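/- **Local notions.** Let $\mathbb R^m_k=[0,\infty)^k\times\mathbb R^{m-k}$, $0\le k\le m$, and let $U\subseteq\mathbb R^m_k$, $V\subseteq\mathbb R^n_l$ be open. For $f:U\to\mathbb R$ the $b$-derivatives are ${}^b\partial_if=x_i\,\partial f/\partial x_i$ for $i\le k$ (defined to be $0$ where $x_i=0$, with no derivative required there), and ${}^b\partial_if=\partial f/\partial x_i$ for $i>k$. A continuous $f$ is *a-smooth* if all iterated $b$-derivatives exist and are continuous on $U$, and for each iterated $b$-derivative $g$ of $f$ (including $g=f$), each $i\le k$ and each compact $S\subseteq U$ there are $C,\alpha>0$ with $|{}^b\partial_ig|\le Cx_i^{\alpha}$ on $S$. A continuous map $f=(f_1,\dots,f_n):U\to V$ is *a-smooth* if $f_j$ is a-smooth for $j>l$, and each $u\in U$ has an open neighbourhood in $U$ on which, for each $j\le l$, either $f_j=F_j\,x_1^{a_{1,j}}\cdots x_k^{a_{k,j}}$ with $F_j>0$ a-smooth and real exponents $a_{i,j}\ge 0$, $a_{i,j}=0$ if $u_i\ne 0$, or $f_j\equiv 0$. It is *strongly a-smooth* if moreover for each $j$ at most one $a_{i,j}$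 is positive. It is *(weakly) smooth* in the ordinary sense if all partial derivatives (one-sided at the boundary) exist and are continuous; *smooth* and *strongly smooth* maps are defined by the same local conditions with "a-smooth" replaced by "weakly smooth" (for all components $f_j$ and for $F_j$), with exponents in $\mathbb N$, and, for strongly smooth, with at most one exponent $a_{i,j}$ equal to $1$ and the others $0$. In both settings $f$ is *interior* if it is (a-)smooth and no $f_j$ with $j\le l$ vanishes identically near a point of $U$. **Manifolds.** A *manifold with corners* (*with a-corners*) of dimension $m$ is a second countable Hausdorff space $X$ with a maximal atlas of charts $(U,\phi)$, where $U\subseteq\mathbb R^m_k$ is open for some $k$ and $\phi$ is a homeomorphism of $U$ onto an open subset of $X$, the transition maps being smooth (a-smooth) bijections with smooth (a-smooth) inverses; for *mixed dimension*, charts of different dimensions $m$ are allowed in one atlas. A continuous map of manifolds is strongly smooth, strongly a-smooth or interior if its local representatives in all charts are. Write $\mathbf{Man^c_{st}}$ and $\mathbf{Man^{ac}_{st}}$ for manifolds with corners and strongly smooth maps, and manifolds with a-corners and strongly a-smooth maps, and $\mathbf{\check Man^c_{st}}$, $\mathbf{\check Man^{ac}_{st}}$ for the versions with mixed dimension. **Theorem.**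 Let $\varphi(0)=0$ and $\varphi(x)=e^{x-1/x}$ for $x>0$. 1. $\varphi:[0,\infty)\to[0,\infty)$ is a homeomorphism, with $\varphi^{-1}(0)=0$ and $\varphi^{-1}(y)=\frac12\bigl(\log y+\sqrt{(\log y)^2+4}\bigr)$ for $y>0$. 2. Let $\Phi=\varphi^k\times\mathrm{id}$ on $\mathbb R^m_k$. If $U\subseteq\mathbb R^m_k$ is open and $f:U\to\mathbb R$ is a-smooth, then all partial derivatives of all orders of $f\circ\Phi:\Phi^{-1}(U)\to\mathbb R$ exist and are continuous (one-sided at the boundary), and a partial derivative involving $\partial/\partial x_i$ with $i\le k$ vanishes where $x_i=0$. 3. For each $a>0$ the map $\Psi:(0,\infty)\times[0,\infty)\to[0,\infty)$, $\Psi(s,t)=\varphi^{-1}\bigl(s\,\varphi(t)^a\bigr)$, is strongly smooth, and $\Psi(s,t)/t\to a^{-1}$ as $t\to 0^+$ for each $s>0$. 4. Let $X$ be a manifold with a-corners. The charts $(\Phi^{-1}(U),\phi\circ\Phi)$, for $(U,\phi)$ in the maximal a-atlas of $X$ with $U\subseteq \mathbb R^m_k$, form an atlas of a manifold with corners on the space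 $X$, of the same dimension. It is contained in a unique maximal atlas, which consists of all charts (of that dimension) compatible with all the charts $(\Phi^{-1}(U),\phi\circ\Phi)$. Write $F(X)$ for the resulting manifold with corners. Then $\mathbf{Man^{ac}_{st}}$ and $\mathbf{Man^c_{st}}$ are categories; every strongly a-smooth map $f:X\to Y$ is strongly smooth as a map $F(X)\to F(Y)$; and $X\mapsto F(X)$, $f\mapsto F(f)=f$ is a functor $F:\mathbf{Man^{ac}_{st}}\to\mathbf{Man^c_{st}}$ that is faithful, is not full, and maps interior morphisms to interior morphisms. 5. The same holds for mixed dimension, giving a functor $\check F:\mathbf{\check Man^{ac}_{st}}\to\mathbf{\check Man^c_{st}}$. Enlarging the maximal ($m$-dimensional) atlas of a manifold to the maximal atlas of mixed dimension containing it makes $\mathbf{Man^{ac}_{st}}$, $\mathbf{Man^c_{st}}$ full subcategories of $\mathbf{\check Man^{ac}_{st}}$, $\mathbf{\check Man^c_{st}}$, and $\check F$ extends $F$. -/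

import Mathlib

open Set Topology CategoryTheory
open scoped ContDiff

universe u

namespace ACorners

/-! ### Local models and maps between open subsets of local models -/

/-- The local model `[0,∞)^k × ℝ^(m-k)` (with `k ≤ m`), as a subset of `ℝ^m`. As a set it is both
the model of manifolds with (ordinary) corners and the model of manifolds with a-corners. -/
def orthant (k m : ℕ) : Set (Fin m → ℝ) := {x | ∀ i : Fin m, (i : ℕ) < k → 0 ≤ x i}

/-- `U` is an open subset of the local model `[0,∞)^k × ℝ^(m-k)`. -/
def IsOpenIn (k : ℕ) {m : ℕ} (U : Set (Fin m → ℝ)) : Prop :=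
  ∃ O : Set (Fin m → ℝ), IsOpen O ∧ U = orthant k m ∩ O

/-- The `i`-th b-derivative of `f` : it is `x_i ∂f/∂x_i` (and `0` where `x_i = 0`) for the first
`k` coordinates, and `∂f/∂x_i` for the remaining ones. -/
noncomputable def bDeriv (k : ℕ) {m : ℕ} (i : Fin m) (f : (Fin m → ℝ) → ℝ) (x : Fin m → ℝ) : ℝ :=
  if (i : ℕ) < k then
    (if x i = 0 then 0 else x i * deriv (fun t => f (Function.update x i t)) (x i))
  else deriv (fun t => f (Function.update x i t)) (x i)

/-- The `i`-th b-derivative of `f` exists on `U`. No derivative in the direction `x_i` is required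
at points with `x_i = 0`, if `x_i` is one of the first `k` coordinates. -/
def BDerivExistsOn (k : ℕ) {m : ℕ} (i : Fin m) (U : Set (Fin m → ℝ)) (f : (Fin m → ℝ) → ℝ) :
    Prop :=
  ∀ x ∈ U, ((i : ℕ) < k → 0 < x i) →
    DifferentiableAt ℝ (fun t => f (Function.update x i t)) (x i)

/-- Iterated b-derivatives, that is, the components of `ᵇ∂^l f` with `l` the length of the list. -/
noncomputable def bDerivIter (k : ℕ) {m : ℕ} (f : (Fin m → ℝ) → ℝ) :
    List (Fin m) → (Fin m → ℝ) → ℝ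
  | [] => f
  | i :: L => bDeriv k i (bDerivIter k f L)

/-- `f` is r-differentiable on `U`: its b-derivative exists and is continuous. -/
def RDifferentiableOn (k : ℕ) {m : ℕ} (U : Set (Fin m → ℝ)) (f : (Fin m → ℝ) → ℝ) : Prop :=
  ∀ i : Fin m, BDerivExistsOn k i U f ∧ ContinuousOn (bDeriv k i f) U

/-- `f` is a-differentiable on `U`: it is r-differentiable, and on each compact subset of `U` the
b-derivative in a boundary coordinate `x_i` is bounded by `C x_i ^ α` for some `C, α > 0`. -/
def ADifferentiableOn (k : ℕ) {m : ℕ} (U : Set (Fin m → ℝ)) (f : (Fin m → ℝ) → ℝ) : Prop :=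
  RDifferentiableOn k U f ∧
    ∀ S : Set (Fin m → ℝ), S ⊆ U → IsCompact S → ∀ i : Fin m, (i : ℕ) < k →
      ∃ C α : ℝ, 0 < C ∧ 0 < α ∧ ∀ x ∈ S, |bDeriv k i f x| ≤ C * x i ^ α

/-- A real function on an open subset `U` of the local model is a-smooth. -/
def ASmoothFunOn (k : ℕ) {m : ℕ} (U : Set (Fin m → ℝ)) (f : (Fin m → ℝ) → ℝ) : Prop :=
  ContinuousOn f U ∧ ∀ L : List (Fin m), ADifferentiableOn k U (bDerivIter k f L)

/-- On `V` we have `g = F · x_1^(a_1) ⋯ x_k^(a_k)`, where `F : V → (0,∞)` is a-smooth, the exponents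
are real and nonnegative, and `a_i = 0` unless `u_i = 0`. (If `V` is a neighbourhood of `u` then
`F` and the exponents are uniquely determined by `g`.) -/
structure IsAFactorization (k : ℕ) {m : ℕ} (V : Set (Fin m → ℝ)) (u : Fin m → ℝ)
    (g : (Fin m → ℝ) → ℝ) (F : (Fin m → ℝ) → ℝ) (a : Fin m → ℝ) : Prop where
  smooth : ASmoothFunOn k V F
  pos : ∀ x ∈ V, 0 < F x
  nonneg : ∀ i, 0 ≤ a i
  support : ∀ i, a i ≠ 0 → (i : ℕ) < k ∧ u i = 0
  eq : ∀ x ∈ V, g x = F x * ∏ i, x i ^ a i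

/-- On `V` we have `g = F · x_1^(a_1) ⋯ x_k^(a_k)`, where `F : V → (0,∞)` is weakly smooth, the
exponents are natural numbers, and `a_i = 0` unless `u_i = 0`. (If `V` is a neighbourhood of `u`
then `F` and the exponents are uniquely determined by `g`.)
On open subsets of a local model, `ContDiffOn ℝ ∞` says that all partial derivatives of all orders
exist and are continuous, including one-sided derivatives at boundary points. -/
structure IsCFactorization (k : ℕ) {m : ℕ} (V : Set (Fin m → ℝ)) (u : Fin m → ℝ)
    (g : (Fin m → ℝ) → ℝ) (F : (Fin m → ℝ) → ℝ) (a : Fin m → ℕ) : Prop where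
  smooth : ContDiffOn ℝ ∞ F V
  pos : ∀ x ∈ V, 0 < F x
  support : ∀ i, a i ≠ 0 → (i : ℕ) < k ∧ u i = 0
  eq : ∀ x ∈ V, g x = F x * ∏ i, x i ^ a i

/-- `f : U → ⟦0,∞)^l × ℝ^(n-l)` is an a-smooth map, and the exponents in the local factorizations of
its first `l` components satisfy the condition `Q`. Here `U ⊆ ⟦0,∞)^k × ℝ^(m-k)` is open. -/
def IsAMapWith (Q : ∀ m : ℕ, (Fin m → ℝ) → Prop) (k l : ℕ) {m n : ℕ} (U : Set (Fin m → ℝ))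
    (f : (Fin m → ℝ) → (Fin n → ℝ)) : Prop :=
  ContinuousOn f U ∧
  (∀ j : Fin n, l ≤ (j : ℕ) → ASmoothFunOn k U (fun x => f x j)) ∧
  ∀ u ∈ U, ∃ W : Set (Fin m → ℝ), IsOpen W ∧ u ∈ W ∧ ∀ j : Fin n, (j : ℕ) < l →
    (∃ F a, IsAFactorization k (W ∩ U) u (fun x => f x j) F a ∧ Q m a) ∨
      (∀ x ∈ W ∩ U, f x j = 0)

/-- `f : U → [0,∞)^l × ℝ^(n-l)` is a smooth map, and the exponents in the local factorizations of
its first `l` components satisfy the condition `Q`. Here `U ⊆ [0,∞)^k × ℝ^(m-k)` is open. -/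
def IsCMapWith (Q : ∀ m : ℕ, (Fin m → ℕ) → Prop) (k l : ℕ) {m n : ℕ} (U : Set (Fin m → ℝ))
    (f : (Fin m → ℝ) → (Fin n → ℝ)) : Prop :=
  ContDiffOn ℝ ∞ f U ∧
  ∀ u ∈ U, ∃ W : Set (Fin m → ℝ), IsOpen W ∧ u ∈ W ∧ ∀ j : Fin n, (j : ℕ) < l →
    (∃ F a, IsCFactorization k (W ∩ U) u (fun x => f x j) F a ∧ Q m a) ∨
      (∀ x ∈ W ∩ U, f x j = 0)

/-- None of the first `l` components of `f` vanishes identically near a point of `U`. -/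
def NowhereLocallyZero (l : ℕ) {m n : ℕ} (U : Set (Fin m → ℝ)) (f : (Fin m → ℝ) → (Fin n → ℝ)) :
    Prop :=
  ∀ u ∈ U, ∀ W : Set (Fin m → ℝ), IsOpen W → u ∈ W → ∀ j : Fin n, (j : ℕ) < l →
    ¬ ∀ x ∈ W ∩ U, f x j = 0

section LocalClasses

variable (k l : ℕ) {m n : ℕ} (U : Set (Fin m → ℝ)) (f : (Fin m → ℝ) → (Fin n → ℝ))

/-- a-smooth maps between open subsets of local models. -/
def ASmooth : Prop := IsAMapWith (fun _ _ => True) k l U f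

/-- Strongly a-smooth maps: each component has at most one positive exponent. -/
def StronglyASmooth : Prop := IsAMapWith (fun _ a => {i | 0 < a i}.Subsingleton) k l U f

/-- Interior maps in the sense of a-corners. -/
def AInterior : Prop := ASmooth k l U f ∧ NowhereLocallyZero l U f

/-- Smooth maps between open subsets of local models of manifolds with corners. -/
def CSmooth : Prop := IsCMapWith (fun _ _ => True) k l U f

/-- Strongly smooth maps: each component has exponent `1` at most once and `0` otherwise. -/
def StronglyCSmooth : Prop :=
  IsCMapWith (fun _ a => {i | a i = 1}.Subsingleton ∧ ∀ i, a i = 1 ∨ a i = 0) k l U f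

/-- Interior maps in the sense of ordinary corners. -/
def CInterior : Prop := CSmooth k l U f ∧ NowhereLocallyZero l U f

/-- `f : U → V` is an a-smooth bijection with a-smooth inverse. -/
def IsADiffeo (V : Set (Fin n → ℝ)) : Prop :=
  ∃ g : (Fin n → ℝ) → (Fin m → ℝ), MapsTo f U V ∧ MapsTo g V U ∧ InvOn g f U V ∧
    ASmooth k l U f ∧ ASmooth l k V g

/-- `f : U → V` is a smooth bijection with smooth inverse. -/
def IsCDiffeo (V : Set (Fin n → ℝ)) : Prop :=
  ∃ g : (Fin n → ℝ) → (Fin m → ℝ), MapsTo f U V ∧ MapsTo g V U ∧ InvOn g f U V ∧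
    CSmooth k l U f ∧ CSmooth l k V g

end LocalClasses

/-! ### Charts and atlases -/

/-- A chart on `X`: a homeomorphism from an open subset `U` of a local model `[0,∞)^k × ℝ^(dim-k)`
onto an open subset of `X`. The same data serves as a chart or as an a-chart; the two notions
differ only in what compatibility means. -/
structure CornerChart (X : Type u) [TopologicalSpace X] where
  dim : ℕ
  k : ℕ
  k_le : k ≤ dim
  U : Set (Fin dim → ℝ)
  isOpenIn : IsOpenIn k U
  toFun : U → X
  isOpenEmbedding : IsOpenEmbedding toFun

section Charts

variable {X Y : Type u} [TopologicalSpace X] [TopologicalSpace Y]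

/-- The inverse of a chart, extended by `0` outside its image. -/
noncomputable def CornerChart.coord (c : CornerChart X) : X → (Fin c.dim → ℝ) :=
  Function.extend c.toFun Subtype.val (fun _ => 0)

/-- The domain `(f ∘ φ)⁻¹(ψ(V))` of the local representative of `f` in charts `(U,φ)`, `(V,ψ)`. -/
def repDomain (c : CornerChart X) (d : CornerChart Y) (f : X → Y) : Set (Fin c.dim → ℝ) :=
  {x | ∃ h : x ∈ c.U, f (c.toFun ⟨x, h⟩) ∈ range d.toFun}

/-- The local representative `ψ⁻¹ ∘ f ∘ φ` of `f` in charts `(U,φ)`, `(V,ψ)`, with junk values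
outside of `repDomain c d f`. -/
noncomputable def rep (c : CornerChart X) (d : CornerChart Y) (f : X → Y) :
    (Fin c.dim → ℝ) → (Fin d.dim → ℝ) :=
  Function.extend Subtype.val (fun x : c.U => d.coord (f (c.toFun x))) (fun _ => 0)

/-- Compatibility of a-charts: the transition map is an a-diffeomorphism. -/
def ACompatible (c d : CornerChart X) : Prop :=
  IsADiffeo c.k d.k (repDomain c d id) (rep c d id) (repDomain d c id)

/-- Compatibility of (ordinary) charts: the transition map is a diffeomorphism. -/
def CCompatible (c d : CornerChart X) : Prop :=
  IsCDiffeo c.k d.k (repDomain c d id) (rep c d id) (repDomain d c id)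

/-- An a-atlas consisting of a-charts with dimensions in `D`. An `m`-dimensional a-atlas is the
case `D = {m}`, an a-atlas of mixed dimension is the case `D = univ`. -/
structure IsAAtlas (D : Set ℕ) (A : Set (CornerChart X)) : Prop where
  dim_mem : ∀ c ∈ A, c.dim ∈ D
  compatible : ∀ c ∈ A, ∀ d ∈ A, ACompatible c d
  cover : ∀ x : X, ∃ c ∈ A, x ∈ range c.toFun

/-- An (ordinary) atlas consisting of charts with dimensions in `D`. -/
structure IsCAtlas (D : Set ℕ) (A : Set (CornerChart X)) : Prop where
  dim_mem : ∀ c ∈ A, c.dim ∈ D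
  compatible : ∀ c ∈ A, ∀ d ∈ A, CCompatible c d
  cover : ∀ x : X, ∃ c ∈ A, x ∈ range c.toFun

/-- All a-charts with dimension in `D` that are compatible with all a-charts in `A`. -/
def aCompletion (D : Set ℕ) (A : Set (CornerChart X)) : Set (CornerChart X) :=
  {d | d.dim ∈ D ∧ ∀ c ∈ A, ACompatible c d}

/-- All charts with dimension in `D` that are compatible with all charts in `A`. -/
def cCompletion (D : Set ℕ) (A : Set (CornerChart X)) : Set (CornerChart X) :=
  {d | d.dim ∈ D ∧ ∀ c ∈ A, CCompatible c d}

end Charts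

/-! ### The categories -/

/-- Whether manifolds are required to have a single dimension. -/
inductive DimType
  | pure
  | mixed

/-- The sets `{m}` for manifolds of dimension `m`, the set `ℕ` for manifolds of mixed dimension. -/
def DimType.Allows : DimType → Set ℕ → Prop
  | .pure, D => ∃ m : ℕ, D = {m}
  | .mixed, D => D = univ

/-- Manifolds with a-corners (of some dimension `m`, or of mixed dimension): second countable
Hausdorff spaces with a maximal a-atlas. -/
structure ManAC (τ : DimType) where
  carrier : Type u
  [top : TopologicalSpace carrier]
  [t2 : T2Space carrier]
  [secondCountable : SecondCountableTopology carrier]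
  dims : Set ℕ
  allows : τ.Allows dims
  atlas : Set (CornerChart carrier)
  maximal : Maximal (IsAAtlas dims) atlas

/-- Manifolds with corners (of some dimension `m`, or of mixed dimension): second countable
Hausdorff spaces with a maximal atlas. -/
structure ManC (τ : DimType) where
  carrier : Type u
  [top : TopologicalSpace carrier]
  [t2 : T2Space carrier]
  [secondCountable : SecondCountableTopology carrier]
  dims : Set ℕ
  allows : τ.Allows dims
  atlas : Set (CornerChart carrier)
  maximal : Maximal (IsCAtlas dims) atlas

attribute [instance] ManAC.top ManAC.t2 ManAC.secondCountable
attribute [instance] ManC.top ManC.t2 ManC.secondCountable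

/-- The ambient category of manifolds with a-corners and all continuous maps; the categories of
interest are wide subcategories of it. -/
instance (τ : DimType) : Category (ManAC.{u} τ) where
  Hom X Y := C(X.carrier, Y.carrier)
  id X := ContinuousMap.id X.carrier
  comp f g := ContinuousMap.comp g f

/-- The ambient category of manifolds with corners and all continuous maps; the categories of
interest are wide subcategories of it. -/
instance (τ : DimType) : Category (ManC.{u} τ) where
  Hom X Y := C(X.carrier, Y.carrier)
  id X := ContinuousMap.id X.carrier
  comp f g := ContinuousMap.comp g f

/-- The continuous map underlying a morphism. -/
def ManAC.map {τ : DimType} {X Y : ManAC.{u} τ} (f : X ⟶ Y) : C(X.carrier, Y.carrier) := f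

/-- The continuous map underlying a morphism. -/
def ManC.map {τ : DimType} {X Y : ManC.{u} τ} (f : X ⟶ Y) : C(X.carrier, Y.carrier) := f

/-- Strongly a-smooth maps of manifolds with a-corners. -/
def ManAC.stronglySmooth (τ : DimType) : MorphismProperty (ManAC.{u} τ) := fun X Y f =>
  ∀ c ∈ X.atlas, ∀ d ∈ Y.atlas,
    StronglyASmooth c.k d.k (repDomain c d (ManAC.map f)) (rep c d (ManAC.map f))

/-- Interior maps of manifolds with a-corners. -/
def ManAC.interior (τ : DimType) : MorphismProperty (ManAC.{u} τ) := fun X Y f =>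
  ∀ c ∈ X.atlas, ∀ d ∈ Y.atlas,
    AInterior c.k d.k (repDomain c d (ManAC.map f)) (rep c d (ManAC.map f))

/-- Strongly smooth maps of manifolds with corners. -/
def ManC.stronglySmooth (τ : DimType) : MorphismProperty (ManC.{u} τ) := fun X Y f =>
  ∀ c ∈ X.atlas, ∀ d ∈ Y.atlas,
    StronglyCSmooth c.k d.k (repDomain c d (ManC.map f)) (rep c d (ManC.map f))

/-- Interior maps of manifolds with corners. -/
def ManC.interior (τ : DimType) : MorphismProperty (ManC.{u} τ) := fun X Y f =>
  ∀ c ∈ X.atlas, ∀ d ∈ Y.atlas,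
    CInterior c.k d.k (repDomain c d (ManC.map f)) (rep c d (ManC.map f))

/-! ### The reparametrisation -/

/-- `φ(x) = exp (x - 1/x)` for `x > 0` and `φ(0) = 0`. Only values at `x ≥ 0` are used. -/
noncomputable def profile (x : ℝ) : ℝ := if x = 0 then 0 else Real.exp (x - x⁻¹)

/-- The inverse of `profile` on `[0,∞)`. -/
noncomputable def profileInv (y : ℝ) : ℝ :=
  if y = 0 then 0 else (Real.log y + √(Real.log y ^ 2 + 4)) / 2

lemma profile_nonneg (x : ℝ) : 0 ≤ profile x := by
  unfold profile; split_ifs <;> positivity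

lemma profileInv_pos {y : ℝ} (hy : y ≠ 0) : 0 < profileInv y := by
  have h : |Real.log y| < √(Real.log y ^ 2 + 4) := by
    rw [← Real.sqrt_sq_eq_abs]; exact Real.sqrt_lt_sqrt (sq_nonneg _) (by linarith)
  have h2 := neg_abs_le (Real.log y)
  simp only [profileInv, hy, if_false]
  linarith

lemma profileInv_nonneg (y : ℝ) : 0 ≤ profileInv y := by
  by_cases hy : y = 0
  · simp [profileInv, hy]
  · exact (profileInv_pos hy).le

lemma profile_profileInv {y : ℝ} (hy : 0 ≤ y) : profile (profileInv y) = y := by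
  rcases hy.eq_or_lt with rfl | hy
  · simp [profile, profileInv]
  · have ht := profileInv_pos hy.ne'
    have hs : √(Real.log y ^ 2 + 4) ^ 2 = Real.log y ^ 2 + 4 := Real.sq_sqrt (by positivity)
    have h : profileInv y - (profileInv y)⁻¹ = Real.log y := by
      have h1 : profileInv y ^ 2 - 1 = Real.log y * profileInv y := by
        simp only [profileInv, hy.ne', if_false]; nlinarith
      field_simp
      linarith
    rw [profile, if_neg ht.ne', h, Real.exp_log hy]

lemma profile_strictMonoOn : StrictMonoOn profile (Ici 0) := by
  intro x hx y _ hxy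
  have hx0 : 0 ≤ x := hx
  have hy0 : 0 < y := lt_of_le_of_lt hx0 hxy
  rcases hx0.eq_or_lt with rfl | hx1
  · simp only [profile, if_true, hy0.ne', if_false]; positivity
  · simp only [profile, hx1.ne', hy0.ne', if_false]
    have := (inv_lt_inv₀ hy0 hx1).2 hxy
    exact Real.exp_lt_exp.2 (by linarith)

/-- `profile` as an order isomorphism, hence a homeomorphism, of `[0,∞)`. -/
noncomputable def profileIso : Ici (0 : ℝ) ≃o Ici (0 : ℝ) :=
  StrictMono.orderIsoOfRightInverse (fun x => ⟨profile x, profile_nonneg x⟩)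
    (fun x y h => profile_strictMonoOn x.2 y.2 h)
    (fun y => ⟨profileInv y, profileInv_nonneg y⟩)
    (fun y => Subtype.ext (profile_profileInv y.2))

lemma profile_continuousOn : ContinuousOn profile (Ici 0) := by
  rw [continuousOn_iff_continuous_domRestrict]
  exact continuous_subtype_val.comp profileIso.continuous

lemma profileInv_continuousOn : ContinuousOn profileInv (Ici 0) := by
  rw [continuousOn_iff_continuous_domRestrict]
  exact continuous_subtype_val.comp profileIso.symm.continuous

lemma profileInv_profile {x : ℝ} (hx : 0 ≤ x) : profileInv (profile x) = x :=
  congrArg Subtype.val (profileIso.symm_apply_apply ⟨x, hx⟩)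

/-- The map `φ^k × id` on the local model. -/
noncomputable def glueMap (k : ℕ) {m : ℕ} (x : Fin m → ℝ) : Fin m → ℝ :=
  fun i => if (i : ℕ) < k then profile (x i) else x i

/-- The map `(φ⁻¹)^k × id` on the local model. -/
noncomputable def glueInv (k : ℕ) {m : ℕ} (x : Fin m → ℝ) : Fin m → ℝ :=
  fun i => if (i : ℕ) < k then profileInv (x i) else x i

lemma glueMap_mem (k : ℕ) {m : ℕ} (x : Fin m → ℝ) : glueMap k x ∈ orthant k m := by
  intro i hi
  simp only [glueMap, hi, if_true]
  exact profile_nonneg _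

lemma glueInv_mem (k : ℕ) {m : ℕ} (x : Fin m → ℝ) : glueInv k x ∈ orthant k m := by
  intro i hi
  simp only [glueInv, hi, if_true]
  exact profileInv_nonneg _

lemma glueMap_glueInv {k m : ℕ} {x : Fin m → ℝ} (hx : x ∈ orthant k m) :
    glueMap k (glueInv k x) = x := by
  funext i
  by_cases hi : (i : ℕ) < k
  · simp [glueMap, glueInv, hi, profile_profileInv (hx i hi)]
  · simp [glueMap, glueInv, hi]

lemma glueInv_glueMap {k m : ℕ} {x : Fin m → ℝ} (hx : x ∈ orthant k m) :
    glueInv k (glueMap k x) = x := by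
  funext i
  by_cases hi : (i : ℕ) < k
  · simp [glueMap, glueInv, hi, profileInv_profile (hx i hi)]
  · simp [glueMap, glueInv, hi]

lemma glueMap_continuousOn (k m : ℕ) : ContinuousOn (glueMap k) (orthant k m) := by
  refine continuousOn_pi.2 fun i => ?_
  by_cases hi : (i : ℕ) < k
  · simp only [glueMap, hi, if_true]
    exact profile_continuousOn.comp (continuous_apply i).continuousOn fun x hx => hx i hi
  · simp only [glueMap, hi, if_false]
    exact (continuous_apply i).continuousOn

lemma glueInv_continuousOn (k m : ℕ) : ContinuousOn (glueInv k) (orthant k m) := by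
  refine continuousOn_pi.2 fun i => ?_
  by_cases hi : (i : ℕ) < k
  · simp only [glueInv, hi, if_true]
    exact profileInv_continuousOn.comp (continuous_apply i).continuousOn fun x hx => hx i hi
  · simp only [glueInv, hi, if_false]
    exact (continuous_apply i).continuousOn

/-- The set `Ũ` of points of the local model that are mapped into `U` by `φ^k × id`. -/
def glueSet (k : ℕ) {m : ℕ} (U : Set (Fin m → ℝ)) : Set (Fin m → ℝ) :=
  orthant k m ∩ glueMap k ⁻¹' U

lemma IsOpenIn.glueSet {k m : ℕ} {U : Set (Fin m → ℝ)} (hU : IsOpenIn k U) :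
    IsOpenIn k (glueSet k U) := by
  obtain ⟨O, hO, rfl⟩ := hU
  obtain ⟨O', hO', h⟩ := continuousOn_iff'.1 (glueMap_continuousOn k m) O hO
  refine ⟨O', hO', ?_⟩
  rw [inter_comm _ O', ← h, ACorners.glueSet, inter_comm, preimage_inter]
  ext x
  simp [glueMap_mem k x]

lemma IsOpenIn.subset_orthant {k m : ℕ} {U : Set (Fin m → ℝ)} (hU : IsOpenIn k U) :
    U ⊆ orthant k m := by
  obtain ⟨O, _, rfl⟩ := hU
  exact inter_subset_left

/-- The homeomorphism `φ^k × id : Ũ → U`. -/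
noncomputable def glueHomeo {k m : ℕ} {U : Set (Fin m → ℝ)} (hU : IsOpenIn k U) :
    glueSet k U ≃ₜ U where
  toFun x := ⟨glueMap k x.1, x.2.2⟩
  invFun y := ⟨glueInv k y.1, glueInv_mem k y.1, by
    rw [mem_preimage, glueMap_glueInv (hU.subset_orthant y.2)]; exact y.2⟩
  left_inv x := Subtype.ext (glueInv_glueMap x.2.1)
  right_inv y := Subtype.ext (glueMap_glueInv (hU.subset_orthant y.2))
  continuous_toFun :=
    ((glueMap_continuousOn k m).mono inter_subset_left).domRestrict.subtype_mk _
  continuous_invFun :=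
    ((glueInv_continuousOn k m).mono hU.subset_orthant).domRestrict.subtype_mk _

/-- The reparametrised chart `(Ũ, φ̃)` of an a-chart. -/
noncomputable def CornerChart.glue {X : Type u} [TopologicalSpace X] (c : CornerChart X) :
    CornerChart X where
  dim := c.dim
  k := c.k
  k_le := c.k_le
  U := glueSet c.k c.U
  isOpenIn := c.isOpenIn.glueSet
  toFun := c.toFun ∘ glueHomeo c.isOpenIn
  isOpenEmbedding := c.isOpenEmbedding.comp (glueHomeo c.isOpenIn).isOpenEmbedding

/-! ### The functor -/

/-- The reparametrisations of all a-charts in the maximal a-atlas of `X`. -/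
def ManAC.gluedCharts {τ : DimType} (X : ManAC.{u} τ) : Set (CornerChart X.carrier) :=
  CornerChart.glue '' X.atlas

/-- All charts that are compatible with the reparametrised a-charts of `X`. -/
def ManAC.gluedAtlas {τ : DimType} (X : ManAC.{u} τ) : Set (CornerChart X.carrier) :=
  cCompletion X.dims X.gluedCharts

/-- The space `X` with the atlas `X.gluedAtlas`, given that this is a maximal atlas. -/
def ManAC.glue {τ : DimType} (X : ManAC.{u} τ) (h : Maximal (IsCAtlas X.dims) X.gluedAtlas) :
    ManC.{u} τ where
  carrier := X.carrier
  dims := X.dims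
  allows := X.allows
  atlas := X.gluedAtlas
  maximal := h

/-- A map of manifolds with a-corners, as a map of the reparametrised manifolds. -/
def ManAC.glueHom {τ : DimType} {X Y : ManAC.{u} τ} (f : X ⟶ Y)
    (hX : Maximal (IsCAtlas X.dims) X.gluedAtlas) (hY : Maximal (IsCAtlas Y.dims) Y.gluedAtlas) :
    X.glue hX ⟶ Y.glue hY :=
  ManAC.map f

/-- The functor from manifolds with a-corners and strongly a-smooth maps to manifolds with corners
and strongly smooth maps, given that it is well defined. -/
def gluingFunctor (τ : DimType) [(ManAC.stronglySmooth.{u} τ).IsMultiplicative]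
    [(ManC.stronglySmooth.{u} τ).IsMultiplicative]
    (hobj : ∀ X : ManAC.{u} τ, Maximal (IsCAtlas X.dims) X.gluedAtlas)
    (hmap : ∀ (X Y : ManAC.{u} τ) (f : X ⟶ Y), ManAC.stronglySmooth τ f →
      ManC.stronglySmooth τ (ManAC.glueHom f (hobj X) (hobj Y))) :
    WideSubcategory (ManAC.stronglySmooth.{u} τ) ⥤ WideSubcategory (ManC.stronglySmooth.{u} τ) where
  obj X := ⟨X.obj.glue (hobj X.obj)⟩
  map {X Y} f := ⟨ManAC.glueHom f.hom (hobj X.obj) (hobj Y.obj), hmap X.obj Y.obj f.hom f.property⟩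
  map_id _ := rfl
  map_comp _ _ := rfl

/-- A manifold with a-corners, regarded as one of mixed dimension. -/
def ManAC.toMixed (X : ManAC.{u} .pure)
    (h : Maximal (IsAAtlas univ) (aCompletion univ X.atlas)) : ManAC.{u} .mixed where
  carrier := X.carrier
  dims := univ
  allows := rfl
  atlas := aCompletion univ X.atlas
  maximal := h

/-- A map of manifolds with a-corners, regarded as a map of manifolds of mixed dimension. -/
def ManAC.toMixedHom {X Y : ManAC.{u} .pure} (f : X ⟶ Y)
    (hX : Maximal (IsAAtlas univ) (aCompletion univ X.atlas))
    (hY : Maximal (IsAAtlas univ) (aCompletion univ Y.atlas)) : X.toMixed hX ⟶ Y.toMixed hY :=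
  ManAC.map f

/-- A manifold with corners, regarded as one of mixed dimension. -/
def ManC.toMixed (X : ManC.{u} .pure)
    (h : Maximal (IsCAtlas univ) (cCompletion univ X.atlas)) : ManC.{u} .mixed where
  carrier := X.carrier
  dims := univ
  allows := rfl
  atlas := cCompletion univ X.atlas
  maximal := h

/-- A map of manifolds with corners, regarded as a map of manifolds of mixed dimension. -/
def ManC.toMixedHom {X Y : ManC.{u} .pure} (f : X ⟶ Y)
    (hX : Maximal (IsCAtlas univ) (cCompletion univ X.atlas))
    (hY : Maximal (IsCAtlas univ) (cCompletion univ Y.atlas)) : X.toMixed hX ⟶ Y.toMixed hY :=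
  ManC.map f

end ACorners

open ACorners

/-! Everything rests on two features of φ: φ'(x) = φ(x)(1 + x⁻²) for x > 0, and φ(x)^α with α > 0 is
smaller than every power of x near 0. For a boundary coordinate the chain rule gives ∂_i(g ∘ Φ) =
((ᵇ∂_i g) ∘ Φ)·(1 + x_i⁻²) where x_i > 0. Hence the functions (g ∘ Φ)·∏ x_i^(-n_i), with g a-smooth
and vanishing on the face x_i = 0 whenever n_i > 0, are closed under partial derivatives up to
finite sums (`IsGluePair.exists_partial`), since ᵇ∂_i g vanishes on that face. They are continuous
up to the boundary, because an a-smooth function vanishing on a face is O(x_i^α) near it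
(`ASmoothFunOn.decaysAt_of_vanishesOnFace`). Smoothness of g ∘ Φ and the vanishing of its
derivatives follow by induction on the order.

For maps, a component F x_i^a turns into φ⁻¹(F(Φ) φ(x_i)^a). With q = t log s + a(t² - 1) one finds
φ⁻¹(s φ(t)^a) = t · 2/(√(q² + 4t²) - q), and the second factor is smooth and positive even at t = 0,
where it equals 1/a. So each exponent a > 0 becomes the exponent 1 (`StronglyASmooth.glue`). This
needs a single positive exponent per component, hence the restriction to strong maps.

Transition maps are not assumed to be strong, but they are invertible. Comparing zero sets of a map
and its inverse leaves at most one positive exponent per component, and this exponent times one of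
the inverse is 1 (`LocalClass.strong_of_inverse`). Therefore the reparametrised charts are
compatible. Composition, transitivity of compatibility and maximality of the completion are the same
for both kinds of atlases, and are proved for an abstract `LocalClass`. Its main analytic input is
closure under composition, which for a-smooth functions is the chain rule for logarithmic
b-derivatives (`ASmoothUpTo.comp`).

The functor does not change underlying maps, so it is faithful. It is not full: φ⁻¹ : [0,∞) → ℝ
becomes the inclusion after reparametrisation, but it is not a-smooth, as t is not O(φ(t)^α). -/

namespace ACorners

open Filter Function

/-! ### Local models -/

/-- The factors of the local model. -/
def orthantFactor (k : ℕ) {m : ℕ} (i : Fin m) : Set ℝ := if (i : ℕ) < k then Ici 0 else univ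

lemma convex_orthantFactor (k : ℕ) {m : ℕ} (i : Fin m) : Convex ℝ (orthantFactor k i) := by
  unfold orthantFactor; split_ifs
  exacts [convex_Ici 0, convex_univ]

lemma orthant_eq_pi (k m : ℕ) : orthant k m = univ.pi (orthantFactor k) := by
  ext x
  simp only [orthant, mem_ofPred_eq, mem_univ_pi, orthantFactor]
  refine forall_congr' fun i => ?_
  split_ifs with h <;> simp [h]

lemma uniqueDiffOn_orthant (k m : ℕ) : UniqueDiffOn ℝ (orthant k m) := by
  rw [orthant_eq_pi]
  refine UniqueDiffOn.univ_pi fun i => ?_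
  unfold orthantFactor; split_ifs
  exacts [uniqueDiffOn_Ici 0, uniqueDiffOn_univ]

lemma isClosed_orthant (k m : ℕ) : IsClosed (orthant k m) := by
  rw [orthant_eq_pi]
  refine isClosed_set_pi fun i _ => ?_
  unfold orthantFactor; split_ifs
  exacts [isClosed_Ici, isClosed_univ]

lemma isOpenIn_orthant (k m : ℕ) : IsOpenIn k (orthant k m) := ⟨univ, isOpen_univ, by simp⟩

lemma IsOpenIn.inter_open {k m : ℕ} {U W : Set (Fin m → ℝ)} (hU : IsOpenIn k U) (hW : IsOpen W) :
    IsOpenIn k (W ∩ U) := by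
  obtain ⟨O, hO, rfl⟩ := hU
  exact ⟨W ∩ O, hW.inter hO, by rw [inter_left_comm]⟩

lemma IsOpenIn.uniqueDiffOn {k m : ℕ} {U : Set (Fin m → ℝ)} (hU : IsOpenIn k U) :
    UniqueDiffOn ℝ U := by
  obtain ⟨O, hO, rfl⟩ := hU
  exact (uniqueDiffOn_orthant k m).inter hO

lemma IsOpenIn.nhdsWithin_eq {k m : ℕ} {U : Set (Fin m → ℝ)} (hU : IsOpenIn k U) {x}
    (hx : x ∈ U) : 𝓝[U] x = 𝓝[orthant k m] x := by
  obtain ⟨O, hO, rfl⟩ := hU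
  exact nhdsWithin_inter_of_mem' (mem_nhdsWithin_of_mem_nhds (hO.mem_nhds hx.2))

lemma IsOpenIn.mem_nhdsWithin {k m : ℕ} {U : Set (Fin m → ℝ)} (hU : IsOpenIn k U) {x}
    (hx : x ∈ U) : U ∈ 𝓝[orthant k m] x := by
  rw [← hU.nhdsWithin_eq hx]; exact self_mem_nhdsWithin

lemma update_mem_orthant {k m : ℕ} {x : Fin m → ℝ} (hx : x ∈ orthant k m) {i : Fin m} {t : ℝ}
    (ht : (i : ℕ) < k → 0 ≤ t) : update x i t ∈ orthant k m := by
  intro j hj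
  by_cases h : j = i
  · subst h; simpa using ht hj
  · simpa [update_of_ne h] using hx j hj

lemma tendsto_update {m : ℕ} (x : Fin m → ℝ) (i : Fin m) :
    Tendsto (fun t => update x i t) (𝓝 (x i)) (𝓝 x) := by
  have : Continuous fun t : ℝ => update x i t := continuous_const.update i continuous_id
  simpa using this.tendsto (x i)

/-- Moving in the direction of an interior coordinate stays in an open subset of the local model. -/
lemma IsOpenIn.eventually_update_mem {k m : ℕ} {U : Set (Fin m → ℝ)} (hU : IsOpenIn k U) {x}
    (hx : x ∈ U) {i : Fin m} (hi : (i : ℕ) < k → 0 < x i) :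
    ∀ᶠ t in 𝓝 (x i), update x i t ∈ U := by
  obtain ⟨O, hO, rfl⟩ := hU
  have h1 : ∀ᶠ t in 𝓝 (x i), update x i t ∈ O :=
    (tendsto_update x i).eventually (hO.mem_nhds hx.2)
  have h2 : ∀ᶠ t in 𝓝 (x i), (i : ℕ) < k → 0 ≤ t := by
    by_cases h : (i : ℕ) < k
    · filter_upwards [lt_mem_nhds (hi h)] with t ht _ using ht.le
    · simp [h]
  filter_upwards [h1, h2] with t h1 h2 using ⟨update_mem_orthant hx.1 h2, h1⟩

/-! ### Differentiability from continuous partial derivatives -/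

/-- Pass from x to z one coordinate at a time. The intermediate points stay in the product set, and
convexity of each factor allows the mean value inequality on each step, with error controlled by the
continuity of the partial derivatives at x. -/
theorem hasFDerivWithinAt_of_partials {m : ℕ} {T : Fin m → Set ℝ} (hT : ∀ i, Convex ℝ (T i))
    {f : (Fin m → ℝ) → ℝ} {D : Fin m → (Fin m → ℝ) → ℝ} {x : Fin m → ℝ} (hx : x ∈ univ.pi T)
    (hd : ∀ᶠ z in 𝓝[univ.pi T] x, ∀ i,
      HasDerivWithinAt (fun t => f (update z i t)) (D i z) (T i) (z i))
    (hc : ∀ i, ContinuousWithinAt (D i) (univ.pi T) x) :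
    HasFDerivWithinAt f (∑ i, D i x • ContinuousLinearMap.proj (R := ℝ) (φ := fun _ => ℝ) i)
      (univ.pi T) x := by
  refine HasFDerivWithinAt.of_isLittleO ?_
  rw [Asymptotics.isLittleO_iff]
  intro c hc0
  -- Each of the m coordinate steps contributes an error ε; dividing by m + 1 also covers m = 0.
  obtain ⟨ε, hε, hεc⟩ : ∃ ε : ℝ, 0 < ε ∧ m * ε ≤ c := by
    refine ⟨c / (m + 1), by positivity, ?_⟩
    rw [mul_div_assoc', div_le_iff₀ (by positivity)]
    nlinarith
  have hcl : ∀ᶠ z in 𝓝[univ.pi T] x, ∀ i, |D i z - D i x| ≤ ε := by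
    rw [eventually_all]
    intro i
    have := Metric.tendsto_nhds.1 (hc i) ε hε
    filter_upwards [this] with z hz using (by simpa [Real.dist_eq] using hz.le)
  obtain ⟨δ, hδ, hball⟩ := Metric.mem_nhdsWithin_iff.1 (hd.and hcl)
  -- Induction on the set `S` of coordinates already moved from x to z.
  have key : ∀ z ∈ Metric.ball x δ ∩ univ.pi T, ∀ S : Finset (Fin m),
      |f (S.piecewise z x) - f x - ∑ i ∈ S, D i x * (z i - x i)| ≤ ∑ i ∈ S, ε * |z i - x i| := by
    intro z hz S
    have hzx : ∀ i, |z i - x i| < δ := fun i => by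
      simpa [Real.dist_eq] using (dist_le_pi_dist z x i).trans_lt hz.1
    have hzT : ∀ i, z i ∈ T i := fun i => hz.2 i (mem_univ i)
    have hxT : ∀ i, x i ∈ T i := fun i => hx i (mem_univ i)
    induction S using Finset.induction_on with
    | empty => simp
    | insert j S hj ih =>
      rw [Finset.sum_insert hj, Finset.sum_insert hj, Finset.piecewise_insert]
      set w := S.piecewise z x with hw
      have hwj : w j = x j := by simp [hw, hj]
      have hmem : ∀ t ∈ T j ∩ Metric.ball (x j) δ,
          update w j t ∈ Metric.ball x δ ∩ univ.pi T := by
        rintro t ⟨ht, ht'⟩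
        refine ⟨?_, fun i _ => ?_⟩
        · rw [Metric.mem_ball, dist_pi_lt_iff hδ]
          intro i
          by_cases h : i = j
          · subst h; simpa using ht'
          · rw [update_of_ne h]
            by_cases hi : i ∈ S
            · simpa [hw, hi, Real.dist_eq] using hzx i
            · simpa [hw, hi] using hδ
        · by_cases h : i = j
          · subst h; simpa using ht
          · rw [update_of_ne h]
            by_cases hi : i ∈ S
            · simpa [hw, hi] using hzT i
            · simpa [hw, hi] using hxT i
      -- With the linear term subtracted, the mean value inequality bounds the error itself.
      have hder : ∀ t ∈ T j ∩ Metric.ball (x j) δ,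
          HasDerivWithinAt (fun t => f (update w j t) - D j x * t)
            (D j (update w j t) - D j x) (T j ∩ Metric.ball (x j) δ) t := by
        intro t ht
        have h1 := (hball (hmem t ht)).1 j
        simp only [update_idem, update_self] at h1
        have h2 : HasDerivWithinAt (fun t => D j x * t) (D j x) (T j ∩ Metric.ball (x j) δ) t := by
          simpa using (hasDerivWithinAt_id t _).const_mul (D j x)
        exact (h1.mono inter_subset_left).sub h2
      have hb : ∀ t ∈ T j ∩ Metric.ball (x j) δ, ‖D j (update w j t) - D j x‖ ≤ ε :=
        fun t ht => (hball (hmem t ht)).2 j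
      have := Convex.norm_image_sub_le_of_norm_hasDerivWithin_le hder hb
        ((hT j).inter (convex_ball _ _)) ⟨hxT j, Metric.mem_ball_self hδ⟩
        ⟨hzT j, by simpa [Real.dist_eq] using hzx j⟩
      rw [Real.norm_eq_abs, Real.norm_eq_abs, ← hwj, update_eq_self, hwj] at this
      refine le_trans ?_ (add_le_add this ih)
      refine le_trans (le_of_eq ?_) (abs_add_le _ _)
      congr 1; ring
  filter_upwards [inter_mem_nhdsWithin (univ.pi T) (Metric.ball_mem_nhds x hδ)] with z hz
  have := key z ⟨hz.2, hz.1⟩ Finset.univ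
  simp only [Finset.piecewise_univ] at this
  rw [Real.norm_eq_abs]
  have e : (∑ i, D i x • ContinuousLinearMap.proj (R := ℝ) (φ := fun _ => ℝ) i) (z - x)
      = ∑ i, D i x * (z i - x i) := by
    simp
  rw [e]
  refine this.trans ?_
  calc ∑ i, ε * |z i - x i| ≤ ∑ _i : Fin m, ε * ‖z - x‖ := by
        refine Finset.sum_le_sum fun i _ => ?_
        gcongr
        exact norm_le_pi_norm (z - x) i
    _ = m * ε * ‖z - x‖ := by simp; ring
    _ ≤ c * ‖z - x‖ := by gcongr

/-! ### The chain rule for b-derivatives along curves -/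

lemma bDeriv_of_eq_zero {k m : ℕ} {i : Fin m} (hi : (i : ℕ) < k) {f : (Fin m → ℝ) → ℝ}
    {x : Fin m → ℝ} (hx : x i = 0) : bDeriv k i f x = 0 := by
  simp [bDeriv, hi, hx]

/-- The derivative of a function with continuous b-derivatives along a curve, the derivatives of
the boundary coordinates of the curve being logarithmic, and the curve staying in the strata. -/
theorem RDifferentiableOn.hasDerivAt_comp {l n : ℕ} {V : Set (Fin n → ℝ)} (hV : IsOpenIn l V)
    {g : (Fin n → ℝ) → ℝ} (hg : RDifferentiableOn l V g) {γ : ℝ → Fin n → ℝ} {t₀ : ℝ}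
    (hγV : ∀ᶠ t in 𝓝 t₀, γ t ∈ V) {γ' : Fin n → ℝ}
    (hγ : ∀ j, HasDerivAt (fun t => γ t j) (if (j : ℕ) < l then γ t₀ j * γ' j else γ' j) t₀)
    (hz : ∀ j : Fin n, (j : ℕ) < l → γ t₀ j = 0 → ∀ᶠ t in 𝓝 t₀, γ t j = 0) :
    HasDerivAt (fun t => g (γ t)) (∑ j, bDeriv l j g (γ t₀) * γ' j) t₀ := by
  classical
  set y := γ t₀ with hy
  have hyV : y ∈ V := hγV.self_of_nhds
  -- `p` retracts onto the stratum of y by killing the boundary coordinates that vanish at y. Near y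
  -- the others are positive on its image, so g ∘ p has honest partial derivatives in all
  -- directions, while γ is fixed by `p` near t₀ thanks to `hz`.
  let p : (Fin n → ℝ) → Fin n → ℝ := fun z j => if (j : ℕ) < l ∧ y j = 0 then 0 else z j
  have hp : Continuous p := continuous_pi fun j => by
    by_cases h : (j : ℕ) < l ∧ y j = 0
    · simp only [p, h, and_self, if_true]; exact continuous_const
    · simp only [p, h, if_false]; exact continuous_apply j
  have hpy : p y = y := by
    funext j
    by_cases h : (j : ℕ) < l ∧ y j = 0
    · simp [p, h]
    · simp [p, h]
  have hpos : ∀ᶠ z in 𝓝 y, ∀ j : Fin n, (j : ℕ) < l → y j ≠ 0 → 0 < z j := by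
    rw [eventually_all]
    intro j
    by_cases h : (j : ℕ) < l ∧ y j ≠ 0
    · have : 0 < y j := lt_of_le_of_ne (hV.subset_orthant hyV j h.1) (Ne.symm h.2)
      filter_upwards [(continuous_apply j).continuousAt.eventually (lt_mem_nhds this)]
        with z hz _ _ using hz
    · filter_upwards with z h1 h2 using absurd ⟨h1, h2⟩ h
  have hpV : ∀ᶠ z in 𝓝 y, p z ∈ V := by
    obtain ⟨O, hO, rfl⟩ := hV
    have : ∀ᶠ z in 𝓝 y, p z ∈ O :=
      hp.continuousAt.eventually (hO.mem_nhds (by rw [hpy]; exact hyV.2))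
    filter_upwards [this, hpos] with z h1 h2
    refine ⟨fun j hj => ?_, h1⟩
    by_cases h : y j = 0
    · simp [p, hj, h]
    · simpa [p, h] using (h2 j hj h).le
  -- The partial derivatives of g ∘ p: b-derivatives divided by the coordinate, and zero in the
  -- killed directions.
  let D : Fin n → (Fin n → ℝ) → ℝ := fun j z =>
    if (j : ℕ) < l then (if y j = 0 then 0 else bDeriv l j g (p z) / z j) else bDeriv l j g (p z)
  have hbc : ∀ j, ContinuousAt (fun z => bDeriv l j g (p z)) y := by
    intro j
    have h1 : ContinuousWithinAt (bDeriv l j g) V (p y) := (hg j).2 _ (by rw [hpy]; exact hyV)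
    exact h1.tendsto.comp (tendsto_nhdsWithin_iff.2 ⟨hp.continuousAt, hpV⟩)
  have hψ : HasFDerivAt (fun z => g (p z))
      (∑ j, D j y • ContinuousLinearMap.proj (R := ℝ) (φ := fun _ => ℝ) j) y := by
    rw [← hasFDerivWithinAt_univ, ← pi_univ univ]
    refine hasFDerivWithinAt_of_partials (T := fun _ => univ) (fun _ => convex_univ)
      (by simp) ?_ ?_
    · rw [pi_univ, nhdsWithin_univ]
      filter_upwards [hpV, hpos] with z hzV hzpos j
      rw [hasDerivWithinAt_univ]
      by_cases h : (j : ℕ) < l ∧ y j = 0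
      · have : (fun t => g (p (update z j t))) = fun _ => g (p z) := by
          funext t
          congr 1
          funext i
          by_cases hi : i = j
          · subst hi; simp [p, h]
          · simp [p, update_of_ne hi]
        simp only [D, h, if_true]
        rw [this]
        exact hasDerivAt_const _ _
      · have hup : ∀ t, p (update z j t) = update (p z) j t := by
          intro t
          funext i
          by_cases hi : i = j
          · subst hi; simp [p, h]
          · simp [p, update_of_ne hi]
        have hpz : p z j = z j := by simp [p, h]
        simp only [hup]
        have hex := (hg j).1 (p z) hzV (fun hj => by
          rw [hpz]; exact hzpos j hj fun h' => h ⟨hj, h'⟩)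
        rw [hpz] at hex
        convert hex.hasDerivAt using 1
        by_cases hj : (j : ℕ) < l
        · have hy0 : y j ≠ 0 := fun h' => h ⟨hj, h'⟩
          have hz0 := (hzpos j hj hy0).ne'
          simp only [D, hj, hy0, if_true, if_false, bDeriv, hpz, hz0]
          field_simp
        · simp only [D, hj, if_false, bDeriv, hpz]
    · intro j
      rw [pi_univ, continuousWithinAt_univ]
      by_cases hj : (j : ℕ) < l
      · by_cases hy0 : y j = 0
        · simp only [D, hj, hy0, if_true]; exact continuousAt_const
        · simp only [D, hj, hy0, if_true, if_false]
          exact (hbc j).div (continuous_apply j).continuousAt hy0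
      · simp only [D, hj, if_false]; exact hbc j
  have hγd : HasDerivAt γ (fun j => if (j : ℕ) < l then y j * γ' j else γ' j) t₀ :=
    hasDerivAt_pi.2 hγ
  have hcomp := HasFDerivAt.comp_hasDerivAt t₀ (show HasFDerivAt _ _ (γ t₀) from hψ) hγd
  have hpγ : (fun t => g (γ t)) =ᶠ[𝓝 t₀] (fun z => g (p z)) ∘ γ := by
    have : ∀ᶠ t in 𝓝 t₀, ∀ j : Fin n, (j : ℕ) < l → y j = 0 → γ t j = 0 := by
      rw [eventually_all]
      intro j
      by_cases h : (j : ℕ) < l ∧ y j = 0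
      · filter_upwards [hz j h.1 h.2] with t ht _ _ using ht
      · filter_upwards with t h1 h2 using absurd ⟨h1, h2⟩ h
    filter_upwards [this] with t ht
    simp only [comp_apply]
    congr 1
    funext j
    by_cases h : (j : ℕ) < l ∧ y j = 0
    · simp [p, h, ht j h.1 h.2]
    · simp [p, h]
  refine (hcomp.congr_of_eventuallyEq hpγ).congr_deriv ?_
  simp only [_root_.sum_apply, _root_.smul_apply,
    ContinuousLinearMap.proj_apply, smul_eq_mul]
  refine Finset.sum_congr rfl fun j _ => ?_
  by_cases hj : (j : ℕ) < l
  · by_cases hy0 : y j = 0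
    · simp [hj, hy0, bDeriv_of_eq_zero hj hy0]
    · simp only [D, hj, hy0, if_true, if_false, hpy]
      field_simp
  · simp only [D, hj, if_false, hpy]

end ACorners

namespace ACorners

open Filter Function

/-! ### Elementary rules for b-derivatives -/

/-- The factor relating the `i`-th b-derivative and the `i`-th partial derivative. -/
def bScale (k : ℕ) {m : ℕ} (i : Fin m) (x : Fin m → ℝ) : ℝ := if (i : ℕ) < k then x i else 1

lemma bScale_pos {k m : ℕ} {i : Fin m} {x : Fin m → ℝ} (hx : (i : ℕ) < k → 0 < x i) :
    0 < bScale k i x := by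
  unfold bScale; split_ifs with h
  exacts [hx h, one_pos]

lemma bDeriv_eq_of_hasDerivAt {k m : ℕ} {i : Fin m} {x : Fin m → ℝ}
    (hx : (i : ℕ) < k → 0 < x i) {f : (Fin m → ℝ) → ℝ} {d : ℝ}
    (hd : HasDerivAt (fun t => f (update x i t)) d (x i)) :
    bDeriv k i f x = bScale k i x * d := by
  unfold bDeriv bScale
  split_ifs with h h'
  · exact absurd h' (hx h).ne'
  · rw [hd.deriv]
  · rw [hd.deriv, one_mul]

lemma BDerivExistsOn.hasDerivAt {k m : ℕ} {i : Fin m} {U : Set (Fin m → ℝ)}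
    {f : (Fin m → ℝ) → ℝ} (hf : BDerivExistsOn k i U f) {x : Fin m → ℝ} (hxU : x ∈ U)
    (hx : (i : ℕ) < k → 0 < x i) :
    HasDerivAt (fun t => f (update x i t)) (bDeriv k i f x / bScale k i x) (x i) := by
  have h := (hf x hxU hx).hasDerivAt
  exact h.congr_deriv
    (by rw [bDeriv_eq_of_hasDerivAt hx h, mul_div_cancel_left₀ _ (bScale_pos hx).ne'])

lemma IsOpenIn.eventuallyEq_update {k m : ℕ} {U : Set (Fin m → ℝ)} (hU : IsOpenIn k U)
    {α : Type*} {f g : (Fin m → ℝ) → α} (h : EqOn f g U) {x} (hx : x ∈ U) {i : Fin m}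
    (hi : (i : ℕ) < k → 0 < x i) :
    (fun t => f (update x i t)) =ᶠ[𝓝 (x i)] fun t => g (update x i t) := by
  filter_upwards [hU.eventually_update_mem hx hi] with t ht using h ht

lemma pos_or_eq_zero {k m : ℕ} {U : Set (Fin m → ℝ)} (hU : IsOpenIn k U) {x} (hx : x ∈ U)
    (i : Fin m) : ((i : ℕ) < k → 0 < x i) ∨ ((i : ℕ) < k ∧ x i = 0) := by
  by_cases h : (i : ℕ) < k
  · rcases (hU.subset_orthant hx i h).eq_or_lt with h0 | h0
    exacts [Or.inr ⟨h, h0.symm⟩, Or.inl fun _ => h0]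
  · exact Or.inl fun h' => absurd h' h

lemma bDeriv_congr {k m : ℕ} {U : Set (Fin m → ℝ)} (hU : IsOpenIn k U)
    {f g : (Fin m → ℝ) → ℝ} (h : EqOn f g U) (i : Fin m) :
    EqOn (bDeriv k i f) (bDeriv k i g) U := by
  intro x hx
  rcases pos_or_eq_zero hU hx i with hi | ⟨hi, h0⟩
  · simp only [bDeriv, (hU.eventuallyEq_update h hx hi).deriv_eq]
  · rw [bDeriv_of_eq_zero hi h0, bDeriv_of_eq_zero hi h0]

lemma BDerivExistsOn.congr {k m : ℕ} {U : Set (Fin m → ℝ)} (hU : IsOpenIn k U)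
    {f g : (Fin m → ℝ) → ℝ} (h : EqOn f g U) {i : Fin m} (hf : BDerivExistsOn k i U f) :
    BDerivExistsOn k i U g := fun x hx hi =>
  (hf x hx hi).congr_of_eventuallyEq (hU.eventuallyEq_update h.symm hx hi)

/-! ### Decay in a boundary coordinate -/

/-- Near `u ∈ U`, the function `h` is bounded by a positive power of `x_i`. -/
def DecaysAt {m : ℕ} (i : Fin m) (U : Set (Fin m → ℝ)) (u : Fin m → ℝ) (h : (Fin m → ℝ) → ℝ) :
    Prop :=
  ∃ C α : ℝ, 0 < C ∧ 0 < α ∧ ∀ᶠ x in 𝓝[U] u, |h x| ≤ C * x i ^ α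

section Decay

variable {k m : ℕ} {U : Set (Fin m → ℝ)} {i : Fin m} {u : Fin m → ℝ} {f g : (Fin m → ℝ) → ℝ}

lemma DecaysAt.congr (hf : DecaysAt i U u f) (h : EqOn f g U) : DecaysAt i U u g := by
  obtain ⟨C, α, hC, hα, hb⟩ := hf
  refine ⟨C, α, hC, hα, ?_⟩
  filter_upwards [hb, self_mem_nhdsWithin] with x hx hxU
  rwa [← h hxU]

lemma eventually_coord_mem_Icc (hU : IsOpenIn k U) (hi : (i : ℕ) < k) (hui : u i = 0) :
    ∀ᶠ x in 𝓝[U] u, x i ∈ Icc (0 : ℝ) 1 := by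
  have h1 : ∀ᶠ x in 𝓝[U] u, x i < 1 :=
    nhdsWithin_le_nhds ((continuous_apply i).continuousAt.eventually
      (gt_mem_nhds (show u i < 1 by rw [hui]; exact one_pos)))
  filter_upwards [h1, self_mem_nhdsWithin] with x hx hxU
  exact ⟨hU.subset_orthant hxU i hi, hx.le⟩

lemma DecaysAt.add (hU : IsOpenIn k U) (hi : (i : ℕ) < k) (hui : u i = 0)
    (hf : DecaysAt i U u f) (hg : DecaysAt i U u g) : DecaysAt i U u (fun x => f x + g x) := by
  obtain ⟨C, α, hC, hα, hb⟩ := hf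
  obtain ⟨C', α', hC', hα', hb'⟩ := hg
  -- Near u one has 0 ≤ x_i ≤ 1, where lowering the exponent weakens the bound.
  refine ⟨C + C', min α α', by positivity, lt_min hα hα', ?_⟩
  filter_upwards [hb, hb', eventually_coord_mem_Icc hU hi hui] with x h1 h2 h3
  have e1 := Real.rpow_le_rpow_of_exponent_ge_of_imp h3.1 h3.2 (min_le_left α α')
    (fun _ h => absurd h hα.ne')
  have e2 := Real.rpow_le_rpow_of_exponent_ge_of_imp h3.1 h3.2 (min_le_right α α')
    (fun _ h => absurd h hα'.ne')
  calc |f x + g x| ≤ |f x| + |g x| := abs_add_le _ _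
    _ ≤ C * x i ^ α + C' * x i ^ α' := add_le_add h1 h2
    _ ≤ C * x i ^ min α α' + C' * x i ^ min α α' := by gcongr
    _ = _ := by ring

lemma DecaysAt.mul_continuous (hU : IsOpenIn k U) (hi : (i : ℕ) < k) (hu : u ∈ U)
    (hf : DecaysAt i U u f) (hg : ContinuousOn g U) : DecaysAt i U u (fun x => f x * g x) := by
  obtain ⟨C, α, hC, hα, hb⟩ := hf
  have h1 : ∀ᶠ x in 𝓝[U] u, |g x| < |g u| + 1 :=
    (hg u hu).abs.eventually (gt_mem_nhds (by linarith))
  refine ⟨C * (|g u| + 1), α, by positivity, hα, ?_⟩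
  filter_upwards [hb, h1, self_mem_nhdsWithin] with x h1 h2 hxU
  have h3 : 0 ≤ x i ^ α := Real.rpow_nonneg (hU.subset_orthant hxU i hi) _
  calc |f x * g x| = |f x| * |g x| := abs_mul _ _
    _ ≤ (C * x i ^ α) * (|g u| + 1) := by gcongr
    _ = _ := by ring

lemma DecaysAt.sum (hU : IsOpenIn k U) (hi : (i : ℕ) < k) (hui : u i = 0) {ι : Type*}
    (s : Finset ι) {f : ι → (Fin m → ℝ) → ℝ} (hf : ∀ j ∈ s, DecaysAt i U u (f j)) :
    DecaysAt i U u (fun x => ∑ j ∈ s, f j x) := by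
  classical
  induction s using Finset.induction_on with
  | empty =>
    refine ⟨1, 1, one_pos, one_pos, ?_⟩
    filter_upwards [eventually_coord_mem_Icc hU hi hui] with x hx
    simpa using hx.1
  | insert j s hj ih =>
    simp only [Finset.sum_insert hj]
    exact (hf j (Finset.mem_insert_self _ _)).add hU hi hui
      (ih fun a ha => hf a (Finset.mem_insert_of_mem ha))

lemma decaysAt_coord (hU : IsOpenIn k U) (hi : (i : ℕ) < k) :
    DecaysAt i U u (fun x => x i) := by
  refine ⟨1, 1, one_pos, one_pos, ?_⟩
  filter_upwards [self_mem_nhdsWithin] with x hx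
  simp [abs_of_nonneg (hU.subset_orthant hx i hi)]

lemma nhdsWithin_open_inter {X : Type*} [TopologicalSpace X] {W U : Set X} (hW : IsOpen W) {u : X}
    (hu : u ∈ W) : 𝓝[W ∩ U] u = 𝓝[U] u := by
  rw [inter_comm]
  exact nhdsWithin_inter_of_mem' (mem_nhdsWithin_of_mem_nhds (hW.mem_nhds hu))

end Decay

/-! ### a-smoothness up to a given order -/

/-- `f` has a-smooth behaviour up to order `N`, with local decay conditions at the boundary. -/
def ASmoothUpTo (k : ℕ) {m : ℕ} (U : Set (Fin m → ℝ)) : ℕ → ((Fin m → ℝ) → ℝ) → Prop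
  | 0, f => ContinuousOn f U
  | N + 1, f => ContinuousOn f U ∧ ∀ i : Fin m, BDerivExistsOn k i U f ∧
      ((i : ℕ) < k → ∀ u ∈ U, u i = 0 → DecaysAt i U u (bDeriv k i f)) ∧
      ASmoothUpTo k U N (bDeriv k i f)

namespace ASmoothUpTo

variable {k m : ℕ} {U : Set (Fin m → ℝ)} {N : ℕ} {f g : (Fin m → ℝ) → ℝ}

lemma continuousOn (hf : ASmoothUpTo k U N f) : ContinuousOn f U := by
  cases N with
  | zero => exact hf
  | succ N => exact hf.1

lemma of_succ (hf : ASmoothUpTo k U (N + 1) f) : ASmoothUpTo k U N f := by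
  induction N generalizing f with
  | zero => exact hf.1
  | succ N ih => exact ⟨hf.1, fun i => ⟨(hf.2 i).1, (hf.2 i).2.1, ih (hf.2 i).2.2⟩⟩

lemma rDifferentiableOn (hf : ASmoothUpTo k U (N + 1) f) : RDifferentiableOn k U f :=
  fun i => ⟨(hf.2 i).1, (hf.2 i).2.2.continuousOn⟩

lemma congr (hU : IsOpenIn k U) (h : EqOn f g U) (hf : ASmoothUpTo k U N f) :
    ASmoothUpTo k U N g := by
  induction N generalizing f g with
  | zero => exact hf.congr h.symm
  | succ N ih =>
    refine ⟨hf.1.congr h.symm, fun i => ⟨(hf.2 i).1.congr hU h, fun hi u hu hui => ?_, ?_⟩⟩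
    · exact ((hf.2 i).2.1 hi u hu hui).congr (bDeriv_congr hU h i)
    · exact ih (bDeriv_congr hU h i) (hf.2 i).2.2

lemma inter_open (hf : ASmoothUpTo k U N f) {W : Set (Fin m → ℝ)} (hW : IsOpen W) :
    ASmoothUpTo k (W ∩ U) N f := by
  induction N generalizing f with
  | zero => exact ContinuousOn.mono hf inter_subset_right
  | succ N ih =>
    refine ⟨hf.1.mono inter_subset_right, fun i => ⟨fun x hx => (hf.2 i).1 x hx.2,
      fun hi u hu hui => ?_, ih (hf.2 i).2.2⟩⟩
    have := (hf.2 i).2.1 hi u hu.2 hui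
    rwa [DecaysAt, ← nhdsWithin_open_inter hW hu.1] at this

lemma of_local (h : ∀ u ∈ U, ∃ W, IsOpen W ∧ u ∈ W ∧ ASmoothUpTo k (W ∩ U) N f) :
    ASmoothUpTo k U N f := by
  have hc : ∀ {f : (Fin m → ℝ) → ℝ},
      (∀ u ∈ U, ∃ W, IsOpen W ∧ u ∈ W ∧ ContinuousOn f (W ∩ U)) → ContinuousOn f U := by
    intro f h u hu
    obtain ⟨W, hW, huW, hf⟩ := h u hu
    have := hf u ⟨huW, hu⟩
    rwa [ContinuousWithinAt, nhdsWithin_open_inter hW huW] at this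
  induction N generalizing f with
  | zero => exact hc h
  | succ N ih =>
    refine ⟨hc fun u hu => ?_, fun i => ⟨fun x hx hxi => ?_, fun hi u hu hui => ?_,
      ih fun u hu => ?_⟩⟩
    · obtain ⟨W, hW, huW, hf⟩ := h u hu
      exact ⟨W, hW, huW, hf.1⟩
    · obtain ⟨W, hW, huW, hf⟩ := h x hx
      exact (hf.2 i).1 x ⟨huW, hx⟩ hxi
    · obtain ⟨W, hW, huW, hf⟩ := h u hu
      have := (hf.2 i).2.1 hi u ⟨huW, hu⟩ hui
      rwa [DecaysAt, nhdsWithin_open_inter hW huW] at this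
    · obtain ⟨W, hW, huW, hf⟩ := h u hu
      exact ⟨W, hW, huW, (hf.2 i).2.2⟩

/-- The criterion behind the closure properties below: it suffices to guess the b-derivatives. Where
x_i > 0 the guess is checked as an ordinary derivative; on the face only the conventional value 0
has to match. -/
lemma of_bDeriv (hU : IsOpenIn k U) (hf : ContinuousOn f U) {D : Fin m → (Fin m → ℝ) → ℝ}
    (hd : ∀ i : Fin m, ∀ x ∈ U, ((i : ℕ) < k → 0 < x i) →
      HasDerivAt (fun t => f (update x i t)) (D i x / bScale k i x) (x i))
    (h0 : ∀ i : Fin m, (i : ℕ) < k → ∀ x ∈ U, x i = 0 → D i x = 0)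
    (hdec : ∀ i : Fin m, (i : ℕ) < k → ∀ u ∈ U, u i = 0 → DecaysAt i U u (D i))
    (hN : ∀ i, ASmoothUpTo k U N (D i)) : ASmoothUpTo k U (N + 1) f := by
  have e : ∀ i, EqOn (D i) (bDeriv k i f) U := by
    intro i x hx
    rcases pos_or_eq_zero hU hx i with hi | ⟨hi, h⟩
    · rw [bDeriv_eq_of_hasDerivAt hi (hd i x hx hi), mul_div_cancel₀ _ (bScale_pos hi).ne']
    · rw [bDeriv_of_eq_zero hi h, h0 i hi x hx h]
  exact ⟨hf, fun i => ⟨fun x hx hi => (hd i x hx hi).differentiableAt,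
    fun hi u hu hui => (hdec i hi u hu hui).congr (e i), (hN i).congr hU (e i)⟩⟩

lemma const (hU : IsOpenIn k U) (c : ℝ) : ASmoothUpTo k U N (fun _ => c) := by
  induction N generalizing c with
  | zero => exact continuousOn_const
  | succ N ih =>
    refine of_bDeriv hU continuousOn_const (D := fun _ _ => 0) (fun i x _ _ => ?_)
      (fun _ _ _ _ _ => rfl) (fun i hi u hu hui => ?_) fun i => ih 0
    · simpa using hasDerivAt_const (x i) c
    -- The zero function decays, being an empty sum.
    · simpa using DecaysAt.sum hU hi hui (ι := Unit) ∅ (f := fun _ _ => 0) (by simp)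

lemma coord (hU : IsOpenIn k U) (i : Fin m) : ASmoothUpTo k U N (fun x => x i) := by
  induction N with
  | zero => exact (continuous_apply i).continuousOn
  | succ N ih =>
    refine of_bDeriv hU (continuous_apply i).continuousOn
      (D := fun j => if j = i then bScale k i else fun _ => 0) (fun j x _ hj => ?_)
      (fun j hj x _ hx => ?_) (fun j hj u hu huj => ?_) fun j => ?_
    · by_cases h : j = i
      · subst h
        simpa [(bScale_pos hj).ne'] using hasDerivAt_id' (x j)
      · simpa [h, update_of_ne (Ne.symm h)] using hasDerivAt_const (x j) (x i)
    · by_cases h : j = i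
      · subst h; simp [bScale, hj, hx]
      · simp [h]
    · by_cases h : j = i
      · subst h
        simp only [if_true]
        exact (decaysAt_coord hU hj).congr fun x _ => by simp [bScale, hj]
      · simp only [h, if_false]
        simpa using DecaysAt.sum hU hj huj (ι := Unit) ∅ (f := fun _ _ => 0) (by simp)
    · by_cases h : j = i
      · subst h
        simp only [if_true]
        by_cases hj : (j : ℕ) < k
        · exact ih.congr hU fun x _ => by simp [bScale, hj]
        · exact (const hU 1).congr hU fun x _ => by simp [bScale, hj]
      · simp only [h, if_false]
        exact const hU 0

lemma add (hU : IsOpenIn k U) (hf : ASmoothUpTo k U N f) (hg : ASmoothUpTo k U N g) :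
    ASmoothUpTo k U N (fun x => f x + g x) := by
  induction N generalizing f g with
  | zero => exact ContinuousOn.add hf hg
  | succ N ih =>
    refine of_bDeriv hU (hf.1.add hg.1) (D := fun i x => bDeriv k i f x + bDeriv k i g x)
      (fun i x hx hi => ?_) (fun i hi x _ hx => ?_) (fun i hi u hu hui => ?_)
      fun i => ih (hf.2 i).2.2 (hg.2 i).2.2
    · rw [add_div]
      exact ((hf.2 i).1.hasDerivAt hx hi).add ((hg.2 i).1.hasDerivAt hx hi)
    · simp [bDeriv_of_eq_zero hi hx]
    · exact ((hf.2 i).2.1 hi u hu hui).add hU hi hui ((hg.2 i).2.1 hi u hu hui)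

lemma mul (hU : IsOpenIn k U) (hf : ASmoothUpTo k U N f) (hg : ASmoothUpTo k U N g) :
    ASmoothUpTo k U N (fun x => f x * g x) := by
  induction N generalizing f g with
  | zero => exact ContinuousOn.mul hf hg
  | succ N ih =>
    refine of_bDeriv hU (hf.1.mul hg.1)
      (D := fun i x => bDeriv k i f x * g x + bDeriv k i g x * f x)
      (fun i x hx hi => ?_) (fun i hi x _ hx => ?_) (fun i hi u hu hui => ?_)
      fun i => (ih (hf.2 i).2.2 hg.of_succ).add hU (ih (hg.2 i).2.2 hf.of_succ)
    · refine (((hf.2 i).1.hasDerivAt hx hi).mul ((hg.2 i).1.hasDerivAt hx hi)).congr_deriv ?_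
      simp only [update_eq_self]
      ring
    · simp [bDeriv_of_eq_zero hi hx]
    · exact (((hf.2 i).2.1 hi u hu hui).mul_continuous hU hi hu hg.1).add hU hi hui
        (((hg.2 i).2.1 hi u hu hui).mul_continuous hU hi hu hf.1)

lemma sum (hU : IsOpenIn k U) {ι : Type*} (s : Finset ι) {f : ι → (Fin m → ℝ) → ℝ}
    (hf : ∀ j ∈ s, ASmoothUpTo k U N (f j)) : ASmoothUpTo k U N (fun x => ∑ j ∈ s, f j x) := by
  classical
  induction s using Finset.induction_on with
  | empty => simpa using const hU 0
  | insert j s hj ih =>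
    simp only [Finset.sum_insert hj]
    exact (hf j (Finset.mem_insert_self _ _)).add hU
      (ih fun a ha => hf a (Finset.mem_insert_of_mem ha))

lemma comp_real (hU : IsOpenIn k U) {Ω : Set ℝ} (hΩ : IsOpen Ω) {φ : ℝ → ℝ}
    (hφ : ContDiffOn ℝ ∞ φ Ω) (hf : ASmoothUpTo k U N f) (hm : MapsTo f U Ω) :
    ASmoothUpTo k U N (fun x => φ (f x)) := by
  induction N generalizing φ with
  | zero => exact hφ.continuousOn.comp hf hm
  | succ N ih =>
    have h := (contDiffOn_infty_iff_deriv_of_isOpen hΩ).1 hφ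
    have hc : ContinuousOn (fun x => deriv φ (f x)) U := h.2.continuousOn.comp hf.1 hm
    refine of_bDeriv hU (hφ.continuousOn.comp hf.1 hm)
      (D := fun i x => bDeriv k i f x * deriv φ (f x))
      (fun i x hx hi => ?_) (fun i hi x _ hx => ?_) (fun i hi u hu hui => ?_)
      fun i => (hf.2 i).2.2.mul hU (ih h.2 hf.of_succ)
    · have h1 : HasDerivAt φ (deriv φ (f x)) (f (update x i (x i))) := by
        rw [update_eq_self]
        exact (h.1.differentiableAt (hΩ.mem_nhds (hm hx))).hasDerivAt
      refine (h1.comp (x i) ((hf.2 i).1.hasDerivAt hx hi)).congr_deriv ?_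
      ring
    · simp [bDeriv_of_eq_zero hi hx]
    · exact ((hf.2 i).2.1 hi u hu hui).mul_continuous hU hi hu hc

end ASmoothUpTo

/-! ### Comparison with a-smooth functions -/

lemma bDerivIter_append (k : ℕ) {m : ℕ} (f : (Fin m → ℝ) → ℝ) (L L' : List (Fin m)) :
    bDerivIter k f (L ++ L') = bDerivIter k (bDerivIter k f L') L := by
  induction L with
  | nil => rfl
  | cons i L ih => simp [bDerivIter, ih]

section Comparison

variable {k m : ℕ} {U : Set (Fin m → ℝ)} {f : (Fin m → ℝ) → ℝ}

/-- An open subset of the local model contains compact neighbourhoods of its points. -/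
lemma IsOpenIn.exists_compact (hU : IsOpenIn k U) {u : Fin m → ℝ} (hu : u ∈ U) :
    ∃ ε > 0, orthant k m ∩ Metric.closedBall u ε ⊆ U ∧
      IsCompact (orthant k m ∩ Metric.closedBall u ε) := by
  obtain ⟨O, hO, rfl⟩ := hU
  obtain ⟨ε, hε, h⟩ := Metric.nhds_basis_closedBall.mem_iff.1 (hO.mem_nhds hu.2)
  exact ⟨ε, hε, inter_subset_inter_right _ h,
    (isCompact_closedBall u ε).inter_left (isClosed_orthant k m)⟩

lemma ADifferentiableOn.decaysAt (hU : IsOpenIn k U) (hf : ADifferentiableOn k U f) {i : Fin m}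
    (hi : (i : ℕ) < k) {u} (hu : u ∈ U) : DecaysAt i U u (bDeriv k i f) := by
  obtain ⟨ε, hε, hsub, hcomp⟩ := hU.exists_compact hu
  obtain ⟨C, α, hC, hα, hb⟩ := hf.2 _ hsub hcomp i hi
  refine ⟨C, α, hC, hα, ?_⟩
  filter_upwards [self_mem_nhdsWithin,
    nhdsWithin_le_nhds (Metric.closedBall_mem_nhds u hε)] with x hxU hxb
  exact hb x ⟨hU.subset_orthant hxU, hxb⟩

/-- Local decay of a continuous function in a boundary coordinate implies decay on compacta. -/
lemma exists_bound_of_decaysAt (hU : IsOpenIn k U) {i : Fin m} (hi : (i : ℕ) < k)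
    (hf : ContinuousOn f U) (hd : ∀ u ∈ U, u i = 0 → DecaysAt i U u f)
    {S : Set (Fin m → ℝ)} (hS : S ⊆ U) (hc : IsCompact S) :
    ∃ C α : ℝ, 0 < C ∧ 0 < α ∧ ∀ x ∈ S, |f x| ≤ C * x i ^ α := by
  obtain ⟨R, hR1, hR⟩ : ∃ R : ℝ, 1 ≤ R ∧ ∀ x ∈ S, x i ≤ R := by
    obtain ⟨R, hR⟩ := (hc.image (continuous_apply i)).bddAbove
    exact ⟨max R 1, le_max_right _ _, fun x hx => (hR ⟨x, hx, rfl⟩).trans (le_max_left _ _)⟩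
  have hS0 : ∀ x ∈ S, 0 ≤ x i := fun x hx => hU.subset_orthant (hS hx) i hi
  -- The inequality x^α = x^(α-β) x^β ≤ R^(α-β) x^β brings bounds with different exponents to the
  -- smaller one.
  have hweak : ∀ {x : Fin m → ℝ} {β α : ℝ}, x ∈ S → 0 < β → β ≤ α →
      x i ^ α ≤ R ^ (α - β) * x i ^ β := by
    intro x β α hx hβ hβα
    rcases (hS0 x hx).eq_or_lt with h0 | h0
    · rw [← h0, Real.zero_rpow hβ.ne', Real.zero_rpow (hβ.trans_le hβα).ne', mul_zero]
    · calc x i ^ α = x i ^ (α - β) * x i ^ β := by rw [← Real.rpow_add h0]; congr 1; ring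
        _ ≤ _ := by
          have := Real.rpow_le_rpow h0.le (hR x hx) (sub_nonneg.2 hβα)
          gcongr
  -- Having such a bound passes to finite unions, so by compactness it is enough to have it near
  -- each point.
  refine hc.induction_on (p := fun T => ∃ C α : ℝ, 0 < C ∧ 0 < α ∧
    ∀ x ∈ S ∩ T, |f x| ≤ C * x i ^ α) ?_ ?_ ?_ ?_ |>.imp fun C h => h.imp fun α h =>
      ⟨h.1, h.2.1, fun x hx => h.2.2 x ⟨hx, hx⟩⟩
  · exact ⟨1, 1, one_pos, one_pos, by simp⟩
  · rintro T T' hT ⟨C, α, hC, hα, h⟩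
    exact ⟨C, α, hC, hα, fun x hx => h x ⟨hx.1, hT hx.2⟩⟩
  · rintro T T' ⟨C, α, hC, hα, h⟩ ⟨C', α', hC', hα', h'⟩
    have hβ := lt_min hα hα'
    refine ⟨C * R ^ (α - min α α') + C' * R ^ (α' - min α α'), min α α', by positivity, hβ, ?_⟩
    rintro x ⟨hx, hxT⟩
    have hx0 : 0 ≤ x i ^ min α α' := Real.rpow_nonneg (hS0 x hx) _
    have hp : 0 ≤ R ^ (α - min α α') * x i ^ min α α' := by positivity
    have hp' : 0 ≤ R ^ (α' - min α α') * x i ^ min α α' := by positivity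
    rcases hxT with hxT | hxT
    · calc |f x| ≤ C * x i ^ α := h x ⟨hx, hxT⟩
        _ ≤ C * (R ^ (α - min α α') * x i ^ min α α') := by
          gcongr; exact hweak hx hβ (min_le_left _ _)
        _ ≤ _ := by nlinarith
    · calc |f x| ≤ C' * x i ^ α' := h' x ⟨hx, hxT⟩
        _ ≤ C' * (R ^ (α' - min α α') * x i ^ min α α') := by
          gcongr; exact hweak hx hβ (min_le_right _ _)
        _ ≤ _ := by nlinarith
  · intro u hu
    have hev : ∃ C α : ℝ, 0 < C ∧ 0 < α ∧ ∀ᶠ x in 𝓝[S] u, |f x| ≤ C * x i ^ α := by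
      rcases (hS0 u hu).eq_or_lt with h0 | h0
      · obtain ⟨C, α, hC, hα, h⟩ := hd u (hS hu) h0.symm
        exact ⟨C, α, hC, hα, nhdsWithin_mono u hS h⟩
      -- Off the face nothing has to decay: x_i > u_i/2 nearby, so a bound on f is also a bound by a
      -- multiple of x_i.
      · refine ⟨(|f u| + 1) / (u i / 2), 1, by positivity, one_pos, ?_⟩
        have h1 : ∀ᶠ x in 𝓝[S] u, |f x| < |f u| + 1 :=
          ((hf u (hS hu)).mono hS).abs.eventually (gt_mem_nhds (by linarith))
        have h2 : ∀ᶠ x in 𝓝[S] u, u i / 2 < x i :=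
          nhdsWithin_le_nhds ((continuous_apply i).continuousAt.eventually
            (lt_mem_nhds (by linarith)))
        filter_upwards [h1, h2] with x hx1 hx2
        rw [Real.rpow_one, div_mul_eq_mul_div, le_div_iff₀ (by positivity)]
        exact mul_le_mul hx1.le hx2.le (by positivity) (by positivity)
    obtain ⟨C, α, hC, hα, h⟩ := hev
    exact ⟨_, h, C, α, hC, hα, fun x hx => hx.2⟩

/-- Bounds on compacta and local decay at the faces agree because `U` is locally compact and
compacta are finitely covered. The recursion on the order removes the innermost derivative, while
lists of indices start with the outermost one, hence `bDerivIter_append`. -/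
theorem aSmoothFunOn_iff (hU : IsOpenIn k U) :
    ASmoothFunOn k U f ↔ ∀ N, ASmoothUpTo k U N f := by
  constructor
  · intro hf N
    induction N generalizing f with
    | zero => exact hf.1
    | succ N ih =>
      refine ⟨hf.1, fun i => ⟨((hf.2 []).1 i).1, fun hi u hu _ => (hf.2 []).decaysAt hU hi hu,
        ih ⟨((hf.2 []).1 i).2, fun L => ?_⟩⟩⟩
      have := hf.2 (L ++ [i])
      rwa [bDerivIter_append] at this
  · intro hf
    refine ⟨hf 0, fun L => ?_⟩
    have hL : ∀ N, ASmoothUpTo k U N (bDerivIter k f L) := by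
      induction L with
      | nil => exact hf
      | cons i L ih => exact fun N => ((ih (N + 1)).2 i).2.2
    exact ⟨(hL 1).rDifferentiableOn, fun S hS hc i hi =>
      exists_bound_of_decaysAt hU hi (((hL 1).2 i).2.2.continuousOn) (((hL 1).2 i).2.1 hi) hS hc⟩

end Comparison

namespace ASmoothFunOn

variable {k m : ℕ} {U : Set (Fin m → ℝ)} {f g : (Fin m → ℝ) → ℝ}

lemma bDeriv (hU : IsOpenIn k U) (hf : ASmoothFunOn k U f) (i : Fin m) :
    ASmoothFunOn k U (bDeriv k i f) :=
  (aSmoothFunOn_iff hU).2 fun N => (((aSmoothFunOn_iff hU).1 hf (N + 1)).2 i).2.2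

lemma bDerivExistsOn (hf : ASmoothFunOn k U f) (i : Fin m) : BDerivExistsOn k i U f :=
  ((hf.2 []).1 i).1

lemma decaysAt (hU : IsOpenIn k U) (hf : ASmoothFunOn k U f) {i : Fin m} (hi : (i : ℕ) < k) {u}
    (hu : u ∈ U) : DecaysAt i U u (ACorners.bDeriv k i f) :=
  (hf.2 []).decaysAt hU hi hu

lemma congr (hU : IsOpenIn k U) (hf : ASmoothFunOn k U f) (h : EqOn f g U) :
    ASmoothFunOn k U g :=
  (aSmoothFunOn_iff hU).2 fun N => ((aSmoothFunOn_iff hU).1 hf N).congr hU h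

lemma inter_open (hU : IsOpenIn k U) (hf : ASmoothFunOn k U f) {W : Set (Fin m → ℝ)}
    (hW : IsOpen W) : ASmoothFunOn k (W ∩ U) f :=
  (aSmoothFunOn_iff (hU.inter_open hW)).2 fun N => ((aSmoothFunOn_iff hU).1 hf N).inter_open hW

lemma of_local (hU : IsOpenIn k U)
    (h : ∀ u ∈ U, ∃ W, IsOpen W ∧ u ∈ W ∧ ASmoothFunOn k (W ∩ U) f) : ASmoothFunOn k U f :=
  (aSmoothFunOn_iff hU).2 fun N => ASmoothUpTo.of_local fun u hu => by
    obtain ⟨W, hW, huW, hf⟩ := h u hu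
    exact ⟨W, hW, huW, (aSmoothFunOn_iff (hU.inter_open hW)).1 hf N⟩

lemma const (hU : IsOpenIn k U) (c : ℝ) : ASmoothFunOn k U (fun _ => c) :=
  (aSmoothFunOn_iff hU).2 fun _ => ASmoothUpTo.const hU c

lemma coord (hU : IsOpenIn k U) (i : Fin m) : ASmoothFunOn k U (fun x => x i) :=
  (aSmoothFunOn_iff hU).2 fun _ => ASmoothUpTo.coord hU i

lemma add (hU : IsOpenIn k U) (hf : ASmoothFunOn k U f) (hg : ASmoothFunOn k U g) :
    ASmoothFunOn k U (fun x => f x + g x) :=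
  (aSmoothFunOn_iff hU).2 fun N =>
    ((aSmoothFunOn_iff hU).1 hf N).add hU ((aSmoothFunOn_iff hU).1 hg N)

lemma mul (hU : IsOpenIn k U) (hf : ASmoothFunOn k U f) (hg : ASmoothFunOn k U g) :
    ASmoothFunOn k U (fun x => f x * g x) :=
  (aSmoothFunOn_iff hU).2 fun N =>
    ((aSmoothFunOn_iff hU).1 hf N).mul hU ((aSmoothFunOn_iff hU).1 hg N)

lemma comp_real (hU : IsOpenIn k U) {Ω : Set ℝ} (hΩ : IsOpen Ω) {φ : ℝ → ℝ}
    (hφ : ContDiffOn ℝ ∞ φ Ω) (hf : ASmoothFunOn k U f) (hm : MapsTo f U Ω) :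
    ASmoothFunOn k U (fun x => φ (f x)) :=
  (aSmoothFunOn_iff hU).2 fun N => ((aSmoothFunOn_iff hU).1 hf N).comp_real hU hΩ hφ hm

lemma rpow (hU : IsOpenIn k U) (hf : ASmoothFunOn k U f) (hpos : ∀ x ∈ U, 0 < f x) (b : ℝ) :
    ASmoothFunOn k U (fun x => f x ^ b) :=
  hf.comp_real hU isOpen_Ioi (φ := fun t => t ^ b)
    (contDiffOn_id.rpow_const_of_ne fun _ hx => (mem_Ioi.1 hx).ne') hpos

end ASmoothFunOn

end ACorners

namespace ACorners

open Filter Function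

/-! ### Composition of a-smooth functions with a-smooth maps -/

/-- `M` is the b-derivative in direction `i` of the `j`-th component of `f`, logarithmic if `j < l`
(with arbitrary values where this component vanishes). -/
structure IsLogBDeriv (k l : ℕ) {m n : ℕ} (U : Set (Fin m → ℝ)) (f : (Fin m → ℝ) → (Fin n → ℝ))
    (i : Fin m) (j : Fin n) (M : (Fin m → ℝ) → ℝ) : Prop where
  smooth : ASmoothFunOn k U M
  deriv : ∀ x ∈ U, ((i : ℕ) < k → 0 < x i) → HasDerivAt (fun t => f (update x i t) j)
    (if (j : ℕ) < l then f x j * (M x / bScale k i x) else M x / bScale k i x) (x i)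
  zero : ∀ x ∈ U, ((i : ℕ) < k → 0 < x i) → (j : ℕ) < l → f x j = 0 →
    ∀ᶠ t in 𝓝 (x i), f (update x i t) j = 0
  boundary : (i : ℕ) < k → ∀ x ∈ U, x i = 0 → ((j : ℕ) < l ∧ f x j = 0) ∨ M x = 0
  decays : (i : ℕ) < k → ∀ u ∈ U, u i = 0 → DecaysAt i U u M ∨
    ((j : ℕ) < l ∧ f u j = 0 ∧ DecaysAt i U u (fun x => f x j))

/-- Inserting one power bound into the other multiplies the exponents. -/
lemma DecaysAt.comp {k l m n : ℕ} {U : Set (Fin m → ℝ)} {V : Set (Fin n → ℝ)}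
    (hU : IsOpenIn k U) (hV : IsOpenIn l V) {f : (Fin m → ℝ) → (Fin n → ℝ)}
    (hf : ContinuousOn f U) (hfV : MapsTo f U V) {i : Fin m} {j : Fin n} (hi : (i : ℕ) < k)
    (hj : (j : ℕ) < l) {u} (hu : u ∈ U) {g : (Fin n → ℝ) → ℝ} (hg : DecaysAt j V (f u) g)
    (hd : DecaysAt i U u (fun x => f x j)) : DecaysAt i U u (fun x => g (f x)) := by
  obtain ⟨C, α, hC, hα, hb⟩ := hg
  obtain ⟨C', α', hC', hα', hb'⟩ := hd
  have ht : Tendsto f (𝓝[U] u) (𝓝[V] f u) := (hf u hu).tendsto_nhdsWithin hfV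
  refine ⟨C * C' ^ α, α' * α, by positivity, by positivity, ?_⟩
  filter_upwards [ht.eventually hb, hb', self_mem_nhdsWithin] with x h1 h2 hx
  have hx0 : 0 ≤ x i := hU.subset_orthant hx i hi
  have hf0 : 0 ≤ f x j := hV.subset_orthant (hfV hx) j hj
  rw [abs_of_nonneg hf0] at h2
  calc |g (f x)| ≤ C * f x j ^ α := h1
    _ ≤ C * (C' * x i ^ α') ^ α := by
      have := Real.rpow_le_rpow hf0 h2 hα.le
      gcongr
    _ = _ := by
      rw [Real.mul_rpow hC'.le (Real.rpow_nonneg hx0 _), ← Real.rpow_mul hx0]; ring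

/-- The chain rule reads ᵇ∂_i(g ∘ f) = ∑_j ((ᵇ∂_j g) ∘ f)·M_ij with a-smooth M_ij, so induction on
the order applies. Each summand decays in x_i for one of two reasons: either M_ij decays, or f_j
does, and then so does (ᵇ∂_j g) ∘ f. -/
theorem ASmoothUpTo.comp {k l m n : ℕ} {U : Set (Fin m → ℝ)} {V : Set (Fin n → ℝ)}
    (hU : IsOpenIn k U) (hV : IsOpenIn l V) {f : (Fin m → ℝ) → (Fin n → ℝ)}
    (hf : ContinuousOn f U) (hfV : MapsTo f U V) {M : Fin m → Fin n → (Fin m → ℝ) → ℝ}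
    (hM : ∀ i j, IsLogBDeriv k l U f i j (M i j)) {N : ℕ} {g : (Fin n → ℝ) → ℝ}
    (hg : ASmoothUpTo l V N g) : ASmoothUpTo k U N (fun x => g (f x)) := by
  induction N generalizing g with
  | zero => exact ContinuousOn.comp hg hf hfV
  | succ N ih =>
    have hMN : ∀ i j, ∀ N, ASmoothUpTo k U N (M i j) := fun i j =>
      (aSmoothFunOn_iff hU).1 (hM i j).smooth
    refine of_bDeriv hU (hg.1.comp hf hfV)
      (D := fun i x => ∑ j, bDeriv l j g (f x) * M i j x)
      (fun i x hx hi => ?_) (fun i hi x hx hxi => ?_) (fun i hi u hu hui => ?_)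
      fun i => sum hU _ fun j _ => (ih (hg.2 j).2.2).mul hU (hMN i j N)
    · have hx' : f x = f (update x i (x i)) := by rw [update_eq_self]
      refine (hg.rDifferentiableOn.hasDerivAt_comp hV (γ := fun t => f (update x i t))
        (γ' := fun j => M i j x / bScale k i x) ?_ (fun j => ?_) fun j hj h0 => ?_).congr_deriv ?_
      · filter_upwards [hU.eventually_update_mem hx hi] with t ht using hfV ht
      · simpa only [update_eq_self] using (hM i j).deriv x hx hi
      · exact (hM i j).zero x hx hi hj (by simpa only [update_eq_self] using h0)
      · simp only [update_eq_self, Finset.sum_div, mul_div_assoc]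
    · refine Finset.sum_eq_zero fun j _ => ?_
      rcases (hM i j).boundary hi x hx hxi with ⟨hj, h⟩ | h
      · rw [bDeriv_of_eq_zero hj h, zero_mul]
      · rw [h, mul_zero]
    · refine DecaysAt.sum hU hi hui _ fun j _ => ?_
      have hc : ContinuousOn (fun x => bDeriv l j g (f x)) U :=
        (hg.2 j).2.2.continuousOn.comp hf hfV
      rcases (hM i j).decays hi u hu hui with h | ⟨hj, h0, h⟩
      · exact (h.mul_continuous hU hi hu hc).congr fun x _ => mul_comm _ _
      · exact (((hg.2 j).2.1 hj (f u) (hfV hu) h0).comp hU hV hf hfV hi hj hu h).mul_continuous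
          hU hi hu (hMN i j 0)

lemma prod_rpow_update {m : ℕ} (a x : Fin m → ℝ) (i : Fin m) (t : ℝ) :
    ∏ r, update x i t r ^ a r = t ^ a i * ∏ r ∈ Finset.univ.erase i, x r ^ a r := by
  rw [← Finset.mul_prod_erase _ _ (Finset.mem_univ i), update_self]
  congr 1
  refine Finset.prod_congr rfl fun r hr => ?_
  rw [update_of_ne (Finset.ne_of_mem_erase hr)]

lemma continuous_prod_rpow {m : ℕ} {a : Fin m → ℝ} (ha : ∀ i, 0 ≤ a i) (s : Finset (Fin m)) :
    Continuous fun x : Fin m → ℝ => ∏ i ∈ s, x i ^ a i :=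
  continuous_finsetProd _ fun i _ => (continuous_apply i).rpow_const fun _ => Or.inr (ha i)

/-- The logarithmic b-derivative of `F x_1^{a_1} ⋯ x_k^{a_k}`. -/
lemma isLogBDeriv_of_factorization {k l m n : ℕ} {U : Set (Fin m → ℝ)} (hU : IsOpenIn k U)
    {f : (Fin m → ℝ) → (Fin n → ℝ)} {j : Fin n} (hj : (j : ℕ) < l) {F : (Fin m → ℝ) → ℝ}
    {a : Fin m → ℝ} (hF : ASmoothFunOn k U F) (hpos : ∀ x ∈ U, 0 < F x) (ha : ∀ i, 0 ≤ a i)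
    (hak : ∀ i, a i ≠ 0 → (i : ℕ) < k) (heq : ∀ x ∈ U, f x j = F x * ∏ i, x i ^ a i) (i : Fin m) :
    IsLogBDeriv k l U f i j (fun x => bDeriv k i F x * F x ^ (-1 : ℝ) + a i) := by
  have hderiv : ∀ x ∈ U, ((i : ℕ) < k → 0 < x i) → HasDerivAt (fun t => f (update x i t) j)
      (f x j * ((bDeriv k i F x * F x ^ (-1 : ℝ) + a i) / bScale k i x)) (x i) := by
    intro x hx hi
    have hs := bScale_pos hi
    have hpow : HasDerivAt (fun t : ℝ => t ^ a i) (x i ^ a i * (a i / bScale k i x)) (x i) := by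
      by_cases h : a i = 0
      · simpa [h] using hasDerivAt_const (x i) (1 : ℝ)
      · have hk := hak i h
        have hx0 := hi hk
        refine (Real.hasDerivAt_rpow_const (p := a i) (Or.inl hx0.ne')).congr_deriv ?_
        rw [Real.rpow_sub hx0, Real.rpow_one, bScale, if_pos hk]
        ring
    have hev := hU.eventuallyEq_update (f := fun x => f x j)
      (g := fun x => F x * ∏ i, x i ^ a i) heq hx hi
    refine (((hF.bDerivExistsOn i).hasDerivAt hx hi).mul
      (hpow.mul_const (∏ r ∈ Finset.univ.erase i, x r ^ a r))).congr_of_eventuallyEq ?_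
      |>.congr_deriv ?_
    · filter_upwards [hev] with t ht
      rw [ht, prod_rpow_update]
      rfl
    · have hFx := (hpos x hx).ne'
      rw [heq x hx, ← Finset.mul_prod_erase _ _ (Finset.mem_univ i), update_eq_self,
        Real.rpow_neg_one]
      field_simp
  refine ⟨((hF.bDeriv hU i).mul hU (hF.rpow hU hpos _)).add hU (ASmoothFunOn.const hU _),
    fun x hx hi => ?_, fun x hx hi _ h0 => ?_, fun hi x hx hxi => ?_, fun hi u hu hui => ?_⟩
  · rw [if_pos hj]; exact hderiv x hx hi
  · rw [heq x hx] at h0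
    rcases mul_eq_zero.1 h0 with h | h
    · exact absurd h (hpos x hx).ne'
    · obtain ⟨r, -, hr⟩ := Finset.prod_eq_zero_iff.1 h
      have har : a r ≠ 0 := by
        intro h'; simp [h'] at hr
      have hxr : x r = 0 :=
        ((Real.rpow_eq_zero_iff_of_nonneg (hU.subset_orthant hx r (hak r har))).1 hr).1
      -- The factor that vanishes belongs to a coordinate other than x_i, so it persists when x_i
      -- varies.
      have hri : r ≠ i := by
        rintro rfl; exact (hi (hak r har)).ne' hxr
      filter_upwards [hU.eventually_update_mem hx hi] with t ht
      rw [heq _ ht, Finset.prod_eq_zero (Finset.mem_univ r), mul_zero]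
      rw [update_of_ne hri, hxr, Real.zero_rpow har]
  -- If a_i ≠ 0, the logarithmic derivative equals a_i on the face and does not vanish there, but
  -- the component itself does. The same dichotomy gives the decay below.
  · by_cases h : a i = 0
    · right; simp [h, bDeriv_of_eq_zero hi hxi]
    · left
      refine ⟨hj, ?_⟩
      rw [heq x hx, Finset.prod_eq_zero (Finset.mem_univ i), mul_zero]
      rw [hxi, Real.zero_rpow h]
  · by_cases h : a i = 0
    · left
      refine ((hF.decaysAt hU hi hu).mul_continuous hU hi hu
        ((hF.rpow hU hpos (-1)).1)).congr fun x _ => by simp [h]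
    · right
      have hu0 : f u j = 0 := by
        rw [heq u hu, Finset.prod_eq_zero (Finset.mem_univ i), mul_zero]
        rw [hui, Real.zero_rpow h]
      refine ⟨hj, hu0, ?_⟩
      have hd : DecaysAt i U u (fun x => x i ^ a i) := by
        refine ⟨1, a i, one_pos, lt_of_le_of_ne (ha i) (Ne.symm h), ?_⟩
        filter_upwards [self_mem_nhdsWithin] with x hx
        rw [one_mul, abs_of_nonneg (Real.rpow_nonneg (hU.subset_orthant hx i hi) _)]
      refine (hd.mul_continuous hU hi hu (g := fun x => F x *
        ∏ r ∈ Finset.univ.erase i, x r ^ a r)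
        (hF.1.mul (continuous_prod_rpow ha _).continuousOn)).congr fun x hx => ?_
      rw [heq x hx, ← Finset.mul_prod_erase _ _ (Finset.mem_univ i)]
      ring

/-- Near a point every component of f has a-smooth b-derivatives in the required sense: logarithmic
ones from the factorization, 0 for a component vanishing identically, and ordinary ones for j ≥ l.
Then `ASmoothUpTo.comp` applies. -/
theorem ASmoothFunOn.comp {k l m n : ℕ} {U : Set (Fin m → ℝ)} {V : Set (Fin n → ℝ)}
    (hU : IsOpenIn k U) (hV : IsOpenIn l V) {f : (Fin m → ℝ) → (Fin n → ℝ)}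
    (hf : ASmooth k l U f) (hfV : MapsTo f U V) {g : (Fin n → ℝ) → ℝ} (hg : ASmoothFunOn l V g) :
    ASmoothFunOn k U (fun x => g (f x)) := by
  refine of_local hU fun u hu => ?_
  obtain ⟨W, hW, huW, hfac⟩ := hf.2.2 u hu
  refine ⟨W, hW, huW, ?_⟩
  have hU' := hU.inter_open hW
  have hex : ∀ (i : Fin m) (j : Fin n), ∃ M, IsLogBDeriv k l (W ∩ U) f i j M := by
    intro i j
    by_cases hj : (j : ℕ) < l
    · rcases hfac j hj with ⟨F, a, h, -⟩ | h
      · exact ⟨_, isLogBDeriv_of_factorization hU' hj h.smooth h.pos h.nonneg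
          (fun i hi => (h.support i hi).1) h.eq i⟩
      · refine ⟨fun _ => 0, ASmoothFunOn.const hU' 0, fun x hx hi => ?_, fun x hx hi _ _ => ?_,
          fun _ _ _ _ => Or.inr rfl, fun hi u hu hui => Or.inl ?_⟩
        · simp only [zero_div, mul_zero, ite_self]
          exact (hasDerivAt_const (x i) (0 : ℝ)).congr_of_eventuallyEq
            (hU'.eventuallyEq_update (f := fun x => f x j) (g := fun _ => 0) h hx hi)
        · exact hU'.eventuallyEq_update (f := fun x => f x j) (g := fun _ => 0) h hx hi
        · simpa using DecaysAt.sum hU' hi hui (ι := Unit) ∅ (f := fun _ _ => 0) (by simp)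
    · have hs := (hf.2.1 j (not_lt.1 hj)).inter_open hU hW
      refine ⟨_, hs.bDeriv hU' i, fun x hx hi => ?_, fun x hx hi h => absurd h hj,
        fun hi x _ hxi => Or.inr (bDeriv_of_eq_zero hi hxi),
        fun hi u hu _ => Or.inl (hs.decaysAt hU' hi hu)⟩
      rw [if_neg hj]
      exact (hs.bDerivExistsOn i).hasDerivAt hx hi
  choose M hM using hex
  exact (aSmoothFunOn_iff hU').2 fun N => ASmoothUpTo.comp hU' hV
    (hf.1.mono inter_subset_right) (hfV.mono_left inter_subset_right) hM
    ((aSmoothFunOn_iff hV).1 hg N)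

end ACorners

namespace ACorners

open Filter Function

/-! ### a-smooth functions become smooth -/

lemma profile_zero : profile 0 = 0 := by simp [profile]

lemma profile_pos {x : ℝ} (hx : 0 < x) : 0 < profile x := by
  rw [profile, if_neg hx.ne']; positivity

/-- The logarithmic derivative of φ is 1 + x⁻²; this is the only source of inverse powers in what
follows. -/
lemma hasDerivAt_profile {x : ℝ} (hx : 0 < x) :
    HasDerivAt profile (profile x * (1 + x⁻¹ ^ 2)) x := by
  have h : HasDerivAt (fun t : ℝ => Real.exp (t - t⁻¹))
      (Real.exp (x - x⁻¹) * (1 - -(x ^ 2)⁻¹)) x :=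
    ((hasDerivAt_id' x).sub (hasDerivAt_inv hx.ne')).exp
  have e : profile =ᶠ[𝓝 x] fun t => Real.exp (t - t⁻¹) := by
    filter_upwards [lt_mem_nhds hx] with t ht
    rw [profile, if_neg ht.ne']
  refine (h.congr_of_eventuallyEq e).congr_deriv ?_
  rw [profile, if_neg hx.ne', inv_pow]
  ring

/-- Since φ(t)^α = e^(αt) e^(-α/t) for t > 0, the exponential beats every power of 1/t. -/
lemma tendsto_profile_rpow_mul_inv_pow {α : ℝ} (hα : 0 < α) {n : ℕ} (hn : n ≠ 0) :
    Tendsto (fun t => profile t ^ α * t⁻¹ ^ n) (𝓝[≥] 0) (𝓝 0) := by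
  rw [← Ioi_insert, nhdsWithin_insert]
  refine tendsto_sup.2 ⟨?_, ?_⟩
  -- At t = 0 itself the value is 0, since 0⁻¹ = 0 and n ≠ 0.
  · rw [tendsto_pure_left]
    intro s hs
    simpa [hn] using mem_of_mem_nhds hs
  · have h1 : Tendsto (fun t : ℝ => t⁻¹ ^ (n : ℝ) * Real.exp (-α * t⁻¹)) (𝓝[>] 0) (𝓝 0) :=
      (tendsto_rpow_mul_exp_neg_mul_atTop_nhds_zero n α hα).comp tendsto_inv_nhdsGT_zero
    have h2 : Tendsto (fun t : ℝ => Real.exp (α * t)) (𝓝[>] 0) (𝓝 (Real.exp (α * 0))) :=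
      tendsto_nhdsWithin_of_tendsto_nhds (Continuous.tendsto (by fun_prop) 0)
    have h3 := h2.mul h1
    rw [mul_zero] at h3
    refine h3.congr' ?_
    filter_upwards [self_mem_nhdsWithin] with t ht
    have ht' : (0 : ℝ) < t := ht
    rw [profile, if_neg ht'.ne', ← Real.exp_mul, Real.rpow_natCast, mul_left_comm, ← Real.exp_add]
    rw [mul_comm]
    congr 2
    ring

lemma tendsto_glueMap {k m : ℕ} {U : Set (Fin m → ℝ)} {x : Fin m → ℝ}
    (hx : x ∈ glueSet k U) : Tendsto (glueMap k) (𝓝[glueSet k U] x) (𝓝[U] glueMap k x) :=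
  ((glueMap_continuousOn k m x hx.1).mono inter_subset_left).tendsto_nhdsWithin fun _ h => h.2

lemma glueMap_update (k : ℕ) {m : ℕ} (x : Fin m → ℝ) (i : Fin m) (t : ℝ) :
    glueMap k (update x i t) = update (glueMap k x) i (if (i : ℕ) < k then profile t else t) := by
  funext j
  by_cases h : j = i
  · subst h; simp [glueMap]
  · simp [glueMap, update_of_ne h]

/-! ### Functions that vanish on a boundary face. -/

section Face

variable {k m : ℕ} {U : Set (Fin m → ℝ)} {g : (Fin m → ℝ) → ℝ} {i : Fin m}

/-- The function `g` vanishes on the boundary face `x_i = 0`. -/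
def VanishesOnFace (U : Set (Fin m → ℝ)) (i : Fin m) (g : (Fin m → ℝ) → ℝ) : Prop :=
  ∀ x ∈ U, x i = 0 → g x = 0

/-- The b-derivative in x_i is 0 on the face by convention; the other directions stay within the
face, on which g is constantly 0. -/
lemma VanishesOnFace.bDeriv (hU : IsOpenIn k U) (hi : (i : ℕ) < k) {j : Fin m}
    (h : j = i ∨ VanishesOnFace U i g) : VanishesOnFace U i (bDeriv k j g) := by
  intro x hx hxi
  by_cases hji : j = i
  · subst hji; exact bDeriv_of_eq_zero hi hxi
  · have h := h.resolve_left hji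
    rcases pos_or_eq_zero hU hx j with hj | ⟨hj, h0⟩
    · have hev : (fun t => g (update x j t)) =ᶠ[𝓝 (x j)] fun _ => 0 := by
        filter_upwards [hU.eventually_update_mem hx hj] with t ht
        exact h _ ht (by rw [update_of_ne (Ne.symm hji), hxi])
      rw [bDeriv_eq_of_hasDerivAt hj ((hasDerivAt_const (x j) (0 : ℝ)).congr_of_eventuallyEq hev),
        mul_zero]
    · exact bDeriv_of_eq_zero hj h0

/-- Integrate |∂g/∂x_i| ≤ C x_i^(α-1) from the face, where g is 0, to get |g| ≤ (C/α) x_i^α. -/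
theorem ASmoothFunOn.decaysAt_of_vanishesOnFace (hU : IsOpenIn k U) (hg : ASmoothFunOn k U g)
    (hi : (i : ℕ) < k) (h0 : VanishesOnFace U i g) {u : Fin m → ℝ} (hu : u ∈ U) (hui : u i = 0) :
    DecaysAt i U u g := by
  obtain ⟨ε, hε, hsub, hcomp⟩ := hU.exists_compact hu
  obtain ⟨C, α, hC, hα, hb⟩ := (hg.2 []).2 _ hsub hcomp i hi
  simp only [bDerivIter] at hb
  refine ⟨C / α, α, by positivity, hα, ?_⟩
  filter_upwards [self_mem_nhdsWithin,
    nhdsWithin_le_nhds (Metric.closedBall_mem_nhds u hε)] with x hxU hxb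
  have hxo := hU.subset_orthant hxU
  have hmem : ∀ t ∈ Icc 0 (x i), update x i t ∈ orthant k m ∩ Metric.closedBall u ε := by
    rintro t ⟨ht0, htx⟩
    refine ⟨update_mem_orthant hxo fun _ => ht0, ?_⟩
    rw [Metric.mem_closedBall, dist_pi_le_iff hε.le] at hxb ⊢
    intro j
    by_cases hj : j = i
    · subst hj
      have := hxb j
      rw [hui, Real.dist_eq, sub_zero, abs_of_nonneg (hxo j hi)] at this
      rw [update_self, hui, Real.dist_eq, sub_zero, abs_of_nonneg ht0]
      exact htx.trans this
    · rw [update_of_ne hj]; exact hxb j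
  have hcont : ContinuousOn (fun t => g (update x i t)) (Icc 0 (x i)) := by
    refine hg.1.comp (Continuous.continuousOn ?_) fun t ht => hsub (hmem t ht)
    exact continuous_const.update i continuous_id
  have hder : ∀ t ∈ Ioo 0 (x i), HasDerivAt (fun t => g (update x i t))
      (ACorners.bDeriv k i g (update x i t) / t) t := by
    intro t ht
    have := (hg.bDerivExistsOn i).hasDerivAt (hsub (hmem t ⟨ht.1.le, ht.2.le⟩))
      (fun _ => by simpa using ht.1)
    simpa [bScale, hi] using this
  have hpow : ∀ t ∈ Ioo 0 (x i), HasDerivAt (fun t : ℝ => C / α * t ^ α) (C * t ^ α / t) t := by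
    intro t ht
    refine ((Real.hasDerivAt_rpow_const (p := α) (Or.inl ht.1.ne')).const_mul (C / α)).congr_deriv ?_
    rw [Real.rpow_sub ht.1, Real.rpow_one]
    field_simp
  have hpc : ContinuousOn (fun t : ℝ => C / α * t ^ α) (Icc 0 (x i)) :=
    (continuous_const.mul (continuous_id.rpow_const fun _ => Or.inr hα.le)).continuousOn
  have hxi := hxo i hi
  -- Instead of integrating, both functions (C/α) t^α ± g have nonnegative derivative, hence
  -- increase from the value 0 at t = 0.
  have key : ∀ s : ℝ, |s| = 1 → 0 ≤ C / α * x i ^ α + s * g x := by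
    intro s hs
    have hd : ∀ t ∈ Ioo 0 (x i), HasDerivAt (fun t => C / α * t ^ α + s * g (update x i t))
        (C * t ^ α / t + s * (ACorners.bDeriv k i g (update x i t) / t)) t :=
      fun t ht => (hpow t ht).add ((hder t ht).const_mul s)
    have hm : MonotoneOn (fun t => C / α * t ^ α + s * g (update x i t)) (Icc 0 (x i)) := by
      refine monotoneOn_of_deriv_nonneg (convex_Icc _ _) (hpc.add (hcont.const_smul s))
        (fun t ht => ?_) fun t ht => ?_
      · rw [interior_Icc] at ht
        exact (hd t ht).differentiableAt.differentiableWithinAt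
      · rw [interior_Icc] at ht
        rw [(hd t ht).deriv, mul_div_assoc', ← add_div]
        refine div_nonneg ?_ ht.1.le
        have h1 := hb _ (hmem t ⟨ht.1.le, ht.2.le⟩)
        rw [update_self] at h1
        have h2 : |s * ACorners.bDeriv k i g (update x i t)| ≤ C * t ^ α := by
          rw [abs_mul, hs, one_mul]; exact h1
        linarith [neg_abs_le (s * ACorners.bDeriv k i g (update x i t))]
    have := hm ⟨le_rfl, hxi⟩ ⟨hxi, le_rfl⟩ hxi
    have hz : g (update x i 0) = 0 := h0 _ (hsub (hmem 0 ⟨le_rfl, hxi⟩)) (by simp)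
    simpa [hz, Real.zero_rpow hα.ne'] using this
  rw [abs_le]
  constructor
  · linarith [key 1 (by simp)]
  · linarith [key (-1) (by simp)]

end Face

/-- The functions `g(Φ(x)) x_1^{-n_1} ⋯ x_k^{-n_k}`. -/
noncomputable def glueTerm (k : ℕ) {m : ℕ} (p : ((Fin m → ℝ) → ℝ) × (Fin m → ℕ))
    (x : Fin m → ℝ) : ℝ :=
  p.1 (glueMap k x) * ∏ i, (x i)⁻¹ ^ p.2 i

/-- The function `g` is a-smooth and vanishes on the faces `x_i = 0` with `n_i > 0`. -/
structure IsGluePair (k : ℕ) {m : ℕ} (U : Set (Fin m → ℝ))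
    (p : ((Fin m → ℝ) → ℝ) × (Fin m → ℕ)) : Prop where
  smooth : ASmoothFunOn k U p.1
  vanishes : ∀ i, p.2 i ≠ 0 → (i : ℕ) < k ∧ VanishesOnFace U i p.1

/-! ### Pullbacks by Φ divided by powers of the boundary coordinates. -/

section Glue

variable {k m : ℕ} {U : Set (Fin m → ℝ)} {p : ((Fin m → ℝ) → ℝ) × (Fin m → ℕ)}

lemma glueMap_apply_eq_zero {i : Fin m} {x : Fin m → ℝ} (hx : x i = 0) : glueMap k x i = 0 := by
  simp [glueMap, hx, profile_zero]

lemma glueTerm_eq_zero {x : Fin m → ℝ} (hx : x ∈ glueSet k U) {i : Fin m} (hxi : x i = 0)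
    (h : VanishesOnFace U i p.1) : glueTerm k p x = 0 := by
  rw [glueTerm, h _ hx.2 (glueMap_apply_eq_zero hxi), zero_mul]

/-- The power decay of g becomes a bound by C φ(y_i)^α, which absorbs any inverse power of y_i. -/
lemma tendsto_glue_mul_inv_pow (hU : IsOpenIn k U) {g : (Fin m → ℝ) → ℝ}
    (hg : ASmoothFunOn k U g) {i : Fin m} (hi : (i : ℕ) < k) (h0 : VanishesOnFace U i g)
    {x : Fin m → ℝ} (hx : x ∈ glueSet k U) (hxi : x i = 0) {n : ℕ} (hn : n ≠ 0) :
    Tendsto (fun y => g (glueMap k y) * (y i)⁻¹ ^ n) (𝓝[glueSet k U] x) (𝓝 0) := by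
  obtain ⟨C, α, hC, hα, hb⟩ :=
    hg.decaysAt_of_vanishesOnFace hU hi h0 hx.2 (glueMap_apply_eq_zero hxi)
  have ht : Tendsto (fun y : Fin m → ℝ => y i) (𝓝[glueSet k U] x) (𝓝[≥] 0) := by
    refine tendsto_nhdsWithin_iff.2 ⟨?_, ?_⟩
    · rw [← hxi]; exact (continuous_apply i).continuousAt.continuousWithinAt
    · filter_upwards [self_mem_nhdsWithin] with y hy using hy.1 i hi
  have h1 := ((tendsto_profile_rpow_mul_inv_pow hα hn).comp ht).const_mul C
  rw [mul_zero] at h1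
  refine squeeze_zero_norm' ?_ h1
  filter_upwards [(tendsto_glueMap hx).eventually hb, self_mem_nhdsWithin] with y hy hyU
  have hyi : 0 ≤ (y i)⁻¹ ^ n := pow_nonneg (inv_nonneg.2 (hyU.1 i hi)) n
  rw [Real.norm_eq_abs, abs_mul, abs_of_nonneg hyi, Function.comp_apply, ← mul_assoc]
  refine mul_le_mul_of_nonneg_right (hy.trans (le_of_eq ?_)) hyi
  simp [glueMap, hi]

/-- Inverse powers in several coordinates may blow up at x while there is only one factor g(Φ(y)).
Raising the function to the power |Z|, where Z is the set of these coordinates, gives each of them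
its own copy of g. -/
lemma IsGluePair.continuousOn (hU : IsOpenIn k U) (hp : IsGluePair k U p) :
    ContinuousOn (glueTerm k p) (glueSet k U) := by
  classical
  intro x hx
  set Z := Finset.univ.filter fun i => p.2 i ≠ 0 ∧ x i = 0 with hZ
  have hg : ContinuousWithinAt (fun y => p.1 (glueMap k y)) (glueSet k U) x :=
    (hp.smooth.1 _ hx.2).tendsto.comp (tendsto_glueMap hx)
  have hrest : ContinuousWithinAt (fun y : Fin m → ℝ => ∏ i ∈ Zᶜ, (y i)⁻¹ ^ p.2 i)
      (glueSet k U) x := by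
    refine ContinuousAt.continuousWithinAt (tendsto_finsetProd _ fun i hi => ?_)
    by_cases h : p.2 i = 0
    · simp only [h, pow_zero]; exact tendsto_const_nhds
    · have hxi : x i ≠ 0 := by
        intro h'; simp [hZ, h, h'] at hi
      exact ((continuous_apply i).continuousAt.inv₀ hxi).pow _
  have hsplit : ∀ y, glueTerm k p y =
      p.1 (glueMap k y) * (∏ i ∈ Z, (y i)⁻¹ ^ p.2 i) * ∏ i ∈ Zᶜ, (y i)⁻¹ ^ p.2 i := by
    intro y
    rw [glueTerm, mul_assoc, Finset.prod_mul_prod_compl]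
  rcases Z.eq_empty_or_nonempty with hE | ⟨i₀, hi₀⟩
  · have : glueTerm k p = fun y => p.1 (glueMap k y) * ∏ i ∈ Zᶜ, (y i)⁻¹ ^ p.2 i := by
      funext y; rw [hsplit, hE]; simp
    rw [this]
    exact hg.mul hrest
  · have hmZ : ∀ i ∈ Z, p.2 i ≠ 0 ∧ x i = 0 := fun i hi => by simpa [hZ] using hi
    have hcard : Z.card ≠ 0 := Finset.card_ne_zero_of_mem hi₀
    have hx0 : glueTerm k p x = 0 :=
      glueTerm_eq_zero hx (hmZ i₀ hi₀).2 (hp.vanishes i₀ (hmZ i₀ hi₀).1).2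
    -- This is the |Z|-th power of the function, redistributed so that each i ∈ Z takes one factor g
    -- and the exponent n_i |Z|.
    have hlim : Tendsto (fun y => (∏ i ∈ Z, p.1 (glueMap k y) * (y i)⁻¹ ^ (p.2 i * Z.card)) *
        (∏ i ∈ Zᶜ, (y i)⁻¹ ^ p.2 i) ^ Z.card) (𝓝[glueSet k U] x) (𝓝 0) := by
      have h1 : Tendsto (fun y => ∏ i ∈ Z, p.1 (glueMap k y) * (y i)⁻¹ ^ (p.2 i * Z.card))
          (𝓝[glueSet k U] x) (𝓝 (∏ _i ∈ Z, 0)) :=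
        tendsto_finsetProd _ fun i hi => tendsto_glue_mul_inv_pow hU hp.smooth
          (hp.vanishes i (hmZ i hi).1).1 (hp.vanishes i (hmZ i hi).1).2 hx (hmZ i hi).2
          (mul_ne_zero (hmZ i hi).1 hcard)
      have h2 := h1.mul (hrest.tendsto.pow Z.card)
      rwa [Finset.prod_eq_zero hi₀ rfl, zero_mul] at h2
    have heq : ∀ y, glueTerm k p y ^ Z.card =
        (∏ i ∈ Z, p.1 (glueMap k y) * (y i)⁻¹ ^ (p.2 i * Z.card)) *
        (∏ i ∈ Zᶜ, (y i)⁻¹ ^ p.2 i) ^ Z.card := by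
      intro y
      rw [hsplit, mul_pow, mul_pow, Finset.prod_mul_distrib, Finset.prod_const,
        ← Finset.prod_pow]
      simp only [pow_mul]
    simp only [← heq] at hlim
    rw [ContinuousWithinAt, hx0, tendsto_zero_iff_abs_tendsto_zero]
    have hlim' := hlim.abs.rpow_const (p := (Z.card : ℝ)⁻¹) (Or.inr (by positivity))
    rw [abs_zero, Real.zero_rpow (by positivity)] at hlim'
    refine hlim'.congr fun y => ?_
    rw [abs_pow, Real.pow_rpow_inv_natCast (abs_nonneg _) hcard]
    rfl

/-- The partial derivatives of a function `g(Φ(x)) x_1^{-n_1} ⋯ x_k^{-n_k}` are sums of functions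
of the same form. -/
lemma IsGluePair.exists_partial (hU : IsOpenIn k U) (hp : IsGluePair k U p) (i : Fin m) :
    ∃ (q : ℕ) (s : Fin q → ((Fin m → ℝ) → ℝ) × (Fin m → ℕ)), (∀ r, IsGluePair k U (s r)) ∧
      (∀ x ∈ glueSet k U, HasDerivWithinAt (fun t => glueTerm k p (update x i t))
        (∑ r, glueTerm k (s r) x) (orthantFactor k i) (x i)) ∧
      ∀ i' : Fin m, (i' : ℕ) < k → (i = i' ∨ VanishesOnFace U i' p.1) →
        ∀ r, VanishesOnFace U i' (s r).1 := by
  classical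
  obtain ⟨g, n⟩ := p
  have hg : ASmoothFunOn k U g := hp.smooth
  have hv : ∀ i, n i ≠ 0 → (i : ℕ) < k ∧ VanishesOnFace U i g := hp.vanishes
  have hg' := hg.bDeriv hU i
  have hprod : ∀ (n : Fin m → ℕ) (x : Fin m → ℝ) (t : ℝ), ∏ r, (update x i t r)⁻¹ ^ n r =
      t⁻¹ ^ n i * ∏ r ∈ Finset.univ.erase i, (x r)⁻¹ ^ n r := by
    intro n x t
    rw [← Finset.mul_prod_erase _ _ (Finset.mem_univ i), update_self]
    congr 1
    refine Finset.prod_congr rfl fun r hr => ?_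
    rw [update_of_ne (Finset.ne_of_mem_erase hr)]
  have hprod' : ∀ (n : Fin m → ℕ) (x : Fin m → ℝ), ∏ r, (x r)⁻¹ ^ n r =
      (x i)⁻¹ ^ n i * ∏ r ∈ Finset.univ.erase i, (x r)⁻¹ ^ n r := by
    intro n x
    have := hprod n x (x i)
    rwa [update_eq_self] at this
  by_cases hi : (i : ℕ) < k
  · have hn2 : ∀ c : ℕ, ∀ r, update n i (n i + c) r ≠ 0 → r = i ∨ n r ≠ 0 := by
      intro c r hr
      by_cases h : r = i
      · exact Or.inl h
      · rw [update_of_ne h] at hr; exact Or.inr hr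
    -- If n_i = 0 the coefficient is 0; otherwise g vanishes on the face.
    have h3 : VanishesOnFace U i (fun x => -(n i : ℝ) * g x) := by
      intro x hx hxi
      by_cases h : n i = 0
      · simp [h]
      · change -(n i : ℝ) * g x = 0
        rw [(hv i h).2 x hx hxi, mul_zero]
    -- The product rule gives ᵇ∂_i g·(1 + x_i⁻²), contributing two terms, and -n_i g x_i^(-n_i-1)
    -- from the inverse power.
    let s : Fin 3 → ((Fin m → ℝ) → ℝ) × (Fin m → ℕ) :=
      ![(bDeriv k i g, n), (bDeriv k i g, update n i (n i + 2)),
        (fun x => -(n i : ℝ) * g x, update n i (n i + 1))]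
    have hs : ∀ r, IsGluePair k U (s r) := by
      intro r
      fin_cases r
      · exact ⟨hg', fun r hr => ⟨(hv r hr).1,
          VanishesOnFace.bDeriv hU (hv r hr).1 (Or.inr (hv r hr).2)⟩⟩
      · refine ⟨hg', fun r hr => ?_⟩
        rcases hn2 2 r hr with rfl | hr
        · exact ⟨hi, VanishesOnFace.bDeriv hU hi (Or.inl rfl)⟩
        · exact ⟨(hv r hr).1,
            VanishesOnFace.bDeriv hU (hv r hr).1 (Or.inr (hv r hr).2)⟩
      · refine ⟨(ASmoothFunOn.const hU _).mul hU hg, fun r hr => ?_⟩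
        rcases hn2 1 r hr with rfl | hr
        · exact ⟨hi, h3⟩
        · exact ⟨(hv r hr).1, fun x hx hxr => by
            change -(n i : ℝ) * g x = 0
            rw [(hv r hr).2 x hx hxr, mul_zero]⟩
    have hpos : ∀ x ∈ glueSet k U, 0 < x i → HasDerivAt
        (fun t => glueTerm k (g, n) (update x i t)) (∑ r, glueTerm k (s r) x) (x i) := by
      intro x hx hxi
      have hΦi : glueMap k x i = profile (x i) := by simp [glueMap, hi]
      have hφ := profile_pos hxi
      have h1 : HasDerivAt (fun t => g (update (glueMap k x) i t))
          (bDeriv k i g (glueMap k x) / profile (x i)) (profile (x i)) := by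
        have := (hg.bDerivExistsOn i).hasDerivAt hx.2 (fun _ => by rw [hΦi]; exact hφ)
        rwa [bScale, if_pos hi, hΦi] at this
      have h2 := h1.comp (x i) (hasDerivAt_profile hxi)
      have h4 : HasDerivAt (fun t : ℝ => t⁻¹ ^ n i) (-(n i : ℝ) * (x i)⁻¹ ^ (n i + 1)) (x i) := by
        refine ((hasDerivAt_inv hxi.ne').pow (n i)).congr_deriv ?_
        rcases Nat.eq_zero_or_pos (n i) with h | h
        · simp [h]
        · obtain ⟨c, hc⟩ := Nat.exists_eq_add_of_lt h
          rw [hc]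
          simp only [zero_add, Nat.add_sub_cancel, inv_pow]
          field_simp
          ring
      have h5 := h2.mul (h4.mul_const (∏ r ∈ Finset.univ.erase i, (x r)⁻¹ ^ n r))
      have hcongr : (fun t => glueTerm k (g, n) (update x i t)) = fun t =>
          g (update (glueMap k x) i (profile t)) *
            (t⁻¹ ^ n i * ∏ r ∈ Finset.univ.erase i, (x r)⁻¹ ^ n r) := by
        funext t
        rw [glueTerm, hprod, glueMap_update, if_pos hi]
      rw [hcongr]
      refine h5.congr_deriv ?_
      have herase : ∀ c : ℕ, ∏ r ∈ Finset.univ.erase i, (x r)⁻¹ ^ update n i (n i + c) r =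
          ∏ r ∈ Finset.univ.erase i, (x r)⁻¹ ^ n r := fun c =>
        Finset.prod_congr rfl fun r hr => by rw [update_of_ne (Finset.ne_of_mem_erase hr)]
      have hup : update (glueMap k x) i (profile (x i)) = glueMap k x := by
        rw [← hΦi, update_eq_self]
      have hsum : ∑ r, glueTerm k (s r) x = glueTerm k (bDeriv k i g, n) x +
          glueTerm k (bDeriv k i g, update n i (n i + 2)) x +
          glueTerm k (fun x => -(n i : ℝ) * g x, update n i (n i + 1)) x := by
        rw [Fin.sum_univ_three]; rfl
      rw [hsum]
      simp only [glueTerm, hprod' _ x, herase, update_self, Function.comp_apply, hup]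
      rw [div_mul_eq_mul_div, mul_left_comm (bDeriv k i g (glueMap k x)),
        mul_div_cancel_left₀ _ hφ.ne']
      ring
    refine ⟨3, s, hs, fun x hx => ?_, ?_⟩
    · rcases (hx.1 i hi).eq_or_lt with h0 | h0
      · rw [orthantFactor, if_pos hi, ← h0]
        have hc : ∀ {h : (Fin m → ℝ) → ℝ}, ContinuousOn h (glueSet k U) →
            Tendsto (fun t => h (update x i t)) (𝓝[≥] 0) (𝓝 (h x)) := by
          intro h hh
          refine (hh x hx).tendsto.comp ?_
          rw [hU.glueSet.nhdsWithin_eq hx]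
          refine tendsto_nhdsWithin_iff.2 ⟨?_, ?_⟩
          · have := tendsto_update x i
            rw [← h0] at this
            exact this.mono_left nhdsWithin_le_nhds
          · filter_upwards [self_mem_nhdsWithin] with t ht
            exact update_mem_orthant hx.1 fun _ => ht
        have hev : ∀ᶠ t in 𝓝[>] (0 : ℝ), update x i t ∈ glueSet k U := by
          have : Tendsto (fun t => update x i t) (𝓝[>] 0) (𝓝[orthant k m] x) := by
            refine tendsto_nhdsWithin_iff.2 ⟨?_, ?_⟩
            · have := tendsto_update x i
              rw [← h0] at this
              exact this.mono_left nhdsWithin_le_nhds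
            · filter_upwards [self_mem_nhdsWithin] with t ht
              exact update_mem_orthant hx.1 fun _ => (mem_Ioi.1 ht).le
          exact this.eventually (hU.glueSet.mem_nhdsWithin hx)
        have hder : ∀ t ∈ {t | update x i t ∈ glueSet k U} ∩ Ioi (0 : ℝ),
            HasDerivAt (fun t => glueTerm k (g, n) (update x i t))
              (∑ r, glueTerm k (s r) (update x i t)) t := by
          rintro t ⟨ht, ht0⟩
          have := hpos _ ht (by simpa using ht0)
          simpa only [update_idem, update_self] using this
        have hmem : {t | update x i t ∈ glueSet k U} ∩ Ioi (0 : ℝ) ∈ 𝓝[>] (0 : ℝ) :=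
          inter_mem hev self_mem_nhdsWithin
        -- On the face the one-sided derivative exists because the derivatives for t > 0 have a
        -- limit, the proposed terms being continuous up to the face.
        refine hasDerivWithinAt_Ici_of_tendsto_deriv
          (s := {t | update x i t ∈ glueSet k U} ∩ Ioi (0 : ℝ))
          (fun t ht => (hder t ht).differentiableAt.differentiableWithinAt) ?_ hmem ?_
        · have h1 := hc (hp.continuousOn hU)
          have hx0 : update x i 0 = x := by rw [h0, update_eq_self]
          rw [ContinuousWithinAt, hx0]
          exact h1.mono_left (nhdsWithin_mono _ fun t ht => (mem_Ioi.1 ht.2).le)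
        · have h1 := hc (h := fun x => ∑ r, glueTerm k (s r) x)
            (continuousOn_finsetSum _ fun r _ => (hs r).continuousOn hU)
          refine (h1.mono_left (nhdsWithin_mono _ Ioi_subset_Ici_self)).congr' ?_
          filter_upwards [hmem] with t ht
          exact (hder t ht).deriv.symm
      · exact (hpos x hx h0).hasDerivWithinAt
    · intro i' hi' h r
      fin_cases r
      · exact VanishesOnFace.bDeriv hU hi' h
      · exact VanishesOnFace.bDeriv hU hi' h
      · rcases h with rfl | h
        · exact h3
        · intro x hx hxr
          change -(n i : ℝ) * g x = 0
          rw [show g x = 0 from h x hx hxr, mul_zero]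
  · have hni : n i = 0 := by
      by_contra h; exact hi (hv i h).1
    refine ⟨1, fun _ => (bDeriv k i g, n), fun _ => ⟨hg', fun r hr => ⟨(hv r hr).1,
        VanishesOnFace.bDeriv hU (hv r hr).1 (Or.inr (hv r hr).2)⟩⟩,
      fun x hx => ?_, fun i' hi' h _ => VanishesOnFace.bDeriv hU hi' h⟩
    have h1 := (hg.bDerivExistsOn i).hasDerivAt hx.2 (fun h => absurd h hi)
    have hΦi : glueMap k x i = x i := by simp [glueMap, hi]
    rw [bScale, if_neg hi, div_one, hΦi] at h1
    have h2 := (h1.mul_const (∏ r ∈ Finset.univ.erase i, (x r)⁻¹ ^ n r)).hasDerivWithinAt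
      (s := orthantFactor k i)
    simp only [Finset.univ_unique, Finset.sum_singleton, glueTerm, hprod, hprod', glueMap_update,
      if_neg hi, hni, pow_zero, one_mul]
    exact h2

lemma IsOpenIn.hasFDerivWithinAt_of_partials (hU : IsOpenIn k U)
    {D : Fin m → (Fin m → ℝ) → ℝ} {f : (Fin m → ℝ) → ℝ}
    (hD : ∀ i, ∀ x ∈ U, HasDerivWithinAt (fun t => f (update x i t)) (D i x)
      (orthantFactor k i) (x i))
    (hc : ∀ i, ContinuousOn (D i) U) {x : Fin m → ℝ} (hx : x ∈ U) :
    HasFDerivWithinAt f (∑ i, D i x • ContinuousLinearMap.proj (R := ℝ) (φ := fun _ => ℝ) i)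
      U x := by
  have hxo := hU.subset_orthant hx
  refine HasFDerivWithinAt.mono (t := univ.pi (orthantFactor k)) ?_
    (by rw [← orthant_eq_pi]; exact hU.subset_orthant)
  refine ACorners.hasFDerivWithinAt_of_partials (convex_orthantFactor k)
    (by rw [← orthant_eq_pi]; exact hxo) ?_ fun i => ?_
  · rw [← orthant_eq_pi]
    filter_upwards [hU.mem_nhdsWithin hx] with z hz i using hD i z hz
  · rw [← orthant_eq_pi, ContinuousWithinAt, ← hU.nhdsWithin_eq hx]
    exact hc i x hx

lemma IsGluePair.exists_hasFDerivWithinAt (hU : IsOpenIn k U) (hp : IsGluePair k U p) :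
    ∃ (q : Fin m → ℕ) (s : ∀ i, Fin (q i) → ((Fin m → ℝ) → ℝ) × (Fin m → ℕ)),
      (∀ i r, IsGluePair k U (s i r)) ∧
      (∀ x ∈ glueSet k U, HasFDerivWithinAt (glueTerm k p)
        (∑ i, (∑ r, glueTerm k (s i r) x) •
          ContinuousLinearMap.proj (R := ℝ) (φ := fun _ => ℝ) i) (glueSet k U) x) ∧
      ∀ i i' : Fin m, (i' : ℕ) < k → (i = i' ∨ VanishesOnFace U i' p.1) →
        ∀ r, VanishesOnFace U i' (s i r).1 := by
  choose q s hs hd hv using fun i => hp.exists_partial hU i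
  refine ⟨q, s, hs, fun x hx => ?_, hv⟩
  exact hU.glueSet.hasFDerivWithinAt_of_partials (D := fun i x => ∑ r, glueTerm k (s i r) x) hd
    (fun i => continuousOn_finsetSum _ fun r _ => (hs i r).continuousOn hU) hx

/-- The derivative is a finite combination, with constant coefficients, of functions of the same
kind, so the order of differentiability can be raised indefinitely. -/
theorem IsGluePair.contDiffOn (hU : IsOpenIn k U) (hp : IsGluePair k U p) :
    ContDiffOn ℝ ∞ (glueTerm k p) (glueSet k U) := by
  rw [contDiffOn_infty]
  intro N
  induction N generalizing p with
  | zero => exact contDiffOn_zero.2 (hp.continuousOn hU)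
  | succ N ih =>
    obtain ⟨q, s, hs, hd, -⟩ := hp.exists_hasFDerivWithinAt hU
    push_cast
    rw [contDiffOn_succ_iff_hasFDerivWithinAt_of_uniqueDiffOn hU.glueSet.uniqueDiffOn]
    refine ⟨fun h => absurd h (by simp), _, ?_, hd⟩
    exact ContDiffOn.sum fun i _ => (ContDiffOn.sum fun r _ => ih (hs i r)).smul contDiffOn_const

/-- After one derivative in x_i all functions g that occur vanish on the face x_i = 0, and further
derivatives keep this property. The disjunction in `h` records whether that derivative is still to
come or has already been taken. -/
theorem IsGluePair.iteratedFDerivWithin_eq_zero (hU : IsOpenIn k U) (hp : IsGluePair k U p)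
    {r : ℕ} (I : Fin r → Fin m) {x : Fin m → ℝ} (hx : x ∈ glueSet k U) {i : Fin m}
    (hi : (i : ℕ) < k) (hxi : x i = 0) (h : (∃ a, I a = i) ∨ VanishesOnFace U i p.1) :
    iteratedFDerivWithin ℝ r (glueTerm k p) (glueSet k U) x
      (fun a => Pi.single (I a) (1 : ℝ)) = 0 := by
  induction r generalizing p with
  | zero =>
    rw [iteratedFDerivWithin_zero_apply]
    exact glueTerm_eq_zero hx hxi (h.resolve_left fun ⟨a, _⟩ => a.elim0)
  | succ r ih =>
    obtain ⟨q, s, hs, hd, hv⟩ := hp.exists_hasFDerivWithinAt hU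
    have hu := hU.glueSet.uniqueDiffOn
    set j := I (Fin.last r) with hj
    rw [iteratedFDerivWithin_succ_apply_right hu hx]
    have hc : ContDiffOn ℝ ∞ (fun y => fderivWithin ℝ (glueTerm k p) (glueSet k U) y)
        (glueSet k U) := (hp.contDiffOn hU).fderivWithin hu (by simp)
    -- Evaluation at a basis vector is linear and commutes with the remaining derivatives, so the
    -- innermost derivative may be replaced by the partial derivative in direction j.
    have h1 := ContinuousLinearMap.iteratedFDerivWithin_comp_left
      (ContinuousLinearMap.apply ℝ ℝ (Pi.single j (1 : ℝ) : Fin m → ℝ)) (hc x hx) hu hx (i := r)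
      (mod_cast le_top)
    have h2 := congrArg (fun L => L (Fin.init (α := fun _ => Fin m → ℝ)
      fun a => Pi.single (I a) (1 : ℝ))) h1
    simp only [ContinuousLinearMap.compContinuousMultilinearMap_coe, Function.comp_apply,
      ContinuousLinearMap.apply_apply] at h2
    rw [← h2]
    have he : EqOn ((ContinuousLinearMap.apply ℝ ℝ (Pi.single j (1 : ℝ) : Fin m → ℝ)) ∘
        fun y => fderivWithin ℝ (glueTerm k p) (glueSet k U) y)
        (∑ b, glueTerm k (s j b)) (glueSet k U) := by
      intro y hy
      simp only [Function.comp_apply, ContinuousLinearMap.apply_apply,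
        (hd y hy).fderivWithin (hu y hy), _root_.sum_apply, _root_.smul_apply,
        ContinuousLinearMap.proj_apply, Finset.sum_apply, smul_eq_mul]
      rw [Finset.sum_eq_single j]
      · simp
      · intro b _ hb; simp [Pi.single_eq_of_ne hb]
      · simp
    rw [iteratedFDerivWithin_congr he hx, iteratedFDerivWithin_sum_apply hu hx fun b _ =>
      ((hs j b).contDiffOn hU x hx).of_le (mod_cast le_top)]
    rw [_root_.sum_apply]
    refine Finset.sum_eq_zero fun b _ => ?_
    refine ih (hs j b) (fun a => I a.castSucc) ?_
    -- If the index i does not occur among the remaining derivatives, then it is the innermost one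
    -- or g already vanishes on the face.
    by_cases h' : ∃ a : Fin r, I a.castSucc = i
    · exact Or.inl h'
    · right
      refine hv j i hi ?_ b
      rcases h with ⟨a, ha⟩ | h
      · left
        rcases Fin.eq_castSucc_or_eq_last a with ⟨a, rfl⟩ | rfl
        · exact absurd ⟨a, ha⟩ h'
        · exact ha
      · exact Or.inr h

lemma ASmoothFunOn.isGluePair {g : (Fin m → ℝ) → ℝ} (hg : ASmoothFunOn k U g) :
    IsGluePair k U (g, fun _ => 0) := ⟨hg, fun _ h => absurd rfl h⟩

lemma glueTerm_zero (k : ℕ) {m : ℕ} (g : (Fin m → ℝ) → ℝ) :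
    glueTerm k (g, fun _ => 0) = fun x => g (glueMap k x) := by
  funext x; simp [glueTerm]

theorem ASmoothFunOn.contDiffOn_glue (hU : IsOpenIn k U) {g : (Fin m → ℝ) → ℝ}
    (hg : ASmoothFunOn k U g) : ContDiffOn ℝ ∞ (fun x => g (glueMap k x)) (glueSet k U) := by
  rw [← glueTerm_zero]; exact hg.isGluePair.contDiffOn hU

end Glue

end ACorners

namespace ACorners

open Filter Function

/-! ### The map `Ψ(s,t) = φ⁻¹(s φ(t)^a)` -/

/-- The function `q` with `t log (s φ(t)^a) = q(s,t)` for `t > 0`. -/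
noncomputable def psiLog (a s t : ℝ) : ℝ := t * Real.log s + a * (t ^ 2 - 1)

/-- The smooth positive function `H` with `φ⁻¹(s φ(t)^a) = H(s,t) t`. -/
noncomputable def psiFactor (a s t : ℝ) : ℝ :=
  2 / (√(psiLog a s t ^ 2 + 4 * t ^ 2) - psiLog a s t)

lemma psi_radicand_pos {a : ℝ} (ha : 0 < a) (s t : ℝ) : 0 < psiLog a s t ^ 2 + 4 * t ^ 2 := by
  rcases eq_or_ne t 0 with rfl | ht
  · simp only [psiLog]; norm_num; positivity
  · positivity

/-- The rationalised quotient, unlike (√(q² + 4t²) + q)/(2t²), survives at t = 0: there q = -a < 0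
and the denominator is 2a. For t ≠ 0 the root exceeds |q|. -/
lemma psi_denom_pos {a : ℝ} (ha : 0 < a) (s t : ℝ) :
    0 < √(psiLog a s t ^ 2 + 4 * t ^ 2) - psiLog a s t := by
  rw [sub_pos]
  rcases eq_or_ne t 0 with rfl | ht
  · refine lt_of_lt_of_le (b := 0) ?_ (Real.sqrt_nonneg _)
    simp only [psiLog]; norm_num; exact ha
  · calc psiLog a s t ≤ |psiLog a s t| := le_abs_self _
      _ = √(psiLog a s t ^ 2) := (Real.sqrt_sq_eq_abs _).symm
      _ < _ := Real.sqrt_lt_sqrt (sq_nonneg _) (by linarith [show 0 < 4 * t ^ 2 by positivity])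

lemma psiFactor_pos {a : ℝ} (ha : 0 < a) (s t : ℝ) : 0 < psiFactor a s t :=
  div_pos two_pos (psi_denom_pos ha s t)

lemma psiFactor_zero {a : ℝ} (ha : 0 < a) (s : ℝ) : psiFactor a s 0 = a⁻¹ := by
  simp only [psiFactor, psiLog]
  norm_num
  rw [Real.sqrt_sq ha.le]
  field_simp
  norm_num

lemma contDiffOn_psiFactor {a : ℝ} (ha : 0 < a) :
    ContDiffOn ℝ ∞ (fun p : ℝ × ℝ => psiFactor a p.1 p.2) {p | 0 < p.1} := by
  have hl : ContDiffOn ℝ ∞ (fun p : ℝ × ℝ => psiLog a p.1 p.2) {p | 0 < p.1} := by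
    refine (contDiffOn_snd.mul (contDiffOn_fst.log fun p hp => ne_of_gt hp)).add ?_
    exact contDiffOn_const.mul ((contDiffOn_snd.pow 2).sub contDiffOn_const)
  refine contDiffOn_const.div (((hl.pow 2).add (contDiffOn_const.mul (contDiffOn_snd.pow 2))).sqrt
    (fun p _ => (psi_radicand_pos ha p.1 p.2).ne') |>.sub hl)
    fun p _ => (psi_denom_pos ha p.1 p.2).ne'

lemma profileInv_zero : profileInv 0 = 0 := by simp [profileInv]

/-- For t > 0 the logarithm of s φ(t)^a is q/t, and the formula for φ⁻¹ gives (q + √(q² +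
4t²))/(2t). -/
lemma profileInv_mul_profile_rpow {a s t : ℝ} (ha : 0 < a) (hs : 0 < s) (ht : 0 ≤ t) :
    profileInv (s * profile t ^ a) = psiFactor a s t * t := by
  rcases ht.eq_or_lt with rfl | ht
  · rw [profile_zero, Real.zero_rpow ha.ne', mul_zero, mul_zero, profileInv_zero]
  · have hp := profile_pos ht
    have hlog : Real.log (s * profile t ^ a) = psiLog a s t / t := by
      rw [Real.log_mul hs.ne' (Real.rpow_pos_of_pos hp a).ne', Real.log_rpow hp, profile,
        if_neg ht.ne', Real.log_exp, psiLog]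
      field_simp
    have hne : s * profile t ^ a ≠ 0 := (mul_pos hs (Real.rpow_pos_of_pos hp a)).ne'
    have hd := psi_denom_pos ha s t
    have hsq : √(psiLog a s t ^ 2 + 4 * t ^ 2) ^ 2 = psiLog a s t ^ 2 + 4 * t ^ 2 :=
      Real.sq_sqrt (psi_radicand_pos ha s t).le
    have hsqrt : √((psiLog a s t / t) ^ 2 + 4) = √(psiLog a s t ^ 2 + 4 * t ^ 2) / t := by
      rw [eq_div_iff ht.ne', ← Real.sqrt_sq ht.le, ← Real.sqrt_mul (by positivity),
        Real.sqrt_sq ht.le]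
      congr 1
      field_simp
    rw [profileInv, if_neg hne, hlog, hsqrt, psiFactor, ← add_div, div_div, div_mul_eq_mul_div,
      div_eq_div_iff (by positivity) hd.ne']
    -- The identity (√(q² + 4t²) + q)(√(q² + 4t²) - q) = 4t².
    linear_combination hsq

lemma contDiffOn_profileInv : ContDiffOn ℝ ∞ profileInv (Ioi 0) := by
  have hl : ContDiffOn ℝ ∞ Real.log (Ioi 0) := contDiffOn_id.log fun p hp => ne_of_gt hp
  have : ContDiffOn ℝ ∞ (fun y => (Real.log y + √(Real.log y ^ 2 + 4)) / 2) (Ioi 0) :=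
    (hl.add (((hl.pow 2).add contDiffOn_const).sqrt fun p _ => by positivity)).div_const 2
  exact this.congr fun y hy => by rw [profileInv, if_neg (ne_of_gt hy)]

lemma tendsto_psi_div {a s : ℝ} (ha : 0 < a) (hs : 0 < s) :
    Tendsto (fun t => profileInv (s * profile t ^ a) / t) (𝓝[>] 0) (𝓝 a⁻¹) := by
  have hc : ContinuousAt (fun t => psiFactor a s t) 0 := by
    have h1 : ContinuousAt (fun p : ℝ × ℝ => psiFactor a p.1 p.2) (s, 0) :=
      (contDiffOn_psiFactor ha).continuousOn.continuousAt
        ((isOpen_lt continuous_const continuous_fst).mem_nhds hs)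
    exact ContinuousAt.comp (f := fun t : ℝ => (s, t)) (x := 0) h1
      (continuousAt_const.prodMk continuousAt_id)
  have h := hc.tendsto.mono_left (nhdsWithin_le_nhds (s := Ioi 0))
  rw [psiFactor_zero ha] at h
  refine h.congr' ?_
  filter_upwards [self_mem_nhdsWithin] with t ht
  have ht' : (0 : ℝ) < t := ht
  rw [profileInv_mul_profile_rpow ha hs ht'.le, mul_div_cancel_right₀ _ ht'.ne']

lemma stronglyCSmooth_psi {a : ℝ} (ha : 0 < a) :
    StronglyCSmooth 1 1 {x : Fin 2 → ℝ | 0 ≤ x 0 ∧ 0 < x 1}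
      (fun x => (fun _ => profileInv (x 1 * profile (x 0) ^ a) : Fin 1 → ℝ)) := by
  have hF : ContDiffOn ℝ ∞ (fun x : Fin 2 → ℝ => psiFactor a (x 1) (x 0)) {x | 0 < x 1} :=
    (contDiffOn_psiFactor ha).comp (s := {x : Fin 2 → ℝ | 0 < x 1})
      (f := fun x : Fin 2 → ℝ => (x 1, x 0)) (ContDiff.contDiffOn (by fun_prop)) fun x hx => hx
  have heq : ∀ x ∈ {x : Fin 2 → ℝ | 0 ≤ x 0 ∧ 0 < x 1},
      profileInv (x 1 * profile (x 0) ^ a) = psiFactor a (x 1) (x 0) * x 0 :=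
    fun x hx => profileInv_mul_profile_rpow ha hx.2 hx.1
  have hsmul : ContDiffOn ℝ ∞ (fun x : Fin 2 → ℝ => psiFactor a (x 1) (x 0) * x 0)
      {x | 0 < x 1} := hF.mul (ContDiff.contDiffOn (by fun_prop))
  refine ⟨contDiffOn_pi.2 fun _ => (hsmul.mono fun x hx => hx.2).congr heq, fun u hu => ?_⟩
  by_cases h0 : u 0 = 0
  · refine ⟨univ, isOpen_univ, mem_univ _, fun j _ => Or.inl
      ⟨fun x => psiFactor a (x 1) (x 0), Pi.single 0 1, ⟨hF.mono fun x hx => hx.2.2,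
        fun x _ => psiFactor_pos ha _ _, fun i hi => ?_, fun x hx => ?_⟩, ?_, fun i => ?_⟩⟩
    · fin_cases i
      · exact ⟨by simp, h0⟩
      · simp at hi
    · refine (heq x hx.2).trans ?_
      rw [Fin.prod_univ_two]; simp
    · rintro i hi j hj
      fin_cases i <;> fin_cases j <;> simp_all
    · fin_cases i <;> simp
  -- At points with t > 0 the support condition forces the exponent 0, so the factor t is absorbed
  -- into F.
  · have hopen : IsOpen {x : Fin 2 → ℝ | 0 < x 0} := isOpen_lt continuous_const (continuous_apply 0)
    refine ⟨_, hopen, lt_of_le_of_ne hu.1 (Ne.symm h0), fun j _ => Or.inl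
      ⟨fun x => psiFactor a (x 1) (x 0) * x 0, 0, ⟨hsmul.mono fun x hx => hx.2.2,
        fun x hx => mul_pos (psiFactor_pos ha _ _) hx.1, fun i hi => by simp at hi,
        fun x hx => ?_⟩, fun i hi => by simp at hi, fun i => by simp⟩⟩
    refine (heq x hx.2).trans ?_
    simp

end ACorners

namespace ACorners

open Filter Function

/-! ### Classes of maps between local models

The a-smooth and the smooth maps are treated together: both are given by a class of functions, a
set of exponents, and a set of exponents allowed for strong maps. -/

/-- `g = F x_1^{a_1} ⋯ x_k^{a_k}` on `V`, with `F > 0` in the class `S` and exponents in `E`. -/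
structure IsFactorization (S : ∀ (_ : ℕ) {m : ℕ}, Set (Fin m → ℝ) → ((Fin m → ℝ) → ℝ) → Prop)
    (E : Set ℝ) (k : ℕ) {m : ℕ} (V : Set (Fin m → ℝ)) (u : Fin m → ℝ)
    (g : (Fin m → ℝ) → ℝ) (F : (Fin m → ℝ) → ℝ) (a : Fin m → ℝ) : Prop where
  smooth : S k V F
  pos : ∀ x ∈ V, 0 < F x
  mem : ∀ i, a i ∈ E
  support : ∀ i, a i ≠ 0 → (i : ℕ) < k ∧ u i = 0
  eq : ∀ x ∈ V, g x = F x * ∏ i, x i ^ a i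

/-- The maps whose components are in the class `S`, respectively have local factorizations with
exponents satisfying `Q`. -/
def IsMapWith (S : ∀ (_ : ℕ) {m : ℕ}, Set (Fin m → ℝ) → ((Fin m → ℝ) → ℝ) → Prop)
    (E : Set ℝ) (Q : ∀ m : ℕ, (Fin m → ℝ) → Prop) (k l : ℕ) {m n : ℕ} (U : Set (Fin m → ℝ))
    (f : (Fin m → ℝ) → (Fin n → ℝ)) : Prop :=
  ContinuousOn f U ∧
  (∀ j : Fin n, l ≤ (j : ℕ) → S k U (fun x => f x j)) ∧
  ∀ u ∈ U, ∃ W : Set (Fin m → ℝ), IsOpen W ∧ u ∈ W ∧ ∀ j : Fin n, (j : ℕ) < l →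
    (∃ F a, IsFactorization S E k (W ∩ U) u (fun x => f x j) F a ∧ Q m a) ∨
      (∀ x ∈ W ∩ U, f x j = 0)

/-- A class of functions and exponents defining a category of maps between local models. -/
structure LocalClass where
  S : ∀ (_ : ℕ) {m : ℕ}, Set (Fin m → ℝ) → ((Fin m → ℝ) → ℝ) → Prop
  E : Subsemiring ℝ
  strongE : Submonoid ℝ
  nonneg : ∀ b ∈ E, 0 ≤ b
  zero_mem_strongE : (0 : ℝ) ∈ strongE
  -- Exponents of mutually inverse maps multiply to 1; this condition makes transition maps strong.
  mem_strongE : ∀ a ∈ E, ∀ b ∈ E, a * b = 1 → a ∈ strongE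
  continuousOn : ∀ {k m : ℕ} {U : Set (Fin m → ℝ)} {F : (Fin m → ℝ) → ℝ}, S k U F →
    ContinuousOn F U
  congr : ∀ {k m : ℕ} {U : Set (Fin m → ℝ)} {F G : (Fin m → ℝ) → ℝ}, IsOpenIn k U → S k U F →
    EqOn F G U → S k U G
  inter_open : ∀ {k m : ℕ} {U : Set (Fin m → ℝ)} {F : (Fin m → ℝ) → ℝ}, IsOpenIn k U → S k U F →
    ∀ {W : Set (Fin m → ℝ)}, IsOpen W → S k (W ∩ U) F
  of_local : ∀ {k m : ℕ} {U : Set (Fin m → ℝ)} {F : (Fin m → ℝ) → ℝ}, IsOpenIn k U →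
    (∀ u ∈ U, ∃ W, IsOpen W ∧ u ∈ W ∧ S k (W ∩ U) F) → S k U F
  one : ∀ {k m : ℕ} {U : Set (Fin m → ℝ)}, IsOpenIn k U → S k U (fun _ => 1)
  mul : ∀ {k m : ℕ} {U : Set (Fin m → ℝ)} {F G : (Fin m → ℝ) → ℝ}, IsOpenIn k U → S k U F →
    S k U G → S k U (fun x => F x * G x)
  rpow : ∀ {k m : ℕ} {U : Set (Fin m → ℝ)} {F : (Fin m → ℝ) → ℝ}, IsOpenIn k U → S k U F →
    (∀ x ∈ U, 0 < F x) → ∀ b ∈ E, S k U (fun x => F x ^ b)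
  comp : ∀ {k l m n : ℕ} {U : Set (Fin m → ℝ)} {V : Set (Fin n → ℝ)}, IsOpenIn k U →
    IsOpenIn l V → ∀ {f : (Fin m → ℝ) → (Fin n → ℝ)}, IsMapWith S E (fun _ _ => True) k l U f →
    MapsTo f U V → ∀ {g : (Fin n → ℝ) → ℝ}, S l V g → S k U (fun x => g (f x))

lemma exists_open_preimage {X Y : Type*} [TopologicalSpace X] [TopologicalSpace Y] {U : Set X}
    {f : X → Y} (hf : ContinuousOn f U) {O : Set Y} (hO : IsOpen O) :
    ∃ W, IsOpen W ∧ ∀ x ∈ U, x ∈ W ↔ f x ∈ O := by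
  obtain ⟨W, hW, h⟩ := continuousOn_iff'.1 hf O hO
  refine ⟨W, hW, fun x hx => ?_⟩
  have := Set.ext_iff.1 h x
  simp only [mem_inter_iff, hx, and_true, mem_preimage] at this
  exact this.symm

/-- There are interior points arbitrarily near to any point; one coordinate can be kept. -/
lemma IsOpenIn.exists_pos {k m : ℕ} {U W : Set (Fin m → ℝ)} (hU : IsOpenIn k U) (hW : IsOpen W)
    {u : Fin m → ℝ} (hu : u ∈ W ∩ U) (s : Set (Fin m)) :
    ∃ x ∈ W ∩ U, (∀ i ∈ s, x i = u i) ∧ ∀ i ∉ s, (i : ℕ) < k → 0 < x i := by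
  classical
  obtain ⟨O, hO, rfl⟩ := hU
  -- All coordinates outside `s` are pushed inwards by the same small t > 0.
  let γ : ℝ → Fin m → ℝ := fun t i => if i ∈ s then u i else u i + t
  have hγ : Continuous γ := continuous_pi fun i => by
    by_cases h : i ∈ s
    · simp only [γ, h, if_true]; exact continuous_const
    · simp only [γ, h, if_false]; fun_prop
  have h0 : γ 0 = u := by funext i; simp [γ]
  have hev : ∀ᶠ t in 𝓝[>] (0 : ℝ), γ t ∈ W ∩ O :=
    nhdsWithin_le_nhds (hγ.continuousAt.eventually
      ((hW.inter hO).mem_nhds (by rw [h0]; exact ⟨hu.1, hu.2.2⟩)))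
  obtain ⟨t, ht, ht0⟩ := (hev.and self_mem_nhdsWithin).exists
  have ht0 : 0 < t := ht0
  refine ⟨γ t, ⟨ht.1, fun i hi => ?_, ht.2⟩, fun i hi => by simp [γ, hi], fun i hi hik => ?_⟩
  · have := hu.2.1 i hi
    simp only [γ]; split_ifs <;> linarith
  · have := hu.2.1 i hik
    simp only [γ, hi, if_false]; linarith

namespace LocalClass

variable (C : LocalClass)

/-- Maps of the class. -/
def Weak (k l : ℕ) {m n : ℕ} (U : Set (Fin m → ℝ)) (f : (Fin m → ℝ) → (Fin n → ℝ)) : Prop :=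
  IsMapWith C.S C.E (fun _ _ => True) k l U f

/-- The condition on the exponents of strong maps. -/
def StrongExp (m : ℕ) (a : Fin m → ℝ) : Prop :=
  {i | 0 < a i}.Subsingleton ∧ ∀ i, a i ∈ C.strongE

/-- Strong maps of the class. -/
def Strong (k l : ℕ) {m n : ℕ} (U : Set (Fin m → ℝ)) (f : (Fin m → ℝ) → (Fin n → ℝ)) : Prop :=
  IsMapWith C.S C.E C.StrongExp k l U f

variable {C} {Q : ∀ m : ℕ, (Fin m → ℝ) → Prop} {k l p m n q : ℕ}
  {U : Set (Fin m → ℝ)} {V : Set (Fin n → ℝ)}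
  {f f' : (Fin m → ℝ) → (Fin n → ℝ)} {g : (Fin n → ℝ) → (Fin q → ℝ)}

lemma isMapWith_weak (hf : IsMapWith C.S C.E Q k l U f) : C.Weak k l U f :=
  ⟨hf.1, hf.2.1, fun u hu => by
    obtain ⟨W, hW, huW, h⟩ := hf.2.2 u hu
    exact ⟨W, hW, huW, fun j hj => (h j hj).imp
      (fun ⟨F, a, h1, _⟩ => ⟨F, a, h1, trivial⟩) id⟩⟩

lemma Strong.weak (hf : C.Strong k l U f) : C.Weak k l U f := isMapWith_weak hf

lemma factorization_inter_open (hU : IsOpenIn k U) {u : Fin m → ℝ} {g F : (Fin m → ℝ) → ℝ}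
    {a : Fin m → ℝ} (h : IsFactorization C.S C.E k U u g F a) {W : Set (Fin m → ℝ)}
    (hW : IsOpen W) : IsFactorization C.S C.E k (W ∩ U) u g F a :=
  ⟨C.inter_open hU h.smooth hW, fun x hx => h.pos x hx.2, h.mem, h.support,
    fun x hx => h.eq x hx.2⟩

lemma isMapWith_congr (hU : IsOpenIn k U) (hf : IsMapWith C.S C.E Q k l U f) (h : EqOn f f' U) :
    IsMapWith C.S C.E Q k l U f' := by
  refine ⟨hf.1.congr h.symm, fun j hj => C.congr hU (hf.2.1 j hj) fun x hx => by
    simp only [h hx], fun u hu => ?_⟩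
  obtain ⟨W, hW, huW, hfac⟩ := hf.2.2 u hu
  refine ⟨W, hW, huW, fun j hj => (hfac j hj).imp ?_ fun h' x hx => by rw [← h hx.2, h' x hx]⟩
  rintro ⟨F, a, h1, h2⟩
  exact ⟨F, a, ⟨h1.smooth, h1.pos, h1.mem, h1.support, fun x hx => by
    rw [← h1.eq x hx]; simp only [h hx.2]⟩, h2⟩

lemma isMapWith_inter_open (hU : IsOpenIn k U) (hf : IsMapWith C.S C.E Q k l U f)
    {W : Set (Fin m → ℝ)} (hW : IsOpen W) : IsMapWith C.S C.E Q k l (W ∩ U) f := by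
  refine ⟨hf.1.mono inter_subset_right, fun j hj => C.inter_open hU (hf.2.1 j hj) hW,
    fun u hu => ?_⟩
  obtain ⟨W', hW', huW', hfac⟩ := hf.2.2 u hu.2
  refine ⟨W', hW', huW', fun j hj => (hfac j hj).imp ?_
    fun h' x hx => h' x ⟨hx.1, hx.2.2⟩⟩
  rintro ⟨F, a, h1, h2⟩
  refine ⟨F, a, ?_, h2⟩
  rw [inter_left_comm]
  exact factorization_inter_open (hU.inter_open hW') h1 hW

lemma isMapWith_of_local (hU : IsOpenIn k U)
    (h : ∀ u ∈ U, ∃ W, IsOpen W ∧ u ∈ W ∧ IsMapWith C.S C.E Q k l (W ∩ U) f) :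
    IsMapWith C.S C.E Q k l U f := by
  refine ⟨fun u hu => ?_, fun j hj => C.of_local hU fun u hu => ?_, fun u hu => ?_⟩
  · obtain ⟨W, hW, huW, hf⟩ := h u hu
    have := hf.1 u ⟨huW, hu⟩
    rwa [ContinuousWithinAt, nhdsWithin_open_inter hW huW] at this
  · obtain ⟨W, hW, huW, hf⟩ := h u hu
    exact ⟨W, hW, huW, hf.2.1 j hj⟩
  · obtain ⟨W, hW, huW, hf⟩ := h u hu
    obtain ⟨W', hW', huW', hfac⟩ := hf.2.2 u ⟨huW, hu⟩
    exact ⟨W' ∩ W, hW'.inter hW, ⟨huW', huW⟩, by simpa only [inter_assoc] using hfac⟩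

lemma prod (hU : IsOpenIn k U) {ι : Type*} (s : Finset ι) {F : ι → (Fin m → ℝ) → ℝ}
    (hF : ∀ j ∈ s, C.S k U (F j)) : C.S k U (fun x => ∏ j ∈ s, F j x) := by
  classical
  induction s using Finset.induction_on with
  | empty => simpa using C.one hU
  | insert j s hj ih =>
    simp only [Finset.prod_insert hj]
    exact C.mul hU (hF j (Finset.mem_insert_self _ _))
      (ih fun a ha => hF a (Finset.mem_insert_of_mem ha))

/-- The exponents of a composition. -/
lemma prod_rpow_comp {x : Fin m → ℝ} (hx : x ∈ orthant k m) {y F : Fin n → ℝ} {b : Fin n → ℝ}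
    {A : Fin n → Fin m → ℝ} (hb : ∀ j, 0 ≤ b j) (hA : ∀ j i, 0 ≤ A j i)
    (hAk : ∀ j i, A j i ≠ 0 → (i : ℕ) < k) (hF : ∀ j, 0 < F j)
    (hy : ∀ j, b j ≠ 0 → y j = F j * ∏ i, x i ^ A j i) :
    ∏ j, y j ^ b j = (∏ j, F j ^ b j) * ∏ i, x i ^ (∑ j, b j * A j i) := by
  -- Coordinates with i ≥ k may be negative, but their exponents are 0.
  have hnn : ∀ j i, 0 ≤ x i ^ A j i := fun j i => by
    by_cases h : A j i = 0
    · simp [h]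
    · exact Real.rpow_nonneg (hx i (hAk j i h)) _
  have h1 : ∀ j, y j ^ b j = F j ^ b j * ∏ i, x i ^ (b j * A j i) := by
    intro j
    by_cases h : b j = 0
    · simp [h]
    · rw [hy j h, Real.mul_rpow (hF j).le (Finset.prod_nonneg fun i _ => hnn j i),
        ← Real.finsetProd_rpow _ _ fun i _ => hnn j i]
      congr 1
      refine Finset.prod_congr rfl fun i _ => ?_
      by_cases h' : A j i = 0
      · simp [h']
      · rw [← Real.rpow_mul (hx i (hAk j i h')), mul_comm]
  simp only [h1, Finset.prod_mul_distrib]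
  rw [Finset.prod_comm]
  congr 1
  refine Finset.prod_congr rfl fun i _ => ?_
  by_cases hi : (i : ℕ) < k
  · rw [Real.rpow_sum_of_nonneg (hx i hi) fun j _ => mul_nonneg (hb j) (hA j i)]
  · have : ∀ j, A j i = 0 := fun j => by
      by_contra h; exact hi (hAk j i h)
    simp [this]

/-- Substituting the factorizations of f into that of g gives the exponents ∑_j b_j A_ji; `hQ` says
that the condition on exponents survives this. -/
theorem isMapWith_comp (hU : IsOpenIn k U) (hV : IsOpenIn l V)
    (hQ : ∀ (m n : ℕ) (b : Fin n → ℝ) (A : Fin n → Fin m → ℝ), (∀ j, b j ∈ C.E) →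
      (∀ j i, A j i ∈ C.E) → Q n b → (∀ j, b j ≠ 0 → Q m (A j)) →
      Q m (fun i => ∑ j, b j * A j i))
    (hf : IsMapWith C.S C.E Q k l U f) (hfV : MapsTo f U V)
    (hg : IsMapWith C.S C.E Q l p V g) : IsMapWith C.S C.E Q k p U (fun x => g (f x)) := by
  classical
  have hfw : C.Weak k l U f := isMapWith_weak hf
  refine ⟨hg.1.comp hf.1 hfV, fun j hj => C.comp hU hV hfw hfV (hg.2.1 j hj), fun u hu => ?_⟩
  obtain ⟨W₁, hW₁, huW₁, hfac⟩ := hf.2.2 u hu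
  obtain ⟨W₂, hW₂, huW₂, gfac⟩ := hg.2.2 (f u) (hfV hu)
  obtain ⟨O, hO, hOW⟩ := exists_open_preimage hf.1 hW₂
  refine ⟨O ∩ W₁, hO.inter hW₁, ⟨(hOW u hu).2 huW₂, huW₁⟩, fun j hj => ?_⟩
  have hU' : IsOpenIn k ((O ∩ W₁) ∩ U) := hU.inter_open (hO.inter hW₁)
  have hm : MapsTo f ((O ∩ W₁) ∩ U) (W₂ ∩ V) := fun x hx =>
    ⟨(hOW x hx.2).1 hx.1.1, hfV hx.2⟩
  rcases gfac j hj with ⟨G, b, hG, hQb⟩ | h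
  swap
  · exact Or.inr fun x hx => h _ (hm hx)
  -- A vanishing component of f that enters with nonzero exponent kills the composite component.
  by_cases hz : ∃ i, b i ≠ 0 ∧ ∀ x ∈ W₁ ∩ U, f x i = 0
  · obtain ⟨i, hbi, hi⟩ := hz
    refine Or.inr fun x hx => ?_
    refine (hG.eq _ (hm hx)).trans ?_
    rw [Finset.prod_eq_zero (Finset.mem_univ i), mul_zero]
    rw [hi x ⟨hx.1.2, hx.2⟩, Real.zero_rpow hbi]
  left
  push Not at hz
  -- A component with b_i = 0 may vanish or belong to an unrestricted coordinate; it enters as a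
  -- zeroth power, so the trivial factorization serves.
  have hex : ∀ i, ∃ (F : (Fin m → ℝ) → ℝ) (a : Fin m → ℝ), C.S k (W₁ ∩ U) F ∧
      (∀ x ∈ W₁ ∩ U, 0 < F x) ∧ (∀ r, a r ∈ C.E) ∧
      (∀ r, a r ≠ 0 → (r : ℕ) < k ∧ u r = 0) ∧
      (b i ≠ 0 → (∀ x ∈ W₁ ∩ U, f x i = F x * ∏ r, x r ^ a r) ∧ Q m a) := by
    intro i
    by_cases hbi : b i = 0
    · exact ⟨fun _ => 1, fun _ => 0, C.one (hU.inter_open hW₁), fun _ _ => one_pos,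
        fun _ => C.E.zero_mem, fun _ h => absurd rfl h, fun h => absurd hbi h⟩
    · rcases hfac i (hG.support i hbi).1 with ⟨F, a, hF, hQa⟩ | h
      · exact ⟨F, a, hF.smooth, hF.pos, hF.mem, hF.support, fun _ => ⟨hF.eq, hQa⟩⟩
      · obtain ⟨x, hx, hx0⟩ := hz i hbi
        exact absurd (h x hx) hx0
  choose F A hFS hFpos hAE hAs hFeq using hex
  refine ⟨fun x => G (f x) * ∏ i, F i x ^ b i, fun r => ∑ i, b i * A i r, ⟨?_, ?_, ?_, ?_, ?_⟩,
    hQ m n b A hG.mem hAE hQb fun i hi => (hFeq i hi).2⟩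
  · have hsub : (O ∩ W₁) ∩ U = O ∩ (W₁ ∩ U) := inter_assoc _ _ _
    refine C.mul hU' (C.comp hU' (hV.inter_open hW₂)
      (isMapWith_inter_open hU hfw (hO.inter hW₁)) hm hG.smooth) (prod hU' _ fun i _ => ?_)
    refine C.rpow hU' ?_ (fun x hx => hFpos i x ⟨hx.1.2, hx.2⟩) _ (hG.mem i)
    rw [hsub]
    exact C.inter_open (hU.inter_open hW₁) (hFS i) hO
  · intro x hx
    exact mul_pos (hG.pos _ (hm hx)) (Finset.prod_pos fun i _ =>
      Real.rpow_pos_of_pos (hFpos i x ⟨hx.1.2, hx.2⟩) _)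
  · exact fun r => C.E.sum_mem fun i _ => C.E.mul_mem (hG.mem i) (hAE i r)
  · intro r hr
    obtain ⟨i, -, hi⟩ := Finset.exists_ne_zero_of_sum_ne_zero hr
    exact hAs i r (right_ne_zero_of_mul hi)
  · intro x hx
    refine (hG.eq _ (hm hx)).trans ?_
    rw [prod_rpow_comp (hU.subset_orthant hx.2) (fun i => C.nonneg _ (hG.mem i))
      (fun i r => C.nonneg _ (hAE i r)) (fun i r h => (hAs i r h).1)
      (fun i => hFpos i x ⟨hx.1.2, hx.2⟩)
      (fun i hi => (hFeq i hi).1 x ⟨hx.1.2, hx.2⟩), mul_assoc]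

/-- At most one b_j is nonzero, so the sum reduces to one product b_j A_ji. -/
lemma strongExp_comp (m n : ℕ) (b : Fin n → ℝ) (A : Fin n → Fin m → ℝ) (hb : ∀ j, b j ∈ C.E)
    (_ : ∀ j i, A j i ∈ C.E) (hQb : C.StrongExp n b)
    (hQA : ∀ j, b j ≠ 0 → C.StrongExp m (A j)) :
    C.StrongExp m (fun i => ∑ j, b j * A j i) := by
  have hb0 : ∀ j, b j ≠ 0 → 0 < b j := fun j h =>
    lt_of_le_of_ne (C.nonneg _ (hb j)) (Ne.symm h)
  by_cases hz : ∀ j, b j = 0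
  · have : (fun i => ∑ j, b j * A j i) = fun _ => (0 : ℝ) := by funext i; simp [hz]
    rw [this]
    exact ⟨fun i hi => absurd (show (0 : ℝ) < 0 from hi) (lt_irrefl _), fun _ => C.zero_mem_strongE⟩
  · push Not at hz
    obtain ⟨j, hj⟩ := hz
    have hsum : (fun i => ∑ j, b j * A j i) = fun i => b j * A j i := by
      funext i
      refine Finset.sum_eq_single j (fun j' _ hne => ?_) (by simp)
      have : b j' = 0 := by
        by_contra h
        exact hne (hQb.1 (hb0 j' h) (hb0 j hj))
      rw [this, zero_mul]
    rw [hsum]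
    refine ⟨fun i hi i' hi' => (hQA j hj).1 ?_ ?_, fun i =>
      C.strongE.mul_mem (hQb.2 j) ((hQA j hj).2 i)⟩
    · exact pos_of_mul_pos_right hi (hb0 j hj).le
    · exact pos_of_mul_pos_right hi' (hb0 j hj).le

/-! ### Interior maps -/

/-- A map of the class is interior if and only if it maps interior points to interior points. -/
theorem nowhereLocallyZero_iff (hU : IsOpenIn k U) (hf : IsMapWith C.S C.E Q k l U f) :
    NowhereLocallyZero l U f ↔ ∀ x ∈ U, (∀ i : Fin m, (i : ℕ) < k → 0 < x i) →
      ∀ j : Fin n, (j : ℕ) < l → 0 < f x j := by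
  constructor
  · intro h x hx hpos j hj
    obtain ⟨W, hW, hxW, hfac⟩ := hf.2.2 x hx
    rcases hfac j hj with ⟨F, a, hF, -⟩ | h'
    -- At an interior point no exponent is allowed by the support condition.
    · have ha : ∀ i, a i = 0 := fun i => by
        by_contra hi
        exact (hpos i (hF.support i hi).1).ne' (hF.support i hi).2
      rw [hF.eq x ⟨hxW, hx⟩]
      simpa [ha] using hF.pos x ⟨hxW, hx⟩
    · exact absurd h' (h x hx W hW hxW j hj)
  · intro h u hu W hW huW j hj h0
    obtain ⟨x, hx, -, hpos⟩ := hU.exists_pos hW ⟨huW, hu⟩ ∅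
    exact (h x hx.2 (fun i hi => hpos i (by simp) hi) j hj).ne' (h0 x hx)

/-! ### Invertible maps are strong and interior -/

lemma factorization_apply_eq_zero_iff (hU : IsOpenIn k U) {u x : Fin m → ℝ}
    {h F : (Fin m → ℝ) → ℝ} {a : Fin m → ℝ} {W : Set (Fin m → ℝ)}
    (hF : IsFactorization C.S C.E k (W ∩ U) u h F a) (hx : x ∈ W ∩ U) :
    h x = 0 ↔ ∃ i, a i ≠ 0 ∧ x i = 0 := by
  rw [hF.eq x hx, mul_eq_zero, or_iff_right (hF.pos x hx).ne', Finset.prod_eq_zero_iff]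
  simp only [Finset.mem_univ, true_and]
  refine exists_congr fun i => ⟨fun hi => ?_, fun hi => by rw [hi.2, Real.zero_rpow hi.1]⟩
  have ha : a i ≠ 0 := fun h => by simp [h] at hi
  exact ⟨ha, ((Real.rpow_eq_zero_iff_of_nonneg
    (hU.subset_orthant hx.2 i (hF.support i ha).1)).1 hi).1⟩

variable {g : (Fin n → ℝ) → (Fin m → ℝ)}

/-- Near f(u) there are points y of `V` with all boundary coordinates positive, and g(y) lies near u
with f(g(y)) = y. -/
theorem nowhereLocallyZero_of_inverse (hV : IsOpenIn l V) (hfV : MapsTo f U V)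
    (hgU : MapsTo g V U) (hinv : InvOn g f U V) (hg : ContinuousOn g V) :
    NowhereLocallyZero l U f := by
  intro u hu W hW huW j hj h0
  obtain ⟨O, hO, hOW⟩ := exists_open_preimage hg hW
  have hfu : f u ∈ O ∩ V := ⟨(hOW _ (hfV hu)).2 (by rwa [hinv.1 hu]), hfV hu⟩
  obtain ⟨y, hy, -, hpos⟩ := hV.exists_pos hO hfu ∅
  have h1 := h0 (g y) ⟨(hOW y hy.2).1 hy.1, hgU hy.2⟩
  rw [hinv.2 hy.2] at h1
  exact (hpos j (by simp) hj).ne' h1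

/-- Near u choose x whose only boundary coordinate not made positive is x_{i'}, which stays 0. Then
f_j(x) = 0, hence x_i = g_i(f(x)) = 0, which is possible only for i = i'. -/
lemma eq_of_inverse_exponents (hU : IsOpenIn k U) (hV : IsOpenIn l V) (hfV : MapsTo f U V)
    (hinv : LeftInvOn g f U) (hf : ContinuousOn f U) {u : Fin m → ℝ} (hu : u ∈ U)
    {i i' : Fin m} {j : Fin n} {W : Set (Fin m → ℝ)} {W' : Set (Fin n → ℝ)}
    (hW : IsOpen W) (huW : u ∈ W) (hW' : IsOpen W') (huW' : f u ∈ W')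
    {F : (Fin m → ℝ) → ℝ} {G : (Fin n → ℝ) → ℝ} {a : Fin m → ℝ} {b : Fin n → ℝ}
    (hi : (i : ℕ) < k)
    (hF : IsFactorization C.S C.E k (W ∩ U) u (fun x => f x j) F a)
    (hG : IsFactorization C.S C.E l (W' ∩ V) (f u) (fun x => g x i) G b)
    (hb : b j ≠ 0) (ha : a i' ≠ 0) : i' = i := by
  obtain ⟨O, hO, hOW⟩ := exists_open_preimage hf hW'
  obtain ⟨x, hx, hx', hpos⟩ := hU.exists_pos (hO.inter hW) ⟨⟨(hOW u hu).2 huW', huW⟩, hu⟩ {i'}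
  have hxi' : x i' = 0 := by rw [hx' i' rfl, (hF.support i' ha).2]
  have h1 : f x j = 0 :=
    (factorization_apply_eq_zero_iff hU hF ⟨hx.1.2, hx.2⟩).2 ⟨i', ha, hxi'⟩
  have h2 : g (f x) i = 0 := (factorization_apply_eq_zero_iff hV hG
    ⟨(hOW x hx.2).1 hx.1.1, hfV hx.2⟩).2 ⟨j, hb, h1⟩
  rw [hinv hx.2] at h2
  by_contra hne
  exact (hpos i (fun h => hne (mem_singleton_iff.1 h).symm) hi).ne' h2

/-- Here t^(1-c) = H(t) has a finite positive limit as t → 0⁺, which excludes c < 1 and c > 1. -/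
lemma eq_one_of_eq_mul_rpow {H : ℝ → ℝ} {c : ℝ} (hH : ContinuousWithinAt H (Ici 0) 0)
    (hH0 : 0 < H 0) (h : ∀ᶠ t in 𝓝[>] (0 : ℝ), t = H t * t ^ c) : c = 1 := by
  have hlim : Tendsto H (𝓝[>] 0) (𝓝 (H 0)) :=
    hH.tendsto.mono_left (nhdsWithin_mono _ Ioi_subset_Ici_self)
  have hpow : ∀ {d : ℝ}, 0 < d → Tendsto (fun t : ℝ => t ^ d) (𝓝[>] 0) (𝓝 0) := by
    intro d hd
    have := (Real.continuous_rpow_const hd.le).tendsto 0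
    rw [Real.zero_rpow hd.ne'] at this
    exact this.mono_left nhdsWithin_le_nhds
  rcases lt_trichotomy c 1 with hc | hc | hc
  · exfalso
    refine hH0.ne' (tendsto_nhds_unique hlim ((hpow (sub_pos.2 hc)).congr' ?_))
    filter_upwards [h, self_mem_nhdsWithin] with t ht ht0
    have ht0 : 0 < t := ht0
    rw [Real.rpow_sub ht0, Real.rpow_one, div_eq_iff (Real.rpow_pos_of_pos ht0 _).ne']
    exact ht
  · exact hc
  · exfalso
    have h1 := hlim.mul (hpow (sub_pos.2 hc))
    rw [mul_zero] at h1
    refine one_ne_zero (tendsto_nhds_unique (tendsto_const_nhds (x := (1 : ℝ))) (h1.congr' ?_))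
    filter_upwards [h, self_mem_nhdsWithin] with t ht ht0
    have ht0 : 0 < t := ht0
    rw [Real.rpow_sub ht0, Real.rpow_one, mul_div_assoc', div_eq_one_iff_eq ht0.ne', ← ht]

/-- If a_i ≠ 0 in the factorization of f_j, then by comparing zero sets it is the only nonzero
exponent there, and b_j is the only one in that of g_i. Inserting one into the other gives x_i =
H·x_i^(a_i b_j) with H > 0 continuous, so a_i b_j = 1. -/
theorem strong_of_inverse (hU : IsOpenIn k U) (hV : IsOpenIn l V) (hfV : MapsTo f U V)
    (hgU : MapsTo g V U) (hinv : InvOn g f U V) (hf : C.Weak k l U f) (hg : C.Weak l k V g) :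
    C.Strong k l U f := by
  refine ⟨hf.1, hf.2.1, fun u hu => ?_⟩
  obtain ⟨W, hW, huW, hfac⟩ := hf.2.2 u hu
  obtain ⟨W', hW', huW', gfac⟩ := hg.2.2 (f u) (hfV hu)
  refine ⟨W, hW, huW, fun j hj => ?_⟩
  rcases hfac j hj with ⟨F, a, hF, -⟩ | h
  swap
  · exact absurd h (nowhereLocallyZero_of_inverse hV hfV hgU hinv hg.1 u hu W hW huW j hj)
  refine Or.inl ⟨F, a, hF, ?_⟩
  have hgn := nowhereLocallyZero_of_inverse hU hgU hfV hinv.symm hf.1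
  have hgu : g (f u) = u := hinv.1 hu
  have main : ∀ i, a i ≠ 0 → (∀ i', a i' ≠ 0 → i' = i) ∧ a i ∈ C.strongE := by
    intro i hai
    obtain ⟨hik, hui⟩ := hF.support i hai
    rcases gfac i hik with ⟨G, b, hG, -⟩ | h
    swap
    · exact absurd h (hgn (f u) (hfV hu) W' hW' huW' i hik)
    have hbj : ∀ j', b j' ≠ 0 → j' = j := fun j' hj' =>
      eq_of_inverse_exponents hV hU hgU hinv.2 hg.1 (hfV hu) hW' huW' hW (by rwa [hgu]) hj hG
        (by rwa [hgu]) hai hj'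
    have hb : b j ≠ 0 := by
      have h1 : g (f u) i = 0 := by rw [hgu, hui]
      obtain ⟨j', hj', -⟩ := (factorization_apply_eq_zero_iff hV hG ⟨huW', hfV hu⟩).1 h1
      rwa [← hbj j' hj']
    have hai' : ∀ i', a i' ≠ 0 → i' = i := fun i' hi' =>
      eq_of_inverse_exponents hU hV hfV hinv.1 hf.1 hu hW huW hW' huW' hik hF hG hb hi'
    refine ⟨hai', C.mem_strongE _ (hF.mem i) _ (hG.mem j) ?_⟩
    obtain ⟨O, hO, hOW⟩ := exists_open_preimage hf.1 hW'
    set T := (O ∩ W) ∩ U with hT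
    have huT : u ∈ T := ⟨⟨(hOW u hu).2 huW', huW⟩, hu⟩
    have hTo : IsOpenIn k T := hU.inter_open (hO.inter hW)
    have hTF : T ⊆ W ∩ U := fun x hx => ⟨hx.1.2, hx.2⟩
    have hTG : MapsTo f T (W' ∩ V) := fun x hx => ⟨(hOW x hx.2).1 hx.1.1, hfV hx.2⟩
    have heq : ∀ x ∈ T, x i = G (f x) * F x ^ b j * x i ^ (a i * b j) := by
      intro x hx
      have hxi : 0 ≤ x i := hTo.subset_orthant hx i hik
      have h1 : f x j = F x * x i ^ a i := by
        rw [hF.eq x (hTF hx), Finset.prod_eq_single i]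
        · intro i' _ hne
          have : a i' = 0 := by
            by_contra h; exact hne (hai' i' h)
          simp [this]
        · simp
      have h2 : g (f x) i = G (f x) * f x j ^ b j := by
        rw [hG.eq _ (hTG hx), Finset.prod_eq_single j]
        · intro j' _ hne
          have : b j' = 0 := by
            by_contra h; exact hne (hbj j' h)
          simp [this]
        · simp
      rw [hinv.1 hx.2, h1, Real.mul_rpow (hF.pos x (hTF hx)).le (Real.rpow_nonneg hxi _),
        ← Real.rpow_mul hxi, ← mul_assoc] at h2
      exact h2
    have hHc : ContinuousOn (fun x => G (f x) * F x ^ b j) T :=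
      ((C.continuousOn hG.smooth).comp (hf.1.mono inter_subset_right) hTG).mul
        (((C.continuousOn hF.smooth).mono hTF).rpow_const fun x hx =>
          Or.inl (hF.pos x (hTF hx)).ne')
    -- Approaching u with only x_i = t varying, the identity becomes t = H(t) t^(a_i b_j) with H(0)
    -- > 0.
    have hup : Tendsto (fun t => update u i t) (𝓝[≥] 0) (𝓝[orthant k m] u) := by
      refine tendsto_nhdsWithin_iff.2 ⟨?_, ?_⟩
      · have := tendsto_update u i
        rw [hui] at this
        exact this.mono_left nhdsWithin_le_nhds
      · filter_upwards [self_mem_nhdsWithin] with t ht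
        exact update_mem_orthant (hTo.subset_orthant huT) fun _ => ht
    have hu0 : update u i 0 = u := by rw [← hui, update_eq_self]
    refine eq_one_of_eq_mul_rpow (H := fun t => G (f (update u i t)) * F (update u i t) ^ b j)
      ?_ ?_ ?_
    · have := (hHc u huT).tendsto
      rw [hTo.nhdsWithin_eq huT] at this
      rw [ContinuousWithinAt, hu0]
      exact this.comp hup
    · simp only [hu0]
      exact mul_pos (hG.pos _ (hTG huT)) (Real.rpow_pos_of_pos (hF.pos u (hTF huT)) _)
    · have hmem : ∀ᶠ t in 𝓝[>] (0 : ℝ), update u i t ∈ T :=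
        (hup.mono_left (nhdsWithin_mono _ Ioi_subset_Ici_self)).eventually
          (hTo.mem_nhdsWithin huT)
      filter_upwards [hmem] with t ht
      simpa using heq _ ht
  refine ⟨fun i hi i' hi' => (main i' (ne_of_gt hi')).1 i (ne_of_gt hi), fun i => ?_⟩
  by_cases h : a i = 0
  · rw [h]; exact C.zero_mem_strongE
  · exact (main i h).2

end LocalClass

end ACorners

namespace ACorners

open Filter Function

/-! ### The classes of a-smooth and of smooth maps -/

lemma isAMapWith_iff {Q : ∀ m : ℕ, (Fin m → ℝ) → Prop} {k l m n : ℕ} {U : Set (Fin m → ℝ)}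
    {f : (Fin m → ℝ) → (Fin n → ℝ)} : IsAMapWith Q k l U f ↔
      IsMapWith ASmoothFunOn (Subsemiring.nonneg ℝ) Q k l U f := by
  have h : ∀ {W : Set (Fin m → ℝ)} {u g F a}, IsAFactorization k W u g F a ↔
      IsFactorization ASmoothFunOn (Subsemiring.nonneg ℝ) k W u g F a := by
    intro W u g F a
    exact ⟨fun h => ⟨h.smooth, h.pos, h.nonneg, h.support, h.eq⟩,
      fun h => ⟨h.smooth, h.pos, h.mem, h.support, h.eq⟩⟩
  simp only [IsAMapWith, IsMapWith, h]

/-- The class of a-smooth maps. -/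
noncomputable def aClass : LocalClass where
  S := ASmoothFunOn
  E := Subsemiring.nonneg ℝ
  strongE := ⊤
  nonneg _ h := h
  zero_mem_strongE := trivial
  mem_strongE _ _ _ _ _ := trivial
  continuousOn h := h.1
  congr hU hF h := hF.congr hU h
  inter_open hU hF _ hW := hF.inter_open hU hW
  of_local hU h := ASmoothFunOn.of_local hU h
  one hU := ASmoothFunOn.const hU 1
  mul hU hF hG := hF.mul hU hG
  rpow hU hF hpos b _ := hF.rpow hU hpos b
  comp hU hV _ hf hm _ hg := hg.comp hU hV (isAMapWith_iff.2 hf) hm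

lemma aSmooth_iff {k l m n : ℕ} {U : Set (Fin m → ℝ)} {f : (Fin m → ℝ) → (Fin n → ℝ)} :
    ASmooth k l U f ↔ aClass.Weak k l U f := isAMapWith_iff

lemma stronglyASmooth_iff {k l m n : ℕ} {U : Set (Fin m → ℝ)} {f : (Fin m → ℝ) → (Fin n → ℝ)} :
    StronglyASmooth k l U f ↔ aClass.Strong k l U f := by
  have h : aClass.StrongExp = fun (m : ℕ) (a : Fin m → ℝ) => {i | 0 < a i}.Subsingleton := by
    funext m a
    exact propext ⟨fun h => h.1, fun h => ⟨h, fun _ => trivial⟩⟩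
  rw [LocalClass.Strong, h]
  exact isAMapWith_iff

/-- Weakly smooth functions. -/
def WeaklySmoothOn (_ : ℕ) {m : ℕ} (U : Set (Fin m → ℝ)) (f : (Fin m → ℝ) → ℝ) : Prop :=
  ContDiffOn ℝ ∞ f U

lemma contDiffOn_prod_pow {m : ℕ} (a : Fin m → ℕ) (U : Set (Fin m → ℝ)) :
    ContDiffOn ℝ ∞ (fun x : Fin m → ℝ => ∏ i, x i ^ a i) U :=
  ContDiff.contDiffOn (contDiff_prod fun i _ => (contDiff_apply ℝ ℝ i).pow (a i))

lemma exists_natCast_eq {m : ℕ} {a : Fin m → ℝ} (ha : ∀ i, a i ∈ (Nat.castRingHom ℝ).rangeS) :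
    ∃ b : Fin m → ℕ, a = fun i => (b i : ℝ) := by
  choose b hb using ha
  exact ⟨b, funext fun i => (hb i).symm⟩

lemma isCFactorization_iff {k m : ℕ} {W : Set (Fin m → ℝ)} {u g F} {b : Fin m → ℕ} :
    IsCFactorization k W u g F b ↔ IsFactorization WeaklySmoothOn (Nat.castRingHom ℝ).rangeS k W u
      g F (fun i => (b i : ℝ)) := by
  constructor
  · intro h
    exact ⟨h.smooth, h.pos, fun i => ⟨b i, rfl⟩, fun i hi => h.support i (mod_cast hi),
      fun x hx => by simpa only [Real.rpow_natCast] using h.eq x hx⟩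
  · intro h
    exact ⟨h.smooth, h.pos, fun i hi => h.support i (mod_cast hi),
      fun x hx => by simpa only [Real.rpow_natCast] using h.eq x hx⟩

/-- Monomials with natural exponents are smooth, so the factorized components are weakly smooth
automatically. This fails for real exponents, hence the difference between the two definitions of
maps. -/
lemma contDiffOn_of_isMapWith {Q : ∀ m : ℕ, (Fin m → ℝ) → Prop} {k l m n : ℕ}
    {U : Set (Fin m → ℝ)} {f : (Fin m → ℝ) → (Fin n → ℝ)}
    (hf : IsMapWith WeaklySmoothOn (Nat.castRingHom ℝ).rangeS Q k l U f) :
    ContDiffOn ℝ ∞ f U := by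
  refine contDiffOn_pi.2 fun j => ?_
  rcases lt_or_ge (j : ℕ) l with hj | hj
  · refine contDiffOn_of_locally_contDiffOn fun u hu => ?_
    obtain ⟨W, hW, huW, h⟩ := hf.2.2 u hu
    refine ⟨W, hW, huW, ?_⟩
    rw [inter_comm]
    rcases h j hj with ⟨F, a, hF, -⟩ | h0
    · obtain ⟨b, rfl⟩ := exists_natCast_eq hF.mem
      have hF' := isCFactorization_iff.2 hF
      exact (hF'.smooth.mul (contDiffOn_prod_pow b _)).congr hF'.eq
    · exact contDiffOn_const.congr h0
  · exact hf.2.1 j hj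

lemma isCMapWith_iff {Q : ∀ m : ℕ, (Fin m → ℕ) → Prop} {Q' : ∀ m : ℕ, (Fin m → ℝ) → Prop}
    (hQ : ∀ (m : ℕ) (b : Fin m → ℕ), Q m b ↔ Q' m (fun i => (b i : ℝ))) {k l m n : ℕ}
    {U : Set (Fin m → ℝ)} {f : (Fin m → ℝ) → (Fin n → ℝ)} : IsCMapWith Q k l U f ↔
      IsMapWith WeaklySmoothOn (Nat.castRingHom ℝ).rangeS Q' k l U f := by
  constructor
  · intro h
    refine ⟨h.1.continuousOn, fun j _ => contDiffOn_pi.1 h.1 j, fun u hu => ?_⟩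
    obtain ⟨W, hW, huW, h⟩ := h.2 u hu
    refine ⟨W, hW, huW, fun j hj => (h j hj).imp_left ?_⟩
    rintro ⟨F, b, hF, hb⟩
    exact ⟨F, _, isCFactorization_iff.1 hF, (hQ m b).1 hb⟩
  · intro h
    refine ⟨contDiffOn_of_isMapWith h, fun u hu => ?_⟩
    obtain ⟨W, hW, huW, h⟩ := h.2.2 u hu
    refine ⟨W, hW, huW, fun j hj => (h j hj).imp_left ?_⟩
    rintro ⟨F, a, hF, ha⟩
    obtain ⟨b, rfl⟩ := exists_natCast_eq hF.mem
    exact ⟨F, b, isCFactorization_iff.2 hF, (hQ m b).2 ha⟩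

/-- The class of smooth maps. -/
noncomputable def cClass : LocalClass where
  S := WeaklySmoothOn
  E := (Nat.castRingHom ℝ).rangeS
  strongE :=
    { carrier := {0, 1}
      mul_mem' := by rintro a b (rfl | rfl) (rfl | rfl) <;> simp
      one_mem' := by simp }
  nonneg := by rintro _ ⟨n, rfl⟩; exact Nat.cast_nonneg n
  zero_mem_strongE := Or.inl rfl
  mem_strongE := by
    -- Natural numbers with product 1 are equal to 1.
    rintro _ ⟨a, rfl⟩ _ ⟨b, rfl⟩ h
    have h' : a * b = 1 := by
      have : ((a : ℝ) * (b : ℝ)) = 1 := h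
      exact_mod_cast this
    right
    simp [Nat.eq_one_of_mul_eq_one_right h']
  continuousOn h := ContDiffOn.continuousOn h
  congr _ hF h := ContDiffOn.congr hF fun _ hx => (h hx).symm
  inter_open _ hF _ _ := ContDiffOn.mono hF inter_subset_right
  of_local _ h := contDiffOn_of_locally_contDiffOn fun u hu => by
    obtain ⟨W, hW, huW, hF⟩ := h u hu
    exact ⟨W, hW, huW, by rwa [inter_comm]⟩
  one _ := contDiffOn_const
  mul _ hF hG := ContDiffOn.mul hF hG
  rpow _ hF hpos b _ := ContDiffOn.rpow_const_of_ne hF fun x hx => (hpos x hx).ne'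
  comp _ _ _ hf hm _ hg := ContDiffOn.comp hg (contDiffOn_of_isMapWith hf) hm

lemma cSmooth_iff {k l m n : ℕ} {U : Set (Fin m → ℝ)} {f : (Fin m → ℝ) → (Fin n → ℝ)} :
    CSmooth k l U f ↔ cClass.Weak k l U f :=
  isCMapWith_iff (Q := fun _ _ => True) (Q' := fun _ _ => True) fun _ _ => Iff.rfl

lemma stronglyCSmooth_iff {k l m n : ℕ} {U : Set (Fin m → ℝ)} {f : (Fin m → ℝ) → (Fin n → ℝ)} :
    StronglyCSmooth k l U f ↔ cClass.Strong k l U f := by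
  refine isCMapWith_iff fun m b => ?_
  have h1 : ∀ i, (b i : ℝ) ∈ cClass.strongE ↔ b i = 1 ∨ b i = 0 := fun i => by
    change ((b i : ℝ) = 0 ∨ (b i : ℝ) = 1) ↔ _
    rw [or_comm]; norm_cast
  have h2 : (∀ i, b i = 1 ∨ b i = 0) → {i | 0 < (b i : ℝ)} = {i | b i = 1} := fun h => by
    ext i
    rcases h i with h | h <;> simp [h]
  simp only [LocalClass.StrongExp, h1]
  exact and_congr_left fun h => by rw [h2 h]

/-- The identity map is a-smooth. -/
lemma aSmooth_id {k m : ℕ} {U : Set (Fin m → ℝ)} (hU : IsOpenIn k U) : ASmooth k k U id := by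
  classical
  refine ⟨continuousOn_id, fun j _ => ASmoothFunOn.coord hU j, fun u hu => ?_⟩
  have hW : IsOpen {x : Fin m → ℝ | ∀ j : Fin m, (j : ℕ) < k → u j ≠ 0 → 0 < x j} := by
    simp only [ofPred_forall]
    exact isOpen_iInter_of_finite fun j => isOpen_iInter_of_finite fun _ =>
      isOpen_iInter_of_finite fun _ => isOpen_lt continuous_const (continuous_apply j)
  refine ⟨_, hW, fun j hj h0 =>
    lt_of_le_of_ne (hU.subset_orthant hu j hj) (Ne.symm h0), fun j hj => Or.inl ?_⟩
  · have hU' := hU.inter_open hW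
    by_cases h0 : u j = 0
    · refine ⟨fun _ => 1, Pi.single j 1, ⟨ASmoothFunOn.const hU' 1, fun _ _ => one_pos,
        fun i => ?_, fun i hi => ?_, fun x _ => ?_⟩, trivial⟩
      · by_cases h : i = j
        · subst h; simp
        · simp [h]
      · by_cases h : i = j
        · subst h; exact ⟨hj, h0⟩
        · simp [h] at hi
      · rw [Finset.prod_eq_single j]
        · simp
        · intro i _ hij; simp [hij]
        · simp
    · exact ⟨fun x => x j, fun _ => 0, ⟨ASmoothFunOn.coord hU' j, fun x hx => hx.1 j hj h0,
        fun _ => le_rfl, fun _ h => absurd rfl h, fun x _ => by simp⟩, trivial⟩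

/-! ### Strongly a-smooth maps become strongly smooth -/

/-- Components with j ≥ l are a-smooth functions composed with Φ. The others have the form F or F
x_i^a with F > 0, and then φ⁻¹ is applied to F(Φ(x)) or to F(Φ(x)) φ(x_i)^a. -/
theorem StronglyASmooth.glue {k l m n : ℕ} {U : Set (Fin m → ℝ)} (hU : IsOpenIn k U)
    {f : (Fin m → ℝ) → (Fin n → ℝ)} (hf : StronglyASmooth k l U f) :
    StronglyCSmooth k l (glueSet k U) (fun x => glueInv l (f (glueMap k x))) := by
  classical
  have hUg := hU.glueSet
  have loc : ∀ u ∈ glueSet k U, ∃ W : Set (Fin m → ℝ), IsOpen W ∧ u ∈ W ∧ ∀ j : Fin n,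
      (j : ℕ) < l → (∃ F a, IsCFactorization k (W ∩ glueSet k U) u
        (fun x => glueInv l (f (glueMap k x)) j) F a ∧
          {i | a i = 1}.Subsingleton ∧ ∀ i, a i = 1 ∨ a i = 0) ∨
        (∀ x ∈ W ∩ glueSet k U, glueInv l (f (glueMap k x)) j = 0) := by
    intro u hu
    obtain ⟨W, hW, huW, hfac⟩ := hf.2.2 (glueMap k u) hu.2
    obtain ⟨O, hO, hOW⟩ := exists_open_preimage
      ((glueMap_continuousOn k m).mono (inter_subset_left (t := glueMap k ⁻¹' U))) hW
    refine ⟨O, hO, (hOW u hu).2 huW, fun j hj => ?_⟩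
    have hmem : ∀ x ∈ O ∩ glueSet k U, glueMap k x ∈ W ∩ U := fun x hx =>
      ⟨(hOW x hx.2).1 hx.1, hx.2.2⟩
    have hsub : O ∩ glueSet k U ⊆ glueSet k (W ∩ U) := fun x hx => ⟨hx.2.1, hmem x hx⟩
    simp only [glueInv, hj, if_true]
    rcases hfac j hj with ⟨F, a, hF, ha⟩ | h
    swap
    · exact Or.inr fun x hx => by rw [h _ (hmem x hx), profileInv_zero]
    left
    have hFs : ContDiffOn ℝ ∞ (fun x => F (glueMap k x)) (O ∩ glueSet k U) :=
      (hF.smooth.contDiffOn_glue (hU.inter_open hW)).mono hsub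
    have hFp : ∀ x ∈ O ∩ glueSet k U, 0 < F (glueMap k x) := fun x hx => hF.pos _ (hmem x hx)
    -- Without exponents the component is positive, where φ⁻¹ is smooth.
    by_cases hz : ∀ i, a i = 0
    · refine ⟨fun x => profileInv (F (glueMap k x)), fun _ => 0,
        ⟨contDiffOn_profileInv.comp hFs hFp, fun x hx => profileInv_pos (hFp x hx).ne',
          fun _ h => absurd rfl h, fun x hx => ?_⟩, fun i hi => absurd hi (by simp), by simp⟩
      rw [hF.eq _ (hmem x hx)]
      simp [hz]
    · push Not at hz
      obtain ⟨i, hi⟩ := hz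
      have hi0 : 0 < a i := lt_of_le_of_ne (hF.nonneg i) (Ne.symm hi)
      obtain ⟨hik, hui⟩ := hF.support i hi
      have hui0 : u i = 0 := by
        by_contra h
        have h1 := profile_pos (lt_of_le_of_ne (hu.1 i hik) (Ne.symm h))
        simp only [glueMap, hik, if_true] at hui
        exact h1.ne' hui
      -- This is Ψ(s, t) = H(s, t) t with s = F(Φ(x)) and t = x_i, so the new exponent of x_i is 1.
      refine ⟨fun x => psiFactor (a i) (F (glueMap k x)) (x i), Pi.single i 1, ⟨?_,
        fun x _ => psiFactor_pos hi0 _ _, fun i' hi' => ?_, fun x hx => ?_⟩, ?_, fun i' => ?_⟩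
      · exact (contDiffOn_psiFactor hi0).comp
          (hFs.prodMk (contDiff_apply ℝ ℝ i).contDiffOn) hFp
      · by_cases h : i' = i
        · subst h; exact ⟨hik, hui0⟩
        · simp [h] at hi'
      · rw [hF.eq _ (hmem x hx), Finset.prod_eq_single i, Finset.prod_eq_single i]
        · have h1 : glueMap k x i = profile (x i) := by simp [glueMap, hik]
          rw [h1, profileInv_mul_profile_rpow hi0 (hFp x hx) (hx.2.1 i hik)]
          simp
        · intro i' _ h; simp [h]
        · simp
        · intro i' _ h
          have : a i' = 0 := by
            by_contra h'
            exact h (ha (lt_of_le_of_ne (hF.nonneg i') (Ne.symm h')) hi0)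
          simp [this]
        · simp
      · have hone : ∀ r, (Pi.single i 1 : Fin m → ℕ) r = 1 → r = i := fun r hr => by
          by_contra h; simp [h] at hr
        intro r hr r' hr'
        rw [hone r hr, hone r' hr']
      · by_cases h : i' = i
        · subst h; simp
        · simp [h]
  refine ⟨contDiffOn_pi.2 fun j => ?_, loc⟩
  rcases lt_or_ge (j : ℕ) l with hj | hj
  · refine contDiffOn_of_locally_contDiffOn fun u hu => ?_
    obtain ⟨W, hW, huW, h⟩ := loc u hu
    refine ⟨W, hW, huW, ?_⟩
    rw [inter_comm]
    rcases h j hj with ⟨F, a, hF, -⟩ | h0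
    · exact (hF.smooth.mul (contDiffOn_prod_pow a _)).congr hF.eq
    · exact contDiffOn_const.congr h0
  · have h := (hf.2.1 j hj).contDiffOn_glue hU
    simpa only [glueInv, not_lt.2 hj, if_false] using h

end ACorners

namespace ACorners

open Filter Function

/-! ### Local representatives -/

section Rep

variable {X Y Z : Type u} [TopologicalSpace X] [TopologicalSpace Y] [TopologicalSpace Z]
  {c : CornerChart X} {d : CornerChart Y} {e : CornerChart Z} {f : X → Y} {g : Y → Z}

lemma CornerChart.coord_toFun (c : CornerChart X) (x : c.U) : c.coord (c.toFun x) = x :=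
  c.isOpenEmbedding.injective.extend_apply _ _ x

lemma rep_apply {x : Fin c.dim → ℝ} (hx : x ∈ c.U) :
    rep c d f x = d.coord (f (c.toFun ⟨x, hx⟩)) :=
  Subtype.val_injective.extend_apply (fun x : c.U => d.coord (f (c.toFun x))) _ ⟨x, hx⟩

lemma rep_mem {x : Fin c.dim → ℝ} (hx : x ∈ repDomain c d f) : rep c d f x ∈ d.U := by
  obtain ⟨h, y, hy⟩ := hx
  rw [rep_apply h, ← hy, d.coord_toFun]
  exact y.2

lemma toFun_rep {x : Fin c.dim → ℝ} (hx : x ∈ repDomain c d f) :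
    d.toFun ⟨rep c d f x, rep_mem hx⟩ = f (c.toFun ⟨x, hx.1⟩) := by
  obtain ⟨y, hy⟩ := hx.2
  have e : rep c d f x = y := by rw [rep_apply hx.1, ← hy, d.coord_toFun]
  exact (congrArg d.toFun (Subtype.ext e)).trans hy

/-- Open subsets of `X` give open subsets of the domain of a chart. -/
lemma CornerChart.exists_open (c : CornerChart X) {A : Set X} (hA : IsOpen A) :
    ∃ W : Set (Fin c.dim → ℝ), IsOpen W ∧ ∀ (x : Fin c.dim → ℝ) (h : x ∈ c.U),
      x ∈ W ↔ c.toFun ⟨x, h⟩ ∈ A := by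
  obtain ⟨W, hW, h⟩ := isOpen_induced_iff.1 (hA.preimage c.isOpenEmbedding.continuous)
  exact ⟨W, hW, fun x hx => Set.ext_iff.1 h ⟨x, hx⟩⟩

lemma isOpenIn_repDomain (c : CornerChart X) (d : CornerChart Y) (hf : Continuous f) :
    IsOpenIn c.k (repDomain c d f) := by
  obtain ⟨W, hW, h⟩ := c.exists_open (d.isOpenEmbedding.isOpen_range.preimage hf)
  have : repDomain c d f = W ∩ c.U := by
    ext x
    exact ⟨fun ⟨hx, hy⟩ => ⟨(h x hx).2 hy, hx⟩, fun ⟨hW, hx⟩ => ⟨hx, (h x hx).1 hW⟩⟩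
  rw [this]
  exact c.isOpenIn.inter_open hW

lemma rep_rep {x : Fin c.dim → ℝ} (hx : x ∈ repDomain c d f) :
    rep c e (g ∘ f) x = rep d e g (rep c d f x) := by
  rw [rep_apply hx.1, rep_apply (rep_mem hx), toFun_rep hx, Function.comp_apply]

lemma rep_mem_repDomain {x : Fin c.dim → ℝ} (hx : x ∈ repDomain c d f)
    (hx' : x ∈ repDomain c e (g ∘ f)) : rep c d f x ∈ repDomain d e g := by
  refine ⟨rep_mem hx, ?_⟩
  rw [toFun_rep hx]
  exact hx'.2

end Rep

namespace LocalClass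

variable {C : LocalClass} {X Y Z : Type u} [TopologicalSpace X] [TopologicalSpace Y]
  [TopologicalSpace Z]

/-- The local representative of `f` in the given charts is strong. -/
def StrongRep (C : LocalClass) (c : CornerChart X) (d : CornerChart Y) (f : X → Y) : Prop :=
  C.Strong c.k d.k (repDomain c d f) (rep c d f)

/-- The intermediate chart may depend on the point: the property is local, and near the point the
representative of g ∘ f is the composite of those of f and g. -/
theorem isMapWith_rep_comp {Q : ∀ m : ℕ, (Fin m → ℝ) → Prop}
    (hQ : ∀ (m n : ℕ) (b : Fin n → ℝ) (A : Fin n → Fin m → ℝ), (∀ j, b j ∈ C.E) →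
      (∀ j i, A j i ∈ C.E) → Q n b → (∀ j, b j ≠ 0 → Q m (A j)) →
      Q m (fun i => ∑ j, b j * A j i))
    {f : X → Y} {g : Y → Z} (hf : Continuous f) (hg : Continuous g) {c : CornerChart X}
    {e : CornerChart Z}
    (h : ∀ x ∈ range c.toFun, g (f x) ∈ range e.toFun → ∃ d : CornerChart Y, f x ∈ range d.toFun ∧
      IsMapWith C.S C.E Q c.k d.k (repDomain c d f) (rep c d f) ∧
      IsMapWith C.S C.E Q d.k e.k (repDomain d e g) (rep d e g)) :
    IsMapWith C.S C.E Q c.k e.k (repDomain c e (g ∘ f)) (rep c e (g ∘ f)) := by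
  have ho := isOpenIn_repDomain c e (hg.comp hf)
  refine isMapWith_of_local ho fun u hu => ?_
  obtain ⟨d, hd, h1, h2⟩ := h _ ⟨_, rfl⟩ hu.2
  obtain ⟨W, hW, hWd⟩ := c.exists_open ((d.isOpenEmbedding.isOpen_range.preimage hf).inter
    (e.isOpenEmbedding.isOpen_range.preimage (hg.comp hf)))
  have hT : W ∩ repDomain c e (g ∘ f) = W ∩ repDomain c d f := by
    ext x
    exact ⟨fun ⟨hxW, hx⟩ => ⟨hxW, hx.1, ((hWd x hx.1).1 hxW).1⟩,
      fun ⟨hxW, hx⟩ => ⟨hxW, hx.1, ((hWd x hx.1).1 hxW).2⟩⟩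
  refine ⟨W, hW, (hWd u hu.1).2 ⟨hd, hu.2⟩, ?_⟩
  have hfo := isOpenIn_repDomain c d hf
  have h3 := isMapWith_inter_open hfo h1 hW
  have hm : MapsTo (rep c d f) (W ∩ repDomain c d f) (repDomain d e g) := fun x hx => by
    have hx' := hx
    rw [← hT] at hx'
    exact rep_mem_repDomain hx.2 hx'.2
  have h4 := isMapWith_comp (hfo.inter_open hW) (isOpenIn_repDomain d e hg) hQ h3 hm h2
  rw [hT]
  exact isMapWith_congr (hfo.inter_open hW) h4 fun x hx => (rep_rep hx.2).symm

theorem strongRep_comp {f : X → Y} {g : Y → Z} (hf : Continuous f) (hg : Continuous g)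
    {c : CornerChart X} {e : CornerChart Z}
    (h : ∀ x ∈ range c.toFun, g (f x) ∈ range e.toFun → ∃ d : CornerChart Y,
      f x ∈ range d.toFun ∧ C.StrongRep c d f ∧ C.StrongRep d e g) :
    C.StrongRep c e (g ∘ f) :=
  isMapWith_rep_comp strongExp_comp hf hg h

/-! ### Compatible charts and atlases -/

/-- Compatibility of charts. -/
def Compatible (C : LocalClass) (c d : CornerChart X) : Prop :=
  C.Weak c.k d.k (repDomain c d id) (rep c d id) ∧ C.Weak d.k c.k (repDomain d c id) (rep d c id)

lemma Compatible.symm {c d : CornerChart X} (h : C.Compatible c d) : C.Compatible d c :=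
  ⟨h.2, h.1⟩

lemma mapsTo_transition (c d : CornerChart X) :
    MapsTo (rep c d id) (repDomain c d id) (repDomain d c id) := fun x hx => by
  refine ⟨rep_mem hx, ?_⟩
  rw [toFun_rep hx]
  exact ⟨⟨x, hx.1⟩, rfl⟩

lemma leftInvOn_transition (c d : CornerChart X) :
    LeftInvOn (rep d c id) (rep c d id) (repDomain c d id) := fun x hx => by
  rw [← rep_rep (f := id) (g := id) hx, rep_apply hx.1]
  exact c.coord_toFun ⟨x, hx.1⟩

/-- Transition maps are invertible, so compatibility, which is defined by maps of the class without
the strong condition, yields strong transition maps. -/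
lemma Compatible.strongRep {c d : CornerChart X} (h : C.Compatible c d) :
    C.StrongRep c d id :=
  strong_of_inverse (isOpenIn_repDomain c d continuous_id) (isOpenIn_repDomain d c continuous_id)
    (mapsTo_transition c d) (mapsTo_transition d c)
    ⟨leftInvOn_transition c d, leftInvOn_transition d c⟩ h.1 h.2

lemma compatible_of_strongRep {c d : CornerChart X} (h : C.StrongRep c d id)
    (h' : C.StrongRep d c id) : C.Compatible c d := ⟨Strong.weak h, Strong.weak h'⟩

/-- An inverse of the transition map must agree with the reverse transition map, so the existential
quantifier can be dropped. -/
lemma isDiffeo_iff_compatible {c d : CornerChart X} :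
    (∃ g : (Fin d.dim → ℝ) → (Fin c.dim → ℝ), MapsTo (rep c d id) (repDomain c d id)
      (repDomain d c id) ∧ MapsTo g (repDomain d c id) (repDomain c d id) ∧
      InvOn g (rep c d id) (repDomain c d id) (repDomain d c id) ∧
      C.Weak c.k d.k (repDomain c d id) (rep c d id) ∧ C.Weak d.k c.k (repDomain d c id) g) ↔
    C.Compatible c d := by
  constructor
  · rintro ⟨g, _, hg, hinv, h1, h2⟩
    refine ⟨h1, isMapWith_congr (isOpenIn_repDomain d c continuous_id) h2 fun y hy => ?_⟩
    calc g y = rep d c id (rep c d id (g y)) := (leftInvOn_transition c d (hg hy)).symm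
      _ = rep d c id y := by rw [hinv.2 hy]
  · intro h
    exact ⟨_, mapsTo_transition c d, mapsTo_transition d c,
      ⟨leftInvOn_transition c d, leftInvOn_transition d c⟩, h.1, h.2⟩

/-- Atlases with respect to a class of maps. -/
structure IsAtlas (C : LocalClass) (D : Set ℕ) (A : Set (CornerChart X)) : Prop where
  dim_mem : ∀ c ∈ A, c.dim ∈ D
  compatible : ∀ c ∈ A, ∀ d ∈ A, C.Compatible c d
  cover : ∀ x : X, ∃ c ∈ A, x ∈ range c.toFun

/-- All charts compatible with the given charts. -/
def completion (C : LocalClass) (D : Set ℕ) (A : Set (CornerChart X)) : Set (CornerChart X) :=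
  {d | d.dim ∈ D ∧ ∀ c ∈ A, C.Compatible c d}

/-- A continuous map that is strong with respect to two atlases is strong with respect to all
compatible charts. -/
theorem strongRep_of_compatible {D D' : Set ℕ} {A : Set (CornerChart X)} {B : Set (CornerChart Y)}
    (hA : C.IsAtlas D A) (hB : C.IsAtlas D' B) {f : X → Y} (hf : Continuous f)
    (h : ∀ c ∈ A, ∀ d ∈ B, C.StrongRep c d f) {c : CornerChart X} {d : CornerChart Y}
    (hc : ∀ c' ∈ A, C.Compatible c' c) (hd : ∀ d' ∈ B, C.Compatible d' d) :
    C.StrongRep c d f := by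
  have h1 : ∀ c' ∈ A, C.StrongRep c' d f := fun c' hc' =>
    strongRep_comp (g := id) hf continuous_id fun x _ _ => by
      obtain ⟨d', hd', hx⟩ := hB.cover (f x)
      exact ⟨d', hx, h c' hc' d' hd', (hd d' hd').strongRep⟩
  refine strongRep_comp (f := id) continuous_id hf fun x _ _ => ?_
  obtain ⟨c', hc', hx⟩ := hA.cover x
  exact ⟨c', hx, (hc c' hc').symm.strongRep, h1 c' hc'⟩

/-- Invariance of strong maps under change of compatible charts, applied to the identity map in both
directions. -/
lemma IsAtlas.compatible_of_compatible {D : Set ℕ} {A : Set (CornerChart X)} (hA : C.IsAtlas D A)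
    {c d : CornerChart X} (hc : ∀ c' ∈ A, C.Compatible c' c) (hd : ∀ c' ∈ A, C.Compatible c' d) :
    C.Compatible c d :=
  compatible_of_strongRep
    (strongRep_of_compatible hA hA continuous_id
      (fun _ h _ h' => (hA.compatible _ h _ h').strongRep) hc hd)
    (strongRep_of_compatible hA hA continuous_id
      (fun _ h _ h' => (hA.compatible _ h _ h').strongRep) hd hc)

lemma IsAtlas.subset_completion {D D' : Set ℕ} {A : Set (CornerChart X)} (hA : C.IsAtlas D A)
    (hD : D ⊆ D') : A ⊆ C.completion D' A :=
  fun d hd => ⟨hD (hA.dim_mem d hd), fun c hc => hA.compatible c hc d hd⟩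

theorem IsAtlas.maximal_completion {D D' : Set ℕ} {A : Set (CornerChart X)} (hA : C.IsAtlas D A)
    (hD : D ⊆ D') : Maximal (C.IsAtlas D') (C.completion D' A) := by
  refine ⟨⟨fun c hc => hc.1, fun c hc d hd => hA.compatible_of_compatible hc.2 hd.2, fun x => ?_⟩,
    fun B hB hsub d hd => ⟨hB.dim_mem d hd, fun c hc =>
      hB.compatible c (hsub (hA.subset_completion hD hc)) d hd⟩⟩
  obtain ⟨c, hc, hx⟩ := hA.cover x
  exact ⟨c, hA.subset_completion hD hc, hx⟩

theorem IsAtlas.eq_completion {D D' : Set ℕ} {A B : Set (CornerChart X)} (hA : C.IsAtlas D A)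
    (hD : D ⊆ D') (hB : Maximal (C.IsAtlas D') B) (hAB : A ⊆ B) : B = C.completion D' A :=
  hB.eq_of_subset (hA.maximal_completion hD).1 fun d hd =>
    ⟨hB.1.dim_mem d hd, fun c hc => hB.1.compatible c (hAB hc) d hd⟩

/-- The completion of `B` is a maximal atlas containing `A`, and there is only one of these. -/
theorem IsAtlas.completion_eq {D D' : Set ℕ} {A B : Set (CornerChart X)} (hA : C.IsAtlas D A)
    (hB : C.IsAtlas D' B) (hAB : A ⊆ B) {D'' : Set ℕ} (hD : D ⊆ D'') (hD' : D' ⊆ D'') :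
    C.completion D'' B = C.completion D'' A :=
  hA.eq_completion hD (hB.maximal_completion hD') (hAB.trans (hB.subset_completion hD'))

/-! ### Interior maps in charts -/

/-- The local representative of `f` maps interior points to interior points. -/
def InteriorRep (c : CornerChart X) (d : CornerChart Y) (f : X → Y) : Prop :=
  ∀ x ∈ repDomain c d f, (∀ i : Fin c.dim, (i : ℕ) < c.k → 0 < x i) →
    ∀ j : Fin d.dim, (j : ℕ) < d.k → 0 < rep c d f x j

lemma nowhereLocallyZero_iff_interiorRep {c : CornerChart X} {d : CornerChart Y} {f : X → Y}
    (hf : Continuous f) (h : C.Weak c.k d.k (repDomain c d f) (rep c d f)) :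
    NowhereLocallyZero d.k (repDomain c d f) (rep c d f) ↔ InteriorRep c d f :=
  nowhereLocallyZero_iff (isOpenIn_repDomain c d hf) h

lemma Compatible.interiorRep {c d : CornerChart X} (h : C.Compatible c d) :
    InteriorRep c d id :=
  (nowhereLocallyZero_iff_interiorRep continuous_id h.1).1 (nowhereLocallyZero_of_inverse
    (isOpenIn_repDomain d c continuous_id) (mapsTo_transition c d) (mapsTo_transition d c)
    ⟨leftInvOn_transition c d, leftInvOn_transition d c⟩ h.2.1)

lemma interiorRep_comp {f : X → Y} {g : Y → Z} {c : CornerChart X} {e : CornerChart Z}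
    (h : ∀ x ∈ range c.toFun, g (f x) ∈ range e.toFun → ∃ d : CornerChart Y,
      f x ∈ range d.toFun ∧ InteriorRep c d f ∧ InteriorRep d e g) :
    InteriorRep c e (g ∘ f) := by
  intro x hx hpos
  obtain ⟨d, hd, h1, h2⟩ := h _ ⟨_, rfl⟩ hx.2
  have hxd : x ∈ repDomain c d f := ⟨hx.1, hd⟩
  rw [rep_rep hxd]
  exact h2 _ (rep_mem_repDomain hxd hx) (h1 x hxd hpos)

theorem interiorRep_of_compatible {D D' : Set ℕ} {A : Set (CornerChart X)}
    {B : Set (CornerChart Y)} (hA : C.IsAtlas D A) (hB : C.IsAtlas D' B) {f : X → Y}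
    (h : ∀ c ∈ A, ∀ d ∈ B, InteriorRep c d f) {c : CornerChart X} {d : CornerChart Y}
    (hc : ∀ c' ∈ A, C.Compatible c' c) (hd : ∀ d' ∈ B, C.Compatible d' d) :
    InteriorRep c d f := by
  have h1 : ∀ c' ∈ A, InteriorRep c' d f := fun c' hc' =>
    interiorRep_comp (f := f) (g := id) fun x _ _ => by
      obtain ⟨d', hd', hx⟩ := hB.cover (f x)
      exact ⟨d', hx, h c' hc' d' hd', (hd d' hd').interiorRep⟩
  refine interiorRep_comp (f := id) (g := f) fun x _ _ => ?_
  obtain ⟨c', hc', hx⟩ := hA.cover x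
  exact ⟨c', hx, (hc c' hc').symm.interiorRep, h1 c' hc'⟩

end LocalClass

/-! ### The two kinds of atlases -/

section Atlases

variable {X : Type u} [TopologicalSpace X]

lemma aCompatible_iff {c d : CornerChart X} : ACompatible c d ↔ aClass.Compatible c d := by
  rw [← LocalClass.isDiffeo_iff_compatible]
  simp only [ACompatible, IsADiffeo, aSmooth_iff]

lemma cCompatible_iff {c d : CornerChart X} : CCompatible c d ↔ cClass.Compatible c d := by
  rw [← LocalClass.isDiffeo_iff_compatible]
  simp only [CCompatible, IsCDiffeo, cSmooth_iff]

lemma isAAtlas_eq (D : Set ℕ) : IsAAtlas (X := X) D = aClass.IsAtlas D := by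
  funext A
  exact propext ⟨fun h => ⟨h.1, fun c hc d hd => aCompatible_iff.1 (h.2 c hc d hd), h.3⟩,
    fun h => ⟨h.1, fun c hc d hd => aCompatible_iff.2 (h.2 c hc d hd), h.3⟩⟩

lemma isCAtlas_eq (D : Set ℕ) : IsCAtlas (X := X) D = cClass.IsAtlas D := by
  funext A
  exact propext ⟨fun h => ⟨h.1, fun c hc d hd => cCompatible_iff.1 (h.2 c hc d hd), h.3⟩,
    fun h => ⟨h.1, fun c hc d hd => cCompatible_iff.2 (h.2 c hc d hd), h.3⟩⟩

lemma aCompletion_eq (D : Set ℕ) (A : Set (CornerChart X)) :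
    aCompletion D A = aClass.completion D A := by
  simp only [aCompletion, LocalClass.completion, aCompatible_iff]

lemma cCompletion_eq (D : Set ℕ) (A : Set (CornerChart X)) :
    cCompletion D A = cClass.completion D A := by
  simp only [cCompletion, LocalClass.completion, cCompatible_iff]

end Atlases

end ACorners

namespace ACorners

open Filter Function

/-! ### Reparametrised charts -/

section GluedCharts

variable {X Y : Type u} [TopologicalSpace X] [TopologicalSpace Y]

lemma CornerChart.range_glue (c : CornerChart X) : range c.glue.toFun = range c.toFun :=
  (glueHomeo c.isOpenIn).surjective.range_comp c.toFun

lemma CornerChart.coord_glue (c : CornerChart X) {y : X} (hy : y ∈ range c.toFun) :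
    c.glue.coord y = glueInv c.k (c.coord y) := by
  obtain ⟨z, rfl⟩ := hy
  have h : c.glue.toFun ((glueHomeo c.isOpenIn).symm z) = c.toFun z :=
    congrArg c.toFun ((glueHomeo c.isOpenIn).apply_symm_apply z)
  have h1 := c.glue.coord_toFun ((glueHomeo c.isOpenIn).symm z)
  rw [h] at h1
  rw [h1, c.coord_toFun]
  rfl

lemma repDomain_glue (c : CornerChart X) (d : CornerChart Y) (f : X → Y) :
    repDomain c.glue d.glue f = glueSet c.k (repDomain c d f) := by
  ext x
  constructor
  · rintro ⟨h, hx⟩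
    rw [d.range_glue] at hx
    exact ⟨h.1, h.2, hx⟩
  · rintro ⟨h1, h2, hx⟩
    refine ⟨⟨h1, h2⟩, ?_⟩
    rw [d.range_glue]
    exact hx

lemma rep_glue {c : CornerChart X} {d : CornerChart Y} {f : X → Y} {x : Fin c.dim → ℝ}
    (hx : x ∈ glueSet c.k (repDomain c d f)) :
    rep c.glue d.glue f x = glueInv d.k (rep c d f (glueMap c.k x)) := by
  have h : x ∈ c.glue.U := ⟨hx.1, hx.2.1⟩
  rw [rep_apply hx.2.1, ← d.coord_glue hx.2.2]
  exact rep_apply h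

/-- Strongly a-smooth maps are strongly smooth in the reparametrised charts. -/
theorem strongRep_glue {c : CornerChart X} {d : CornerChart Y} {f : X → Y} (hf : Continuous f)
    (h : aClass.StrongRep c d f) : cClass.StrongRep c.glue d.glue f := by
  have ho := isOpenIn_repDomain c d hf
  have h1 := stronglyCSmooth_iff.1 ((stronglyASmooth_iff.2 h).glue ho)
  have h2 := LocalClass.isMapWith_congr ho.glueSet h1 fun x hx => (rep_glue hx).symm
  rw [← repDomain_glue] at h2
  exact h2

lemma interiorRep_glue {c : CornerChart X} {d : CornerChart Y} {f : X → Y}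
    (h : LocalClass.InteriorRep c d f) : LocalClass.InteriorRep c.glue d.glue f := by
  intro x hx hpos j hj
  have hx' : x ∈ glueSet c.k (repDomain c d f) := by rwa [← repDomain_glue]
  have hj' : (j : ℕ) < d.k := hj
  have h1 := h _ hx'.2 (fun i hi => by
    simp only [glueMap, hi, if_true]
    exact profile_pos (hpos i hi)) j hj'
  rw [rep_glue hx']
  simp only [glueInv, hj', if_true]
  exact profileInv_pos h1.ne'

end GluedCharts

/-! ### The functor -/

lemma ManAC.isAtlas {τ : DimType} (X : ManAC.{u} τ) : aClass.IsAtlas X.dims X.atlas := by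
  rw [← isAAtlas_eq]; exact X.maximal.1

lemma ManC.isAtlas {τ : DimType} (X : ManC.{u} τ) : cClass.IsAtlas X.dims X.atlas := by
  rw [← isCAtlas_eq]; exact X.maximal.1

lemma ManAC.stronglySmooth_iff {τ : DimType} {X Y : ManAC.{u} τ} (f : X ⟶ Y) :
    ManAC.stronglySmooth τ f ↔
      ∀ c ∈ X.atlas, ∀ d ∈ Y.atlas, aClass.StrongRep c d (ManAC.map f) := by
  simp only [ManAC.stronglySmooth, stronglyASmooth_iff]; rfl

lemma ManC.stronglySmooth_iff {τ : DimType} {X Y : ManC.{u} τ} (f : X ⟶ Y) :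
    ManC.stronglySmooth τ f ↔
      ∀ c ∈ X.atlas, ∀ d ∈ Y.atlas, cClass.StrongRep c d (ManC.map f) := by
  simp only [ManC.stronglySmooth, stronglyCSmooth_iff]; rfl

theorem ManAC.isMultiplicative_stronglySmooth (τ : DimType) :
    (ManAC.stronglySmooth.{u} τ).IsMultiplicative where
  id_mem X := (ManAC.stronglySmooth_iff (𝟙 X)).2 fun c hc d hd =>
    (X.isAtlas.compatible c hc d hd).strongRep
  comp_mem {X Y Z} f g hf hg := by
    rw [ManAC.stronglySmooth_iff] at hf hg ⊢
    refine fun c hc e he => LocalClass.strongRep_comp (ManAC.map f).continuous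
      (ManAC.map g).continuous fun x _ _ => ?_
    obtain ⟨d, hd, hx⟩ := Y.isAtlas.cover (ManAC.map f x)
    exact ⟨d, hx, hf c hc d hd, hg d hd e he⟩

theorem ManC.isMultiplicative_stronglySmooth (τ : DimType) :
    (ManC.stronglySmooth.{u} τ).IsMultiplicative where
  id_mem X := (ManC.stronglySmooth_iff (𝟙 X)).2 fun c hc d hd =>
    (X.isAtlas.compatible c hc d hd).strongRep
  comp_mem {X Y Z} f g hf hg := by
    rw [ManC.stronglySmooth_iff] at hf hg ⊢
    refine fun c hc e he => LocalClass.strongRep_comp (ManC.map f).continuous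
      (ManC.map g).continuous fun x _ _ => ?_
    obtain ⟨d, hd, hx⟩ := Y.isAtlas.cover (ManC.map f x)
    exact ⟨d, hx, hf c hc d hd, hg d hd e he⟩

/-- Only strong a-smooth maps are known to become smooth, so it is essential that transition maps
are strong by invertibility. -/
lemma isAtlas_glue {X : Type u} [TopologicalSpace X] {D : Set ℕ} {A : Set (CornerChart X)}
    (hA : aClass.IsAtlas D A) : cClass.IsAtlas D (CornerChart.glue '' A) := by
  refine ⟨?_, ?_, fun x => ?_⟩
  · rintro _ ⟨c, hc, rfl⟩
    exact hA.dim_mem c hc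
  · rintro _ ⟨c, hc, rfl⟩ _ ⟨d, hd, rfl⟩
    exact LocalClass.compatible_of_strongRep
      (strongRep_glue continuous_id (hA.compatible c hc d hd).strongRep)
      (strongRep_glue continuous_id (hA.compatible d hd c hc).strongRep)
  · obtain ⟨c, hc, hx⟩ := hA.cover x
    exact ⟨c.glue, ⟨c, hc, rfl⟩, by rwa [c.range_glue]⟩

namespace ManAC

variable {τ : DimType}

lemma isAtlas_gluedCharts (X : ManAC.{u} τ) : cClass.IsAtlas X.dims X.gluedCharts :=
  isAtlas_glue X.isAtlas

lemma gluedAtlas_eq (X : ManAC.{u} τ) :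
    X.gluedAtlas = cClass.completion X.dims X.gluedCharts := cCompletion_eq _ _

lemma maximal_gluedAtlas (X : ManAC.{u} τ) : Maximal (IsCAtlas X.dims) X.gluedAtlas := by
  rw [isCAtlas_eq, gluedAtlas_eq]
  exact X.isAtlas_gluedCharts.maximal_completion le_rfl

theorem gluedAtlas_spec (X : ManAC.{u} τ) : IsCAtlas X.dims X.gluedCharts ∧
    X.gluedCharts ⊆ X.gluedAtlas ∧ Maximal (IsCAtlas X.dims) X.gluedAtlas ∧
    ∀ B, Maximal (IsCAtlas X.dims) B → X.gluedCharts ⊆ B → B = X.gluedAtlas := by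
  refine ⟨?_, ?_, X.maximal_gluedAtlas, fun B hB h => ?_⟩
  · rw [isCAtlas_eq]; exact X.isAtlas_gluedCharts
  · rw [gluedAtlas_eq]; exact X.isAtlas_gluedCharts.subset_completion le_rfl
  · rw [gluedAtlas_eq]
    rw [isCAtlas_eq] at hB
    exact X.isAtlas_gluedCharts.eq_completion le_rfl hB h

lemma compatible_of_mem_gluedAtlas {X : ManAC.{u} τ} {c : CornerChart X.carrier}
    (hc : c ∈ X.gluedAtlas) : ∀ c' ∈ X.gluedCharts, cClass.Compatible c' c := by
  rw [gluedAtlas_eq] at hc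
  exact hc.2

/-- The condition is checked in the reparametrised charts, which form an atlas, and passes from
there to all compatible charts. -/
theorem stronglySmooth_glueHom {X Y : ManAC.{u} τ} (f : X ⟶ Y) (hf : ManAC.stronglySmooth τ f)
    (hX : Maximal (IsCAtlas X.dims) X.gluedAtlas) (hY : Maximal (IsCAtlas Y.dims) Y.gluedAtlas) :
    ManC.stronglySmooth τ (glueHom f hX hY) := by
  rw [ManAC.stronglySmooth_iff] at hf
  rw [ManC.stronglySmooth_iff]
  intro c hc d hd
  refine LocalClass.strongRep_of_compatible X.isAtlas_gluedCharts Y.isAtlas_gluedCharts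
    (f := ManAC.map f) (ManAC.map f).continuous ?_ (compatible_of_mem_gluedAtlas hc)
    (compatible_of_mem_gluedAtlas hd)
  rintro _ ⟨c', hc', rfl⟩ _ ⟨d', hd', rfl⟩
  exact strongRep_glue (ManAC.map f).continuous (hf c' hc' d' hd')

/-- For maps of either class, interior means that interior points go to interior points, and φ and
φ⁻¹ preserve positivity of coordinates. -/
theorem interior_glueHom {X Y : ManAC.{u} τ} (f : X ⟶ Y) (hf : ManAC.stronglySmooth τ f)
    (hi : ManAC.interior τ f) (hX : Maximal (IsCAtlas X.dims) X.gluedAtlas)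
    (hY : Maximal (IsCAtlas Y.dims) Y.gluedAtlas) :
    ManC.interior τ (glueHom f hX hY) := by
  have hs := (ManC.stronglySmooth_iff _).1 (stronglySmooth_glueHom f hf hX hY)
  intro c hc d hd
  have hw := LocalClass.Strong.weak (hs c hc d hd)
  refine ⟨cSmooth_iff.2 hw, (LocalClass.nowhereLocallyZero_iff_interiorRep
    (ManAC.map f).continuous hw).2 ?_⟩
  refine LocalClass.interiorRep_of_compatible X.isAtlas_gluedCharts Y.isAtlas_gluedCharts ?_
    (compatible_of_mem_gluedAtlas hc) (compatible_of_mem_gluedAtlas hd)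
  rintro _ ⟨c', hc', rfl⟩ _ ⟨d', hd', rfl⟩
  have h := hi c' hc' d' hd'
  exact interiorRep_glue ((LocalClass.nowhereLocallyZero_iff_interiorRep
    (ManAC.map f).continuous (aSmooth_iff.1 h.1)).1 h.2)

end ManAC

/-! ### Mixed dimension -/

lemma ManAC.maximal_toMixed (X : ManAC.{u} .pure) :
    Maximal (IsAAtlas univ) (aCompletion univ X.atlas) := by
  rw [isAAtlas_eq, aCompletion_eq]
  exact X.isAtlas.maximal_completion (subset_univ _)

lemma ManC.maximal_toMixed (X : ManC.{u} .pure) :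
    Maximal (IsCAtlas univ) (cCompletion univ X.atlas) := by
  rw [isCAtlas_eq, cCompletion_eq]
  exact X.isAtlas.maximal_completion (subset_univ _)

theorem ManAC.stronglySmooth_toMixedHom_iff {X Y : ManAC.{u} .pure} (f : X ⟶ Y)
    (hX : Maximal (IsAAtlas univ) (aCompletion univ X.atlas))
    (hY : Maximal (IsAAtlas univ) (aCompletion univ Y.atlas)) :
    ManAC.stronglySmooth .pure f ↔ ManAC.stronglySmooth .mixed (ManAC.toMixedHom f hX hY) := by
  rw [ManAC.stronglySmooth_iff, ManAC.stronglySmooth_iff]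
  constructor
  · intro h c hc d hd
    have hc' : c ∈ aClass.completion univ X.atlas := by rw [← aCompletion_eq]; exact hc
    have hd' : d ∈ aClass.completion univ Y.atlas := by rw [← aCompletion_eq]; exact hd
    exact LocalClass.strongRep_of_compatible X.isAtlas Y.isAtlas (f := ManAC.map f)
      (ManAC.map f).continuous h hc'.2 hd'.2
  · intro h c hc d hd
    refine h c ?_ d ?_
    · change c ∈ aCompletion univ X.atlas
      rw [aCompletion_eq]
      exact X.isAtlas.subset_completion (subset_univ _) hc
    · change d ∈ aCompletion univ Y.atlas
      rw [aCompletion_eq]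
      exact Y.isAtlas.subset_completion (subset_univ _) hd

theorem ManC.stronglySmooth_toMixedHom_iff {X Y : ManC.{u} .pure} (f : X ⟶ Y)
    (hX : Maximal (IsCAtlas univ) (cCompletion univ X.atlas))
    (hY : Maximal (IsCAtlas univ) (cCompletion univ Y.atlas)) :
    ManC.stronglySmooth .pure f ↔ ManC.stronglySmooth .mixed (ManC.toMixedHom f hX hY) := by
  rw [ManC.stronglySmooth_iff, ManC.stronglySmooth_iff]
  constructor
  · intro h c hc d hd
    have hc' : c ∈ cClass.completion univ X.atlas := by rw [← cCompletion_eq]; exact hc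
    have hd' : d ∈ cClass.completion univ Y.atlas := by rw [← cCompletion_eq]; exact hd
    exact LocalClass.strongRep_of_compatible X.isAtlas Y.isAtlas (f := ManC.map f)
      (ManC.map f).continuous h hc'.2 hd'.2
  · intro h c hc d hd
    refine h c ?_ d ?_
    · change c ∈ cCompletion univ X.atlas
      rw [cCompletion_eq]
      exact X.isAtlas.subset_completion (subset_univ _) hc
    · change d ∈ cCompletion univ Y.atlas
      rw [cCompletion_eq]
      exact Y.isAtlas.subset_completion (subset_univ _) hd

/-- Both sides are the mixed completion of the same atlas `X.gluedCharts`. -/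
lemma ManAC.gluedAtlas_toMixed (X : ManAC.{u} .pure)
    (h : Maximal (IsAAtlas univ) (aCompletion univ X.atlas)) :
    (X.toMixed h).gluedAtlas = cCompletion univ X.gluedAtlas := by
  have hg := X.isAtlas_gluedCharts
  have hB : cClass.IsAtlas univ (X.toMixed h).gluedCharts := (X.toMixed h).isAtlas_gluedCharts
  have hsub : X.gluedCharts ⊆ (X.toMixed h).gluedCharts := by
    refine image_mono fun c hc => ?_
    change c ∈ aCompletion univ X.atlas
    rw [aCompletion_eq]
    exact X.isAtlas.subset_completion (subset_univ _) hc
  have hG : cClass.IsAtlas X.dims X.gluedAtlas := by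
    rw [← isCAtlas_eq]; exact X.maximal_gluedAtlas.1
  have hsub' : X.gluedCharts ⊆ X.gluedAtlas := X.gluedAtlas_spec.2.1
  rw [ManAC.gluedAtlas_eq, cCompletion_eq]
  exact (hg.completion_eq hB hsub (subset_univ _) le_rfl).trans
    (hg.completion_eq hG hsub' (subset_univ _) (subset_univ _)).symm

theorem ManAC.glue_toMixed (X : ManAC.{u} .pure)
    (hA : Maximal (IsAAtlas univ) (aCompletion univ X.atlas))
    (h₁ : Maximal (IsCAtlas (X.toMixed hA).dims) (X.toMixed hA).gluedAtlas)
    (h₂ : Maximal (IsCAtlas X.dims) X.gluedAtlas)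
    (hC : Maximal (IsCAtlas univ) (cCompletion univ (X.glue h₂).atlas)) :
    (X.toMixed hA).glue h₁ = (X.glue h₂).toMixed hC := by
  have h := X.gluedAtlas_toMixed hA
  -- The two manifolds differ only in their atlases, which agree by `h`.
  change @ManC.mk .mixed X.carrier X.top X.t2 X.secondCountable univ rfl
      (X.toMixed hA).gluedAtlas h₁ =
    @ManC.mk .mixed X.carrier X.top X.t2 X.secondCountable univ rfl
      (cCompletion univ X.gluedAtlas) hC
  congr 1

/-! ### The functor is not full -/

/-- The local model as a chart on itself. -/
def modelChart (k m : ℕ) (hk : k ≤ m) : CornerChart (ULift.{u} (orthant k m)) where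
  dim := m
  k := k
  k_le := hk
  U := orthant k m
  isOpenIn := isOpenIn_orthant k m
  toFun := ULift.up
  isOpenEmbedding := Homeomorph.ulift.symm.isOpenEmbedding

lemma range_modelChart (k m : ℕ) (hk : k ≤ m) : range (modelChart.{u} k m hk).toFun = univ :=
  range_eq_univ.2 ULift.up_surjective

lemma isAtlas_modelChart (k m : ℕ) (hk : k ≤ m) :
    aClass.IsAtlas {m} {modelChart.{u} k m hk} := by
  refine ⟨?_, ?_, fun x => ⟨_, rfl, by rw [range_modelChart]; trivial⟩⟩
  · rintro _ rfl; rfl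
  · rintro _ rfl _ rfl
    have ho := isOpenIn_repDomain (modelChart.{u} k m hk) (modelChart.{u} k m hk) continuous_id
    have h := LocalClass.isMapWith_congr ho (aSmooth_iff.1 (aSmooth_id ho))
      (f' := rep (modelChart.{u} k m hk) (modelChart.{u} k m hk) id) fun x hx => by
        rw [rep_apply hx.1]
        exact ((modelChart.{u} k m hk).coord_toFun ⟨x, hx.1⟩).symm
    exact ⟨h, h⟩

/-- The dimensions allowed for a manifold with a chart of dimension `m`. -/
def DimType.dims : DimType → ℕ → Set ℕ
  | .pure, m => {m}
  | .mixed, _ => univ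

lemma DimType.allows_dims (τ : DimType) (m : ℕ) : τ.Allows (τ.dims m) := by
  cases τ
  exacts [⟨m, rfl⟩, rfl]

lemma DimType.subset_dims (τ : DimType) (m : ℕ) : {m} ⊆ τ.dims m := by
  cases τ
  exacts [le_rfl, subset_univ _]

/-- The local model as a manifold with a-corners. -/
def modelManAC (τ : DimType) (k m : ℕ) (hk : k ≤ m) : ManAC.{u} τ where
  carrier := ULift.{u} (orthant k m)
  secondCountable := Homeomorph.ulift.secondCountableTopology
  dims := τ.dims m
  allows := τ.allows_dims m
  atlas := aCompletion (τ.dims m) {modelChart k m hk}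
  maximal := by
    rw [isAAtlas_eq, aCompletion_eq]
    exact (isAtlas_modelChart k m hk).maximal_completion (τ.subset_dims m)

lemma modelChart_mem (τ : DimType) (k m : ℕ) (hk : k ≤ m) :
    modelChart.{u} k m hk ∈ (modelManAC.{u} τ k m hk).atlas := by
  change _ ∈ aCompletion (τ.dims m) {modelChart k m hk}
  rw [aCompletion_eq]
  exact (isAtlas_modelChart k m hk).subset_completion (τ.subset_dims m) rfl

lemma compatible_glue_modelChart {τ : DimType} {k m : ℕ} {hk : k ≤ m}
    {c : CornerChart (modelManAC.{u} τ k m hk).carrier}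
    (hc : c ∈ (modelManAC.{u} τ k m hk).gluedAtlas) :
    ∀ c' ∈ CornerChart.glue '' {modelChart.{u} k m hk}, cClass.Compatible c' c := by
  rintro _ ⟨_, rfl, rfl⟩
  exact ManAC.compatible_of_mem_gluedAtlas hc _ ⟨_, modelChart_mem τ k m hk, rfl⟩

/-- The map `φ⁻¹ : [0,∞) → ℝ`. -/
noncomputable def profileInvMap :
    C(ULift.{u} (orthant 1 1), ULift.{u} (orthant 0 1)) where
  toFun x := ⟨⟨fun _ => profileInv (x.down.1 0), fun _ h => absurd h (Nat.not_lt_zero _)⟩⟩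
  continuous_toFun := by
    refine continuous_uliftUp.comp (Continuous.subtype_mk (continuous_pi fun _ => ?_) _)
    refine profileInv_continuousOn.comp_continuous ?_ fun x => x.down.2 0 Nat.zero_lt_one
    exact (continuous_apply 0).comp (continuous_subtype_val.comp continuous_uliftDown)

lemma mem_repDomain_profileInvMap {x : Fin 1 → ℝ} (hx : x ∈ orthant 1 1) :
    x ∈ repDomain (modelChart.{u} 1 1 le_rfl) (modelChart.{u} 0 1 zero_le_one) profileInvMap :=
  ⟨hx, by rw [range_modelChart]; trivial⟩

lemma rep_profileInvMap {x : Fin 1 → ℝ} (hx : x ∈ orthant 1 1) :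
    rep (modelChart.{u} 1 1 le_rfl) (modelChart.{u} 0 1 zero_le_one) profileInvMap x =
      fun _ => profileInv (x 0) := by
  rw [rep_apply (c := modelChart.{u} 1 1 le_rfl) hx]
  exact (modelChart.{u} 0 1 zero_le_one).coord_toFun
    ⟨fun _ => profileInv (x 0), fun _ h => absurd h (Nat.not_lt_zero _)⟩

/-- `φ⁻¹` is not a-smooth. -/
lemma not_aSmoothFunOn_profileInv :
    ¬ ASmoothFunOn 1 (orthant 1 1) (fun x : Fin 1 → ℝ => profileInv (x 0)) := by
  intro h
  have h0 : (0 : Fin 1 → ℝ) ∈ orthant 1 1 := fun _ _ => le_rfl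
  obtain ⟨C, α, hC, hα, hb⟩ := h.decaysAt_of_vanishesOnFace (isOpenIn_orthant 1 1) (i := 0)
    Nat.zero_lt_one (fun x _ hx => by rw [hx, profileInv_zero]) h0 rfl
  -- Along x = φ(t) the decay bound would read t ≤ C φ(t)^α, which contradicts the flatness of φ.
  have ht : Tendsto (fun t : ℝ => (fun _ => profile t : Fin 1 → ℝ)) (𝓝[>] 0)
      (𝓝[orthant 1 1] 0) := by
    refine tendsto_nhdsWithin_iff.2 ⟨tendsto_pi_nhds.2 fun _ => ?_, ?_⟩
    · have := (profile_continuousOn 0 self_mem_Ici).tendsto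
      rw [profile_zero] at this
      exact this.mono_left (nhdsWithin_mono _ Ioi_subset_Ici_self)
    · exact Eventually.of_forall fun t _ _ => profile_nonneg t
  have h1 : Tendsto (fun t => C * (profile t ^ α * t⁻¹ ^ 1)) (𝓝[>] 0) (𝓝 (C * 0)) :=
    ((tendsto_profile_rpow_mul_inv_pow hα one_ne_zero).mono_left
      (nhdsWithin_mono _ Ioi_subset_Ici_self)).const_mul C
  rw [mul_zero] at h1
  obtain ⟨t, ⟨ht1, ht2⟩, ht0⟩ := ((ht.eventually hb).and
    (h1.eventually (gt_mem_nhds one_pos)) |>.and self_mem_nhdsWithin).exists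
  have ht0 : 0 < t := ht0
  have ht1 : |profileInv (profile t)| ≤ C * profile t ^ α := ht1
  rw [profileInv_profile ht0.le, abs_of_pos ht0] at ht1
  rw [pow_one, ← mul_assoc, ← div_eq_mul_inv, div_lt_one ht0] at ht2
  exact absurd ht1 (not_le.2 ht2)

/-- The source coordinate is reparametrised by φ and the target ℝ is not, so the representative is
φ⁻¹ ∘ φ. -/
lemma strongRep_glue_profileInvMap : cClass.StrongRep (modelChart.{u} 1 1 le_rfl).glue
    (modelChart.{u} 0 1 zero_le_one).glue profileInvMap := by
  have h : StronglyCSmooth 1 0 (glueSet 1 (orthant 1 1)) (id : (Fin 1 → ℝ) → _) :=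
    ⟨contDiffOn_id, fun u _ => ⟨univ, isOpen_univ, mem_univ u, fun j hj =>
      absurd hj (Nat.not_lt_zero _)⟩⟩
  have hd : repDomain (modelChart.{u} 1 1 le_rfl) (modelChart.{u} 0 1 zero_le_one)
      profileInvMap = orthant 1 1 :=
    Subset.antisymm (fun x hx => hx.1) fun x hx => mem_repDomain_profileInvMap hx
  have ho := (isOpenIn_orthant 1 1).glueSet
  have h2 := LocalClass.isMapWith_congr ho (stronglyCSmooth_iff.1 h)
    (f' := rep (modelChart.{u} 1 1 le_rfl).glue (modelChart.{u} 0 1 zero_le_one).glue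
      profileInvMap) fun x hx => by
    have hx' : x ∈ glueSet (modelChart.{u} 1 1 le_rfl).k (repDomain (modelChart.{u} 1 1 le_rfl)
      (modelChart.{u} 0 1 zero_le_one) profileInvMap) := by rw [hd]; exact hx
    rw [rep_glue hx']
    have e := rep_profileInvMap.{u} hx.2
    refine Eq.trans ?_ (congrArg (glueInv 0) e).symm
    refine funext fun j : Fin 1 => ?_
    obtain rfl : j = 0 := Subsingleton.elim _ _
    simp [glueInv, glueMap, profileInv_profile (hx.1 0 Nat.zero_lt_one)]
    rfl
  have hd' : repDomain (modelChart.{u} 1 1 le_rfl).glue (modelChart.{u} 0 1 zero_le_one).glue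
      profileInvMap = glueSet 1 (orthant 1 1) := by
    rw [repDomain_glue, hd]; rfl
  rw [LocalClass.StrongRep, hd']
  exact h2

/-- A preimage of the morphism φ⁻¹ would have φ⁻¹ as its underlying map and would make it a-smooth
in the model charts. -/
theorem gluingFunctor_not_full (τ : DimType) [(ManAC.stronglySmooth.{u} τ).IsMultiplicative]
    [(ManC.stronglySmooth.{u} τ).IsMultiplicative]
    (hobj : ∀ X : ManAC.{u} τ, Maximal (IsCAtlas X.dims) X.gluedAtlas)
    (hmap : ∀ (X Y : ManAC.{u} τ) (f : X ⟶ Y), ManAC.stronglySmooth τ f →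
      ManC.stronglySmooth τ (ManAC.glueHom f (hobj X) (hobj Y))) :
    ¬ (gluingFunctor τ hobj hmap).Full := by
  intro hfull
  let X : ManAC.{u} τ := modelManAC τ 1 1 le_rfl
  let Y : ManAC.{u} τ := modelManAC τ 0 1 zero_le_one
  let f : X ⟶ Y := profileInvMap
  have hf : ManC.stronglySmooth τ (ManAC.glueHom f (hobj X) (hobj Y)) := by
    rw [ManC.stronglySmooth_iff]
    intro c hc d hd
    refine LocalClass.strongRep_of_compatible (isAtlas_glue (isAtlas_modelChart.{u} 1 1 le_rfl))
      (isAtlas_glue (isAtlas_modelChart.{u} 0 1 zero_le_one)) (f := profileInvMap)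
      (ContinuousMap.continuous _) ?_ (compatible_glue_modelChart (τ := τ) hc)
      (compatible_glue_modelChart (τ := τ) hd)
    rintro _ ⟨_, rfl, rfl⟩ _ ⟨_, rfl, rfl⟩
    exact strongRep_glue_profileInvMap
  obtain ⟨g, hg⟩ := hfull.map_surjective (X := ⟨X⟩) (Y := ⟨Y⟩)
    ⟨ManAC.glueHom f (hobj X) (hobj Y), hf⟩
  have hgf : g.hom = f := congrArg (fun h => h.hom) hg
  have h1 := (ManAC.stronglySmooth_iff _).1 g.property _ (modelChart_mem τ 1 1 le_rfl) _
    (modelChart_mem τ 0 1 zero_le_one)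
  rw [hgf] at h1
  have h2 := (h1.2.1 (0 : Fin 1) (Nat.zero_le _))
  have hd : repDomain (modelChart.{u} 1 1 le_rfl) (modelChart.{u} 0 1 zero_le_one)
      profileInvMap = orthant 1 1 :=
    Subset.antisymm (fun x hx => hx.1) fun x hx => mem_repDomain_profileInvMap hx
  have h3 : ∀ V : Set (Fin 1 → ℝ), repDomain (modelChart.{u} 1 1 le_rfl)
      (modelChart.{u} 0 1 zero_le_one) profileInvMap = V → ASmoothFunOn 1 V
        (fun x => rep (modelChart.{u} 1 1 le_rfl) (modelChart.{u} 0 1 zero_le_one)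
          profileInvMap x (0 : Fin 1)) := by
    rintro _ rfl; exact h2
  refine not_aSmoothFunOn_profileInv ((h3 _ hd).congr (isOpenIn_orthant 1 1) fun x hx => ?_)
  exact congrFun (rep_profileInvMap hx) _

end ACorners

/-! ### The theorem. -/

theorem mainTheorem1 :
    -- `φ` is a homeomorphism of `[0,∞)` with the stated inverse
    (∃ e : Ici (0 : ℝ) ≃ₜ Ici (0 : ℝ),
      (∀ x, (e x : ℝ) = profile x) ∧ ∀ y, (e.symm y : ℝ) = profileInv y) ∧
    -- a-smooth functions become smooth, all their partial derivatives that involve a boundary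
    -- coordinate vanishing where that coordinate is zero
    (∀ (k m : ℕ), k ≤ m → ∀ U : Set (Fin m → ℝ), IsOpenIn k U → ∀ g : (Fin m → ℝ) → ℝ,
      ASmoothFunOn k U g →
        ContDiffOn ℝ ∞ (fun x => g (glueMap k x)) (glueSet k U) ∧
        ∀ x ∈ glueSet k U, ∀ (r : ℕ) (I : Fin r → Fin m),
          (∃ p, ((I p : Fin m) : ℕ) < k ∧ x (I p) = 0) →
            iteratedFDerivWithin ℝ r (fun x => g (glueMap k x)) (glueSet k U) x
              (fun p => Pi.single (I p) (1 : ℝ)) = 0) ∧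
    -- `Ψ(s,t) = φ⁻¹(s φ(t)^a)` is strongly smooth, in the coordinates `x = (t,s)`, and `~ t/a`
    (∀ a : ℝ, 0 < a →
      StronglyCSmooth 1 1 {x : Fin 2 → ℝ | 0 ≤ x 0 ∧ 0 < x 1}
        (fun x => (fun _ => profileInv (x 1 * profile (x 0) ^ a) : Fin 1 → ℝ)) ∧
      ∀ s : ℝ, 0 < s →
        Filter.Tendsto (fun t => profileInv (s * profile t ^ a) / t) (𝓝[>] 0) (𝓝 a⁻¹)) ∧
    -- the functor, for manifolds with a dimension and for manifolds of mixed dimension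
    (∀ τ : DimType,
      -- the reparametrised charts form an atlas, contained in a unique maximal atlas
      (∀ X : ManAC.{u} τ, IsCAtlas X.dims X.gluedCharts ∧
        X.gluedCharts ⊆ X.gluedAtlas ∧ Maximal (IsCAtlas X.dims) X.gluedAtlas ∧
        ∀ B, Maximal (IsCAtlas X.dims) B → X.gluedCharts ⊆ B → B = X.gluedAtlas) ∧
      ∃ (_ : (ManAC.stronglySmooth.{u} τ).IsMultiplicative)
        (_ : (ManC.stronglySmooth.{u} τ).IsMultiplicative)
        (hobj : ∀ X : ManAC.{u} τ, Maximal (IsCAtlas X.dims) X.gluedAtlas)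
        (hmap : ∀ (X Y : ManAC.{u} τ) (f : X ⟶ Y), ManAC.stronglySmooth τ f →
          ManC.stronglySmooth τ (ManAC.glueHom f (hobj X) (hobj Y))),
        (gluingFunctor τ hobj hmap).Faithful ∧
        ¬ (gluingFunctor τ hobj hmap).Full ∧
        ∀ (X Y : WideSubcategory (ManAC.stronglySmooth.{u} τ)) (f : X ⟶ Y),
          ManAC.interior τ f.hom → ManC.interior τ ((gluingFunctor τ hobj hmap).map f).hom) ∧
    -- manifolds with a dimension form full subcategories of those of mixed dimension, and the
    -- functor for mixed dimensions extends the one for manifolds with a dimension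
    (∃ (hA : ∀ X : ManAC.{u} .pure, Maximal (IsAAtlas univ) (aCompletion univ X.atlas))
        (hC : ∀ X : ManC.{u} .pure, Maximal (IsCAtlas univ) (cCompletion univ X.atlas))
        (hobj : ∀ (τ : DimType) (X : ManAC.{u} τ), Maximal (IsCAtlas X.dims) X.gluedAtlas),
        (∀ (X Y : ManAC.{u} .pure) (f : X ⟶ Y), ManAC.stronglySmooth .pure f ↔
          ManAC.stronglySmooth .mixed (ManAC.toMixedHom f (hA X) (hA Y))) ∧
        (∀ (X Y : ManC.{u} .pure) (f : X ⟶ Y), ManC.stronglySmooth .pure f ↔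
          ManC.stronglySmooth .mixed (ManC.toMixedHom f (hC X) (hC Y))) ∧
        ∀ X : ManAC.{u} .pure,
          (X.toMixed (hA X)).glue (hobj .mixed (X.toMixed (hA X))) =
            (X.glue (hobj .pure X)).toMixed (hC (X.glue (hobj .pure X)))) := by
  refine ⟨⟨profileIso.toHomeomorph, fun _ => rfl, fun _ => rfl⟩, ?_, ?_, ?_, ?_⟩
  · intro k m _ U hU g hg
    refine ⟨hg.contDiffOn_glue hU, fun x hx r I => ?_⟩
    rintro ⟨p, hp, hxp⟩
    rw [← glueTerm_zero]
    exact hg.isGluePair.iteratedFDerivWithin_eq_zero hU I hx hp hxp (Or.inl ⟨p, rfl⟩)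
  · exact fun a ha => ⟨stronglyCSmooth_psi ha, fun s hs => tendsto_psi_div ha hs⟩
  · intro τ
    have := ManAC.isMultiplicative_stronglySmooth.{u} τ
    have := ManC.isMultiplicative_stronglySmooth.{u} τ
    refine ⟨ManAC.gluedAtlas_spec, ManAC.isMultiplicative_stronglySmooth τ,
      ManC.isMultiplicative_stronglySmooth τ, ManAC.maximal_gluedAtlas,
      fun X Y f hf => ManAC.stronglySmooth_glueHom f hf _ _, ⟨fun {X Y f g} h => ?_⟩,
      gluingFunctor_not_full τ _ _, fun X Y f hf =>
        ManAC.interior_glueHom f.hom f.property hf _ _⟩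
    exact WideSubcategory.hom_ext _ (congrArg (fun h => h.hom) h)
  · exact ⟨ManAC.maximal_toMixed, ManC.maximal_toMixed, fun _ => ManAC.maximal_gluedAtlas,
      fun X Y f => ManAC.stronglySmooth_toMixedHom_iff f _ _,
      fun X Y f => ManC.stronglySmooth_toMixedHom_iff f _ _, fun X => X.glue_toMixed _ _ _ _⟩
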